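/- **Model.** In the (randomized) CONGEST model a network is a simple graph whose nodes have distinct identifiers; all nodes compute in synchronous rounds, and in each round every node may send one message to each neighbour. A node initially knows its own identifier and those of its neighbours, draws fresh private uniform randomness from a finite set in every round, and local computation is free. Fix integers $\kappa,\beta\ge 1$. For integers $n,D,\Delta$ let $\mathcal G(n,D,\Delta)$ be the class of networks whose graph has at least three and at most $n$ vertices, is $2$-vertex connected (it stays connected after the removal of any one vertex), and has diameter at most $D$ and maximum degree at most $\Delta$, with arbitrary distinct identifiers of $\kappa\log_2 n$ bits (numbers below $n^\kappa$). Algorithms for $\mathcal G(n,D,\Delta)$ may depend on $n,D,\Delta$ and use messages of $\beta\log_2 n$ bits (alphabet of size $n^\beta$, or no message). **Structures.** A $(d,c)$-cycle cover of $G$ is a family of cycles of $G$, each of length at most $d$, such that every edge lies on at least one and at most $c$ cycles of the family. It is output distributedly: the cycles are labelled, and each node knows, for each incident edge, the labels of the cycles through that edge. $(d,c)$-private neighbourhood trees of $G=(V,E)$ are subtrees $T(u)\subseteq G$, $u\in V$, such that $T(u)$ contains all neighbours of $u$ but not $u$ itself, $T(u)$ has diameter at most $d$, and every edge of $G$ appears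 in at most $c$ of the trees. They are output distributedly: each tree is rooted, and each node knows, for every $v\in V$, its parent in $T(v)$ (if it has one). **Lemma.** There are constants $K,k$, depending only on $\kappa$ and $\beta$, such that for all $n,D,\Delta,d,c,r$ and every real $\delta$ the following holds. Suppose that there is an $r$-round distributed algorithm that, on every network of $\mathcal G(n^2,3D+2,\Delta)$, constructs a $(d,c)$-cycle cover with failure probability at most $\delta$. Then there is a distributed algorithm that, on every network of $\mathcal G(n,D,\Delta)$, constructs $$\bigl(d\,\Delta,\; c\,d\,\lfloor\log_2\Delta\rfloor\bigr)\text{-private neighbourhood trees}$$ with failure probability at most $\lfloor\log_2\Delta\rfloor\,\delta$, in at most $$K\,(\lfloor\log_2 n\rfloor+1)^{k}\,(r+d\,c)$$ rounds, that is, in $\widetilde O(r+d\,c)$ rounds; in particular, in $r\cdot\widetilde O(d\,c)$ rounds if $r\ge 1$. -/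

import Mathlib

namespace PrivateTrees

/-! ### Graph-theoretic notions -/

/-- `G` is 2-vertex connected: it has at least three vertices and stays connected after the removal
of any single vertex. -/
def TwoVertexConnected {V : Type} [Fintype V] (G : SimpleGraph V) : Prop :=
  3 ≤ Fintype.card V ∧ ∀ u : V, (G.induce ({u}ᶜ : Set V)).Connected

/-- The family `C i`, `i ∈ I`, of edge sets is a `(d, c)`-cycle cover of `G`: every member is the
edge set of a (simple) cycle of `G` of length at most `d`, and every edge of `G` lies on at least
one and at most `c` members of the family. -/
def IsCycleCover {V : Type} (G : SimpleGraph V) (d c : ℕ) {ι : Type} (I : Finset ι)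
    (C : ι → Set (Sym2 V)) : Prop :=
  (∀ i ∈ I, ∃ (v : V) (p : G.Walk v v), p.IsCycle ∧ p.length ≤ d ∧ C i = {e | e ∈ p.edges}) ∧
  ∀ e ∈ G.edgeSet, 1 ≤ {i | i ∈ I ∧ e ∈ C i}.ncard ∧ {i | i ∈ I ∧ e ∈ C i}.ncard ≤ c

/-- The subgraphs `T u` are `(d, c)`-private neighbourhood trees of `G`: `T u` is a tree of diameter
at most `d` that contains all neighbours of `u` but not `u`, and every edge of `G` appears in at
most `c` of the trees. -/
def IsPrivateNeighborhoodTrees {V : Type} (G : SimpleGraph V) (d c : ℕ)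
    (T : V → G.Subgraph) : Prop :=
  (∀ u, (T u).coe.IsTree ∧ G.neighborSet u ⊆ (T u).verts ∧ u ∉ (T u).verts ∧
    (T u).coe.diam ≤ d) ∧
  ∀ e ∈ G.edgeSet, {u | e ∈ (T u).edgeSet}.ncard ≤ c

/-- In the tree `T` rooted at `ρ`, the vertex `p` is the parent of `w`. -/
def IsParent {V : Type} {G : SimpleGraph V} (T : G.Subgraph) (ρ w p : V) : Prop :=
  T.Adj w p ∧ T.spanningCoe.dist ρ w = T.spanningCoe.dist ρ p + 1

/-! ### The synchronous message passing model with bounded messages -/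

/-- An `r`-round randomized distributed algorithm whose messages are taken from an alphabet of `M`
letters (`none` stands for "no message"). Initially a node knows its own identifier and those of its
neighbours. In round `i` it gets its state, the messages received from its neighbours (indexed by
the identifier of the sender) and fresh private randomness, uniform in the finite set `Seed`, and
it computes its new state and its outgoing messages (indexed by the identifier of the receiver).
Local computation is free. -/
structure Algorithm (r M : ℕ) (Out : Type) where
  State : Type
  Seed : Type
  seedFinite : Finite Seed
  seedNonempty : Nonempty Seed
  init : ℕ → Finset ℕ → State
  step : Fin r → State → (ℕ → Option (Fin M)) → Seed → State × (ℕ → Option (Fin M))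
  output : State → Out

/-- The messages that `v` receives, indexed by the identifier of the sender, when every node `u`
has prepared the messages `out u`. -/
noncomputable def inbox {V : Type} {M : ℕ} (G : SimpleGraph V) (ident : V → ℕ)
    (out : V → ℕ → Option (Fin M)) (v : V) : ℕ → Option (Fin M) :=
  open Classical in
  fun x => if h : ∃ u, G.Adj v u ∧ ident u = x then out h.choose (ident v) else none

/-- The identifiers of the neighbours of `v`. -/
noncomputable def neighborIdents {V : Type} [Fintype V] (G : SimpleGraph V) (ident : V → ℕ)
    (v : V) : Finset ℕ :=
  open Classical in
  (Finset.univ.filter (fun u => G.Adj v u)).image ident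

namespace Algorithm

variable {r M : ℕ} {Out : Type}

/-- State and outgoing messages of every node after `t` rounds; `ω v i` is the randomness of `v` in
round `i`. -/
noncomputable def config (A : Algorithm r M Out) {V : Type} [Fintype V] (G : SimpleGraph V)
    (ident : V → ℕ) (ω : V → Fin r → A.Seed) : ℕ → V → A.State × (ℕ → Option (Fin M))
  | 0 => fun v => (A.init (ident v) (neighborIdents G ident v), fun _ => none)
  | t + 1 => fun v =>
      if h : t < r then
        A.step ⟨t, h⟩ (A.config G ident ω t v).1
          (inbox G ident (fun u => (A.config G ident ω t u).2) v) (ω v ⟨t, h⟩)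
      else A.config G ident ω t v

/-- The outputs of all nodes after `r` rounds. -/
noncomputable def result (A : Algorithm r M Out) {V : Type} [Fintype V] (G : SimpleGraph V)
    (ident : V → ℕ) (ω : V → Fin r → A.Seed) (v : V) : Out :=
  A.output (A.config G ident ω r v).1

/-- The probability, over the independent uniform private randomness of all nodes in all rounds,
that the outputs violate `P`. -/
noncomputable def failureProb (A : Algorithm r M Out) {V : Type} [Fintype V] (G : SimpleGraph V)
    (ident : V → ℕ) (P : (V → Out) → Prop) : ℝ :=
  (Nat.card {ω : V → Fin r → A.Seed // ¬ P (A.result G ident ω)} : ℝ) /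
    (Nat.card (V → Fin r → A.Seed) : ℝ)

end Algorithm

/-- Input networks with parameters `n`, `D`, `Δ`: a 2-vertex connected graph with at most `n`
vertices, diameter at most `D` and maximum degree at most `Δ`, with arbitrary distinct identifiers
of `κ log n` bits. -/
def IsNetwork (n D Δ κ : ℕ) {V : Type} [Fintype V] (G : SimpleGraph V) (ident : V → ℕ) : Prop :=
  TwoVertexConnected G ∧ Fintype.card V ≤ n ∧ G.diam ≤ D ∧
    (∀ v, (G.neighborSet v).ncard ≤ Δ) ∧ Function.Injective ident ∧ ∀ v, ident v < n ^ κ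

/-- Distributed output of a cycle cover: the cycles carry labels (natural numbers), and each node
knows, for each of its incident edges (given by the identifier of the other endpoint), the set of
the labels of the cycles through this edge. -/
def IsCycleCoverOutput {V : Type} (G : SimpleGraph V) (ident : V → ℕ) (d c : ℕ)
    (out : V → ℕ → Finset ℕ) : Prop :=
  ∃ (I : Finset ℕ) (C : ℕ → Set (Sym2 V)), IsCycleCover G d c I C ∧
    ∀ u v, G.Adj u v → ∀ l, l ∈ out u (ident v) ↔ l ∈ I ∧ s(u, v) ∈ C l

/-- Distributed output of private neighbourhood trees: every tree is rooted, and each node `w`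
knows, for every node `v` (given by its identifier), the identifier of its parent in `T v`; the
value is `none` if there is no parent, that is, if `w` is the root of `T v` or is not in `T v`. -/
def IsPrivateTreesOutput {V : Type} (G : SimpleGraph V) (ident : V → ℕ) (d c : ℕ)
    (out : V → ℕ → Option ℕ) : Prop :=
  ∃ T : V → G.Subgraph, IsPrivateNeighborhoodTrees G d c T ∧
    (∀ v, ∃ ρ ∈ (T v).verts, ∀ w,
      (∃ p, IsParent (T v) ρ w p ∧ out w (ident v) = some (ident p)) ∨
      ((w = ρ ∨ w ∉ (T v).verts) ∧ out w (ident v) = none)) ∧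
    ∀ w x, (∀ v, ident v ≠ x) → out w x = none

/-- `A` constructs `(d, c)`-cycle covers, with failure probability at most `δ`, on all networks
with parameters `n`, `D`, `Δ`. -/
def ConstructsCycleCovers {r M : ℕ} (A : Algorithm r M (ℕ → Finset ℕ)) (n D Δ κ d c : ℕ)
    (δ : ℝ) : Prop :=
  ∀ (V : Type) [Fintype V] (G : SimpleGraph V) (ident : V → ℕ), IsNetwork n D Δ κ G ident →
    A.failureProb G ident (IsCycleCoverOutput G ident d c) ≤ δ

/-- `B` constructs `(d, c)`-private neighbourhood trees, with failure probability at most `δ`, on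
all networks with parameters `n`, `D`, `Δ`. -/
def ConstructsPrivateTrees {r M : ℕ} (B : Algorithm r M (ℕ → Option ℕ)) (n D Δ κ d c : ℕ)
    (δ : ℝ) : Prop :=
  ∀ (V : Type) [Fintype V] (G : SimpleGraph V) (ident : V → ℕ), IsNetwork n D Δ κ G ident →
    B.failureProb G ident (IsPrivateTreesOutput G ident d c) ≤ δ

end PrivateTrees

namespace PrivateTrees

/-! ### Splitting the vertices of a graph -/

section Split

variable {V : Type} {G : SimpleGraph V} {ident : V → ℕ} {rep : V → ℕ → ℕ}

/-! The construction runs in `L` phases, where `L` is the smaller of `⌊log₂ Δ⌋` and `⌊log₂ n⌋`. In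
each phase every node `u` has a partition of its neighbours into at least two classes. Replace `u`
by a star: a centre, and one leaf for each class, to which the edges from `u` into that class are
attached. This split graph is again 2-vertex connected, has at most `n ^ 2` vertices, diameter at
most `3 * D + 2` and maximum degree at most `Δ` (`IsSplitting.isNetwork`). Hence the given algorithm
applies to it. The nodes of `G` simulate it, each computing for its whole star; every edge of `G`
carries exactly one edge between stars, so the simulation causes no congestion
(`IsClusterInfo.received_eq`, `simOutput_eq`).

A covering cycle through the edge from the centre of `u` to the leaf of a class leaves the star from
that leaf and returns first at a different leaf (`IsCoverInfo.exists_segment`). The part in between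
is a walk in `G - u` of fewer than `d` steps from a neighbour in this class to a neighbour in
another class: a link. The classes of the next phase come from the equivalence relation generated by
all links found so far, so as long as more than one class remains, every class merges with another
one and the minimal class size doubles (`rel_of_merge`). The degree is below `2 ^ (L + 1)`, so after
`L` phases all neighbours of `u` are linked. Nodes find their links by sending tokens around the
cycles and absorbing their own tokens when they come back (`IsCoverInfo.tokenRun_eq_some`,
`IsCoverInfo.isLink_iff`).

For the tree of `u`, the node `u` chooses fewer than `deg u` links that explore its neighbourhood
step by step, and sends tokens along them that carry the position `j` of the link. A vertex that
such a token reaches in step `s` counts as visited at time `j * d + s`, and its parent is the sender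
of its earliest visit. First visits have distinct times below `d * Δ`, and parents are visited
earlier; this gives a tree that avoids `u`, contains its neighbours and has the required diameter
(`isVisitPlan`, `IsVisitPlan.exists_tree`). An edge of `G` is one edge of each split graph, lies
there on at most `c` cycles, and each cycle meets at most `d` stars, so the edge is in at most `c *
d * L` trees (`ncard_visit_le`).

The phases use separate seeds, and the split graph of a phase is determined by the seeds of the
earlier ones. Conditioned on all other seeds, a phase is thus a run of the given algorithm on a
fixed network and fails with probability at most `δ`; a union bound finishes the argument
(`card_not_finalOutput_le`). A phase costs `O(r + d * c)` rounds. -/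

/-- `rep u` partitions the neighbours of `u` (given by their identifiers) into at least two classes;
the name of a class is the identifier of a neighbour of `u`. -/
structure IsSplitting (G : SimpleGraph V) (ident : V → ℕ) (rep : V → ℕ → ℕ) : Prop where
  exists_ident : ∀ u v, G.Adj u v → ∃ w, G.Adj u w ∧ rep u (ident v) = ident w
  exists_ne : ∀ u, ∃ v w, G.Adj u v ∧ G.Adj u w ∧ rep u (ident v) ≠ rep u (ident w)

/-- The vertices of the split graph: every vertex `u` is replaced by a centre `(u, ident u)` and by
one vertex `(u, a)` for every class `a` of its neighbours. -/
def SplitVertex (G : SimpleGraph V) (ident : V → ℕ) (rep : V → ℕ → ℕ) : Type :=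
  {q : V × ℕ // q.2 = ident q.1 ∨ ∃ x, G.Adj q.1 x ∧ rep q.1 (ident x) = q.2}

namespace SplitVertex

/-- The vertex of the original graph to which a vertex of the split graph belongs. -/
def base (q : SplitVertex G ident rep) : V := q.1.1

/-- The name of a vertex of the split graph among those with the same base. -/
def name (q : SplitVertex G ident rep) : ℕ := q.1.2

theorem ext' {p q : SplitVertex G ident rep} (h₁ : p.base = q.base) (h₂ : p.name = q.name) :
    p = q :=
  Subtype.ext (Prod.ext h₁ h₂)

/-- The centre of the cluster of `u`. -/
def center (u : V) : SplitVertex G ident rep := ⟨(u, ident u), Or.inl rfl⟩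

/-- The endpoint in the cluster of `u` of the edge that corresponds to the edge from `u` to `v`. -/
def port {u v : V} (h : G.Adj u v) : SplitVertex G ident rep :=
  ⟨(u, rep u (ident v)), Or.inr ⟨v, h, rfl⟩⟩

theorem name_cases (q : SplitVertex G ident rep) :
    q.name = ident q.base ∨ ∃ x, G.Adj q.base x ∧ rep q.base (ident x) = q.name := q.2

theorem eq_center_or_port (q : SplitVertex G ident rep) :
    q = center q.base ∨ ∃ (x : V) (h : G.Adj q.base x), q = port h := by
  rcases q.2 with h | ⟨x, hx, h⟩
  · exact Or.inl (ext' rfl h)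
  · exact Or.inr ⟨x, hx, ext' rfl h.symm⟩

@[simp] theorem base_center (u : V) : (center u : SplitVertex G ident rep).base = u := rfl
@[simp] theorem name_port {u v : V} (h : G.Adj u v) :
    (port h : SplitVertex G ident rep).name = rep u (ident v) := rfl

end SplitVertex

open SplitVertex

/-- The split graph: centres are joined to the class vertices of their clusters, and every edge
`u v` of `G` joins the classes to which the endpoints assign each other. -/
def splitGraph (G : SimpleGraph V) (ident : V → ℕ) (rep : V → ℕ → ℕ) :
    SimpleGraph (SplitVertex G ident rep) where
  Adj p q := (p.base = q.base ∧ p.name ≠ q.name ∧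
      (p.name = ident p.base ∨ q.name = ident q.base)) ∨
    (G.Adj p.base q.base ∧ p.name = rep p.base (ident q.base) ∧
      q.name = rep q.base (ident p.base))
  symm := ⟨by
    rintro p q (⟨h₁, h₂, h₃⟩ | ⟨h₁, h₂, h₃⟩)
    · exact Or.inl ⟨h₁.symm, h₂.symm, h₃.symm⟩
    · exact Or.inr ⟨h₁.symm, h₃, h₂⟩⟩
  loopless := ⟨by
    rintro p (⟨_, h₂, _⟩ | ⟨h₁, _, _⟩)
    · exact h₂ rfl
    · exact G.irrefl h₁⟩

/-- The identifiers of the vertices of the split graph. -/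
def splitIdent (N : ℕ) (G : SimpleGraph V) (ident : V → ℕ) (rep : V → ℕ → ℕ)
    (q : SplitVertex G ident rep) : ℕ := ident q.base * N + q.name

theorem splitGraph_adj_port {u v : V} (h : G.Adj u v) :
    (splitGraph G ident rep).Adj (port h) (port h.symm) := Or.inr ⟨h, rfl, rfl⟩

theorem eq_port_of_adj {p q : SplitVertex G ident rep} (h : (splitGraph G ident rep).Adj p q)
    (hne : p.base ≠ q.base) : ∃ hG : G.Adj p.base q.base, p = port hG ∧ q = port hG.symm := by
  rcases h with h | h
  · exact absurd h.1 hne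
  · exact ⟨h.1, ext' rfl h.2.1, ext' rfl h.2.2⟩

variable (hs : IsSplitting G ident rep)
include hs

/-- Class names are identifiers of neighbours, so every name is an identifier of a vertex of `G`.
This keeps names below `N`, which makes them base-`N` digits in `splitIdent`, and bounds the number
of split vertices by the number of pairs of vertices. -/
theorem IsSplitting.exists_name (q : SplitVertex G ident rep) :
    ∃ w, q.name = ident w ∧ (w = q.base ∨ G.Adj q.base w) := by
  rcases q.name_cases with h | ⟨x, hx, h⟩
  · exact ⟨_, h, Or.inl rfl⟩
  · obtain ⟨w, hw, e⟩ := hs.exists_ident _ _ hx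
    exact ⟨w, h ▸ e, Or.inr hw⟩

theorem IsSplitting.rep_ne (hi : Function.Injective ident) {u v : V} (h : G.Adj u v) :
    rep u (ident v) ≠ ident u := by
  obtain ⟨w, hw, e⟩ := hs.exists_ident _ _ h
  rw [e]
  exact fun h' => G.ne_of_adj hw (hi h').symm

theorem IsSplitting.adj_center_port (hi : Function.Injective ident) {u v : V} (h : G.Adj u v) :
    (splitGraph G ident rep).Adj (center u) (port h) :=
  Or.inl ⟨rfl, (hs.rep_ne hi h).symm, Or.inl rfl⟩

theorem IsSplitting.injective_splitIdent {N : ℕ} (hi : Function.Injective ident)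
    (hN : ∀ v, ident v < N) : Function.Injective (splitIdent N G ident rep) := by
  intro p q h
  obtain ⟨v, hv, -⟩ := hs.exists_name p
  obtain ⟨w, hw, -⟩ := hs.exists_name q
  have h₁ : p.name < N := hv ▸ hN v
  have h₂ : q.name < N := hw ▸ hN w
  have hpos : 0 < N := by omega
  unfold splitIdent at h
  have e₂ : p.name = q.name := by
    have := congrArg (· % N) h
    simpa [Nat.mul_add_mod', Nat.mod_eq_of_lt, h₁, h₂] using this
  have e₁ : ident p.base = ident q.base := by
    rw [e₂] at h
    exact Nat.eq_of_mul_eq_mul_right hpos (Nat.add_right_cancel h)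
  exact ext' (hi e₁) e₂

theorem IsSplitting.splitIdent_lt {N : ℕ} (hN : ∀ v, ident v < N)
    (q : SplitVertex G ident rep) : splitIdent N G ident rep q < N * N := by
  obtain ⟨v, hv, -⟩ := hs.exists_name q
  have h₁ : q.name < N := hv ▸ hN v
  have h₂ := hN q.base
  unfold splitIdent
  nlinarith

theorem IsSplitting.splitIdent_div {N : ℕ} (hN : ∀ v, ident v < N)
    (q : SplitVertex G ident rep) : splitIdent N G ident rep q / N = ident q.base := by
  obtain ⟨v, hv, -⟩ := hs.exists_name q
  have h₁ : q.name < N := hv ▸ hN v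
  unfold splitIdent
  rw [Nat.mul_comm, Nat.mul_add_div (by omega), Nat.div_eq_of_lt h₁, Nat.add_zero]

theorem IsSplitting.splitIdent_mod {N : ℕ} (hN : ∀ v, ident v < N)
    (q : SplitVertex G ident rep) : splitIdent N G ident rep q % N = q.name := by
  obtain ⟨v, hv, -⟩ := hs.exists_name q
  have h₁ : q.name < N := hv ▸ hN v
  unfold splitIdent
  rw [Nat.mul_add_mod', Nat.mod_eq_of_lt h₁]

/-- A vertex of the split graph, as a pair of vertices of the original graph. -/
noncomputable def IsSplitting.toProd (q : SplitVertex G ident rep) : V × V :=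
  (q.base, (hs.exists_name q).choose)

theorem IsSplitting.injective_toProd : Function.Injective hs.toProd := by
  intro p q h
  have h₁ : p.base = q.base := congrArg (Prod.fst : V × V → V) h
  have h₂ : (hs.exists_name p).choose = (hs.exists_name q).choose :=
    congrArg (Prod.snd : V × V → V) h
  refine ext' h₁ ?_
  rw [(hs.exists_name p).choose_spec.1, (hs.exists_name q).choose_spec.1, h₂]

theorem IsSplitting.finite [Finite V] : Finite (SplitVertex G ident rep) :=
  Finite.of_injective _ hs.injective_toProd

/-! ### 2-vertex connectivity of the split graph. -/

/-- Removing `z` damages only one cluster. A survivor in another cluster is its centre or adjacent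
to it; a survivor in the damaged cluster escapes through a leaf other than `z` along an edge of `G`.
-/
theorem IsSplitting.reachable_center [Fintype V] (hi : Function.Injective ident)
    (z : SplitVertex G ident rep) (q : SplitVertex G ident rep) (hq : q ≠ z) :
    ∃ (v : V) (hv : v ≠ z.base), ((splitGraph G ident rep).induce {z}ᶜ).Reachable ⟨q, hq⟩
      ⟨center v, fun h => hv (congrArg base h)⟩ := by
  have key : ∀ (v x : V) (h : G.Adj v x) (hne : (port h : SplitVertex G ident rep) ≠ z)
      (hv : v ≠ z.base), ((splitGraph G ident rep).induce {z}ᶜ).Adj ⟨port h, hne⟩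
      ⟨center v, fun h => hv (congrArg base h)⟩ := fun v x h hne hv =>
    (hs.adj_center_port hi h).symm
  have key2 : ∀ (x : V) (h : G.Adj z.base x) (hne : (port h : SplitVertex G ident rep) ≠ z),
      ((splitGraph G ident rep).induce {z}ᶜ).Reachable ⟨port h, hne⟩
      ⟨center x, fun h' => h.ne' (congrArg base h')⟩ := by
    intro x h hne
    have h₁ : ((splitGraph G ident rep).induce {z}ᶜ).Adj ⟨port h, hne⟩
        ⟨port h.symm, fun h' => h.ne' (congrArg base h')⟩ := splitGraph_adj_port h
    exact h₁.reachable.trans (key x _ h.symm _ h.ne').reachable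
  by_cases hb : q.base = z.base
  · obtain h | ⟨x, hx, h⟩ := q.eq_center_or_port
    · obtain ⟨v, w, hv, hw, hvw⟩ := hs.exists_ne q.base
      obtain ⟨x, hx, hxz⟩ : ∃ (x : V) (hx : G.Adj q.base x),
          (port hx : SplitVertex G ident rep) ≠ z := by
        by_contra! hcon
        exact hvw ((congrArg name (hcon v hv)).trans (congrArg name (hcon w hw)).symm)
      have h₁ : ((splitGraph G ident rep).induce {z}ᶜ).Adj ⟨q, hq⟩ ⟨port hx, hxz⟩ := by
        have := hs.adj_center_port hi hx
        rw [← h] at this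
        exact this
      -- Ports carry `q.base` in their type; once it is a variable, it can be replaced by `z.base`.
      generalize q.base = u at *
      subst hb
      exact ⟨x, hx.ne', h₁.reachable.trans (key2 x hx hxz)⟩
    · have hq' : (port hx : SplitVertex G ident rep) ≠ z := h ▸ hq
      have e : (⟨q, hq⟩ : ({z}ᶜ : Set _)) = ⟨port hx, hq'⟩ := Subtype.ext h
      rw [e]
      clear e h hq
      generalize q.base = u at *
      subst hb
      exact ⟨x, hx.ne', key2 x hx hq'⟩
  · refine ⟨q.base, hb, ?_⟩
    obtain h | ⟨x, hx, h⟩ := q.eq_center_or_port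
    · rw [show (⟨q, hq⟩ : ({z}ᶜ : Set _)) = ⟨center q.base,
        fun h : center q.base = z => hb ((base_center _).symm.trans (congrArg base h))⟩
        from Subtype.ext h]
    · have : (⟨q, hq⟩ : ({z}ᶜ : Set _)) = ⟨port hx, h ▸ hq⟩ := Subtype.ext h
      rw [this]
      exact (key _ _ hx _ hb).reachable

/-- A walk in `G` that avoids `z.base` lifts to the split graph, one edge becoming centre, port,
port, centre, and the lift avoids the whole cluster of `z`. -/
theorem IsSplitting.reachable_center_center [Fintype V] (hi : Function.Injective ident)
    (hG : TwoVertexConnected G) (z : SplitVertex G ident rep) {v w : V} (hv : v ≠ z.base)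
    (hw : w ≠ z.base) : ((splitGraph G ident rep).induce {z}ᶜ).Reachable
      ⟨center v, fun h => hv (congrArg base h)⟩ ⟨center w, fun h => hw (congrArg base h)⟩ := by
  obtain ⟨p⟩ := (hG.2 z.base).preconnected ⟨v, hv⟩ ⟨w, hw⟩
  have : ∀ (a b : ({z.base}ᶜ : Set V)) (p : (G.induce ({z.base}ᶜ : Set V)).Walk a b),
      ((splitGraph G ident rep).induce {z}ᶜ).Reachable
      ⟨center a.1, fun h => a.2 (congrArg base h)⟩
      ⟨center b.1, fun h => b.2 (congrArg base h)⟩ := by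
    intro a b p
    induction p with
    | nil => exact SimpleGraph.Reachable.refl _
    | @cons a b' c h p ih =>
      refine SimpleGraph.Reachable.trans ?_ ih
      have hab : G.Adj a.1 b'.1 := h
      have h₁ : ((splitGraph G ident rep).induce {z}ᶜ).Adj
          ⟨center a.1, fun h => a.2 (congrArg base h)⟩
          ⟨port hab, fun h => a.2 (congrArg base h)⟩ := hs.adj_center_port hi hab
      have h₂ : ((splitGraph G ident rep).induce {z}ᶜ).Adj
          ⟨port hab, fun h => a.2 (congrArg base h)⟩
          ⟨port hab.symm, fun h => b'.2 (congrArg base h)⟩ := splitGraph_adj_port hab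
      have h₃ : ((splitGraph G ident rep).induce {z}ᶜ).Adj
          ⟨port hab.symm, fun h => b'.2 (congrArg base h)⟩
          ⟨center b'.1, fun h => b'.2 (congrArg base h)⟩ :=
        (hs.adj_center_port hi hab.symm).symm
      exact h₁.reachable.trans (h₂.reachable.trans h₃.reachable)
  exact this _ _ p

omit hs in
theorem TwoVertexConnected.exists_ne_ne [Fintype V] (hG : TwoVertexConnected G) (u v : V) :
    ∃ w, w ≠ u ∧ w ≠ v := by
  classical
  by_contra! h
  have : (Finset.univ : Finset V) ⊆ {u, v} := by
    intro w _
    by_cases hw : w = u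
    · simp [hw]
    · simp [h w hw]
  have h₁ := Finset.card_le_card this
  have h₂ := Finset.card_le_two (a := u) (b := v)
  have h₃ := hG.1
  rw [Finset.card_univ] at h₁
  omega

omit hs in
theorem TwoVertexConnected.connected [Fintype V] (hG : TwoVertexConnected G) : G.Connected := by
  have : Nonempty V := by
    have := hG.1
    exact Fintype.card_pos_iff.1 (by omega)
  refine ⟨fun u v => ?_⟩
  obtain ⟨w, hu, hv⟩ := hG.exists_ne_ne u v
  have := (hG.2 w).preconnected ⟨u, hu.symm⟩ ⟨v, hv.symm⟩
  exact this.map (SimpleGraph.Embedding.induce _).toHom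

theorem IsSplitting.twoVertexConnected [Fintype V] [Fintype (SplitVertex G ident rep)]
    (hi : Function.Injective ident) (hG : TwoVertexConnected G) :
    TwoVertexConnected (splitGraph G ident rep) := by
  refine ⟨hG.1.trans (Fintype.card_le_of_injective center fun u v h => congrArg base h),
    fun z => ?_⟩
  obtain ⟨v, hv, -⟩ := hG.exists_ne_ne z.base z.base
  have : Nonempty ({z}ᶜ : Set (SplitVertex G ident rep)) :=
    ⟨⟨center v, fun h => hv (congrArg base h)⟩⟩
  refine ⟨fun p q => ?_⟩
  obtain ⟨v, hv, h₁⟩ := hs.reachable_center hi z p.1 p.2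
  obtain ⟨w, hw, h₂⟩ := hs.reachable_center hi z q.1 q.2
  exact h₁.trans ((hs.reachable_center_center hi hG z hv hw).trans h₂.symm)

/-! ### Diameter and degrees of the split graph. -/

theorem IsSplitting.exists_walk_center (hi : Function.Injective ident) {u v : V}
    (p : G.Walk u v) :
    ∃ w : (splitGraph G ident rep).Walk (center u) (center v), w.length = 3 * p.length := by
  induction p with
  | nil => exact ⟨.nil, rfl⟩
  | cons h p ih =>
    obtain ⟨w, hw⟩ := ih
    refine ⟨.cons (hs.adj_center_port hi h) (.cons (splitGraph_adj_port h)
      (.cons (hs.adj_center_port hi h.symm).symm w)), ?_⟩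
    simp only [SimpleGraph.Walk.length_cons, hw]
    ring

theorem IsSplitting.exists_walk_to_center (hi : Function.Injective ident)
    (q : SplitVertex G ident rep) :
    ∃ w : (splitGraph G ident rep).Walk q (center q.base), w.length ≤ 1 := by
  obtain h | ⟨x, hx, h⟩ := q.eq_center_or_port
  · exact ⟨.copy .nil rfl h, by simp⟩
  · have h₁ : (splitGraph G ident rep).Adj q (center q.base) := by
      have := (hs.adj_center_port hi hx).symm
      rwa [← h] at this
    exact ⟨.cons h₁ .nil, by simp⟩

/-- Every edge of a shortest walk in `G` lifts to three edges between centres, and each of the two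
ends is at most one step from its centre. -/
theorem IsSplitting.diam_le [Fintype V] (hi : Function.Injective ident)
    (hG : G.Connected) {D : ℕ} (hD : G.diam ≤ D) :
    (splitGraph G ident rep).diam ≤ 3 * D + 2 := by
  have : Nonempty V := hG.nonempty
  have : Finite (SplitVertex G ident rep) := hs.finite
  have : Nonempty (SplitVertex G ident rep) := ⟨center (Classical.arbitrary V)⟩
  obtain ⟨p, q, h⟩ := (splitGraph G ident rep).exists_dist_eq_diam
  rw [← h]
  obtain ⟨w₁, h₁⟩ := hs.exists_walk_to_center hi p
  obtain ⟨w₂, h₂⟩ := hs.exists_walk_to_center hi q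
  obtain ⟨g, hg⟩ := hG.exists_walk_length_eq_dist p.base q.base
  obtain ⟨w, hw⟩ := hs.exists_walk_center hi g
  refine (SimpleGraph.dist_le (w₁.append (w.append w₂.reverse))).trans ?_
  have := SimpleGraph.dist_le_diam (SimpleGraph.connected_iff_ediam_ne_top.1 hG)
    (u := p.base) (v := q.base)
  simp only [SimpleGraph.Walk.length_append, SimpleGraph.Walk.length_reverse]
  omega

/-- A centre has one neighbour per class, and a representative of each class gives an injection into
the neighbours of the base. A leaf has the members of its class and the centre as neighbours; since
there is a second class, some neighbour `y` outside the class can stand for the centre. -/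
theorem IsSplitting.ncard_neighborSet_le [Finite V] (hi : Function.Injective ident)
    (q : SplitVertex G ident rep) :
    ((splitGraph G ident rep).neighborSet q).ncard ≤ (G.neighborSet q.base).ncard := by
  classical
  obtain h | ⟨x, hx, h⟩ := q.eq_center_or_port
  · have hex : ∀ p : SplitVertex G ident rep, (splitGraph G ident rep).Adj q p →
        ∃ y, G.Adj q.base y ∧ rep q.base (ident y) = p.name ∧ p.base = q.base := by
      intro p hp
      rcases hp with ⟨h₁, h₂, -⟩ | ⟨h₁, h₂, -⟩
      · rcases p.name_cases with h₃ | ⟨y, hy, h₃⟩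
        · exact absurd (by rw [h₃, ← h₁]; exact congrArg name h) h₂
        · rw [← h₁] at hy h₃
          exact ⟨y, hy, h₃, h₁.symm⟩
      · exact absurd (h₂.symm.trans (congrArg name h)) (hs.rep_ne hi h₁)
    refine Set.ncard_le_ncard_of_injOn
      (fun p => if hp : (splitGraph G ident rep).Adj q p then (hex p hp).choose else q.base)
      ?_ ?_ (Set.toFinite _)
    · intro p hp
      have hp' : (splitGraph G ident rep).Adj q p := hp
      simp only [hp', dif_pos]
      exact (hex p hp').choose_spec.1
    · intro p hp p' hp' e
      have hp₁ : (splitGraph G ident rep).Adj q p := hp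
      have hp₂ : (splitGraph G ident rep).Adj q p' := hp'
      simp only [hp₁, hp₂, dif_pos] at e
      have s₁ := (hex p hp₁).choose_spec.2
      have s₂ := (hex p' hp₂).choose_spec.2
      refine ext' (s₁.2.trans s₂.2.symm) ?_
      rw [← s₁.1, ← s₂.1, e]
  · obtain ⟨y, hy, hyne⟩ : ∃ y, G.Adj q.base y ∧ rep q.base (ident y) ≠ q.name := by
      obtain ⟨v, w, hv, hw, hvw⟩ := hs.exists_ne q.base
      by_contra! hcon
      exact hvw ((hcon v hv).trans (hcon w hw).symm)
    have hq : q.name ≠ ident q.base := by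
      intro e
      exact hs.rep_ne hi hx ((congrArg name h).symm.trans e)
    refine Set.ncard_le_ncard_of_injOn
      (fun p => if p.base = q.base then y else p.base) ?_ ?_ (Set.toFinite _)
    · intro p hp
      split_ifs with hb
      · exact hy
      · rcases hp with h₁ | h₁
        · exact absurd h₁.1.symm hb
        · exact h₁.1
    · intro p hp p' hp' e
      have aux : ∀ p : SplitVertex G ident rep, (splitGraph G ident rep).Adj q p →
          (p.base = q.base → p.name = ident q.base) ∧
          (p.base ≠ q.base → q.name = rep q.base (ident p.base) ∧
            p.name = rep p.base (ident q.base)) := by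
        intro p hp
        rcases hp with ⟨h₁, h₂, h₃ | h₃⟩ | ⟨h₁, h₂, h₃⟩
        · exact absurd h₃ hq
        · exact ⟨fun _ => by rw [h₃, h₁], fun h => absurd h₁.symm h⟩
        · exact ⟨fun h => absurd h.symm h₁.ne, fun _ => ⟨h₂, h₃⟩⟩
      have a₁ := aux p hp
      have a₂ := aux p' hp'
      dsimp only at e
      split_ifs at e with c₁ c₂ c₂
      · exact ext' (c₁.trans c₂.symm) ((a₁.1 c₁).trans (a₂.1 c₂).symm)
      · exact absurd (by rw [e]; exact (a₂.2 c₂).1.symm) hyne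
      · exact absurd (by rw [← e]; exact (a₁.2 c₁).1.symm) hyne
      · refine ext' e ?_
        rw [(a₁.2 c₁).2, (a₂.2 c₂).2, e]

/-- The split graph of a network is a network. -/
theorem IsSplitting.isNetwork {n D Δ κ : ℕ} [Fintype V] [Fintype (SplitVertex G ident rep)]
    (hG : IsNetwork n D Δ κ G ident) : IsNetwork (n ^ 2) (3 * D + 2) Δ κ
      (splitGraph G ident rep) (splitIdent (n ^ κ) G ident rep) := by
  obtain ⟨h2, hn, hD, hΔ, hi, hid⟩ := hG
  refine ⟨hs.twoVertexConnected hi h2, ?_, hs.diam_le hi h2.connected hD,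
    fun q => (hs.ncard_neighborSet_le hi q).trans (hΔ _), hs.injective_splitIdent hi hid,
    fun q => ?_⟩
  · have := Fintype.card_le_of_injective _ hs.injective_toProd
    rw [Fintype.card_prod] at this
    exact this.trans (by rw [sq]; exact Nat.mul_le_mul hn hn)
  · have := hs.splitIdent_lt hid q
    rwa [← pow_mul, Nat.mul_comm, pow_mul, sq]

end Split

end PrivateTrees

namespace PrivateTrees

/-! ### Parametrized cycles -/

section Cycle

variable {V : Type} {G : SimpleGraph V} {C : Set (Sym2 V)} {m : ℕ} {p : ℤ → V}

/-- `p` runs periodically through a cycle of length `m` of `G` with edge set `C`. -/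
structure IsCycleParam (G : SimpleGraph V) (C : Set (Sym2 V)) (m : ℕ) (p : ℤ → V) : Prop where
  three_le : 3 ≤ m
  eq_iff : ∀ i j, p i = p j ↔ (m : ℤ) ∣ i - j
  adj : ∀ i, G.Adj (p i) (p (i + 1))
  mem_iff : ∀ e, e ∈ C ↔ ∃ i, e = s(p i, p (i + 1))

/-- Running through the cycle periodically over all integers turns a change of starting point or
direction into index arithmetic. -/
theorem exists_isCycleParam {v : V} {w : G.Walk v v} (hw : w.IsCycle) :
    ∃ p, IsCycleParam G {e | e ∈ w.edges} w.length p := by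
  have h3 := hw.three_le_length
  have hpos : (0 : ℤ) < w.length := by omega
  have hmod : ∀ i : ℤ, 0 ≤ i % w.length ∧ i % w.length < w.length := fun i =>
    ⟨Int.emod_nonneg _ (by omega), Int.emod_lt_of_pos _ hpos⟩
  have hsucc : ∀ i : ℤ, w.getVert ((i + 1) % w.length).toNat =
      w.getVert ((i % w.length).toNat + 1) := by
    intro i
    have h := hmod i
    by_cases hlt : i % w.length + 1 < w.length
    · have : (i + 1) % w.length = i % w.length + 1 := by
        rw [Int.add_emod, Int.emod_eq_of_lt (a := 1) (by omega) (by omega),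
          Int.emod_eq_of_lt (by omega) hlt]
      rw [this]
      congr 1
      omega
    -- Here the index wraps around; the closed walk ends in its first vertex.
    · have h₁ : (i + 1) % w.length = 0 := by
        rw [Int.add_emod, Int.emod_eq_of_lt (a := 1) (by omega) (by omega),
          show i % w.length + 1 = w.length by omega, Int.emod_self]
      have h₂ : (i % w.length).toNat + 1 = w.length := by omega
      rw [h₁, h₂, SimpleGraph.Walk.getVert_length]
      simp
  refine ⟨fun i => w.getVert (i % w.length).toNat, h3, fun i j => ?_, fun i => ?_, fun e => ?_⟩
  · rw [← Int.emod_emod_of_dvd i (dvd_refl (w.length : ℤ)), Int.emod_emod_of_dvd _ dvd_rfl,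
      ← Int.emod_eq_emod_iff_emod_sub_eq_zero.trans Int.dvd_iff_emod_eq_zero.symm]
    constructor
    · intro h
      have := hw.getVert_injOn' (x₁ := (i % w.length).toNat) (x₂ := (j % w.length).toNat)
        (by have := hmod i; simp only [Set.mem_ofPred_eq]; omega)
        (by have := hmod j; simp only [Set.mem_ofPred_eq]; omega) h
      have h₁ := hmod i
      have h₂ := hmod j
      omega
    · intro h
      simp only [h]
  · rw [hsucc]
    have := hmod i
    exact w.adj_getVert_succ (by omega)
  · simp only [hsucc, Set.mem_ofPred_eq]
    constructor
    · intro he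
      obtain ⟨i, hi, h⟩ := List.getElem_of_mem he
      rw [SimpleGraph.Walk.length_edges] at hi
      refine ⟨i, ?_⟩
      have h₁ : ((i : ℤ) % w.length).toNat = i := by
        rw [Int.emod_eq_of_lt (by omega) (by omega)]
        simp
      rw [h₁, ← h]
      simp [SimpleGraph.Walk.edges, SimpleGraph.Walk.darts_getElem_eq_getVert]
    · rintro ⟨i, rfl⟩
      have := hmod i
      have hi : (i % w.length).toNat < w.edges.length := by
        rw [SimpleGraph.Walk.length_edges]; omega
      convert List.getElem_mem hi using 1
      simp [SimpleGraph.Walk.edges, SimpleGraph.Walk.darts_getElem_eq_getVert]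

namespace IsCycleParam

theorem shift (h : IsCycleParam G C m p) (k : ℤ) : IsCycleParam G C m (fun i => p (i + k)) where
  three_le := h.three_le
  eq_iff i j := by rw [h.eq_iff]; ring_nf
  adj i := by rw [show i + 1 + k = i + k + 1 by ring]; exact h.adj _
  mem_iff e := by
    rw [h.mem_iff]
    constructor
    · rintro ⟨i, rfl⟩
      exact ⟨i - k, by ring_nf⟩
    · rintro ⟨i, rfl⟩
      exact ⟨i + k, by ring_nf⟩

theorem reverse (h : IsCycleParam G C m p) : IsCycleParam G C m (fun i => p (-i)) where
  three_le := h.three_le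
  eq_iff i j := by rw [h.eq_iff, show -i - -j = -(i - j) by ring, dvd_neg]
  adj i := by
    have := h.adj (-(i + 1))
    rw [show -(i + 1) + 1 = -i by ring] at this
    exact this.symm
  mem_iff e := by
    rw [h.mem_iff]
    constructor
    · rintro ⟨i, rfl⟩
      exact ⟨-(i + 1), by rw [Sym2.eq_swap]; ring_nf⟩
    · rintro ⟨i, rfl⟩
      exact ⟨-(i + 1), by rw [Sym2.eq_swap]; ring_nf⟩

theorem exists_of_mem (h : IsCycleParam G C m p) {u v : V} (he : s(u, v) ∈ C) :
    ∃ q, IsCycleParam G C m q ∧ q 0 = u ∧ q 1 = v := by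
  obtain ⟨i, hi⟩ := (h.mem_iff _).1 he
  rcases Sym2.eq_iff.1 hi with ⟨rfl, rfl⟩ | ⟨rfl, rfl⟩
  · exact ⟨_, h.shift i, by ring_nf, by ring_nf⟩
  · exact ⟨_, (h.shift (i + 1)).reverse, by ring_nf, by ring_nf⟩

theorem ne (h : IsCycleParam G C m p) (i : ℤ) : p (i + 1) ≠ p (i - 1) := by
  rw [Ne, h.eq_iff]
  intro hd
  have h3 := h.three_le
  have := Int.le_of_dvd (by omega) hd
  omega

/-- A vertex of a cycle has exactly two incident edges of the cycle. This is why "forward along the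
other edge with the same label" is an unambiguous rule for tokens. -/
theorem mem_iff_eq (h : IsCycleParam G C m p) (i : ℤ) (v : V) :
    s(p i, v) ∈ C ↔ v = p (i + 1) ∨ v = p (i - 1) := by
  constructor
  · intro he
    obtain ⟨j, hj⟩ := (h.mem_iff _).1 he
    rcases Sym2.eq_iff.1 hj with ⟨h₁, rfl⟩ | ⟨h₁, rfl⟩
    · left
      rw [h.eq_iff] at h₁ ⊢
      obtain ⟨k, hk⟩ := h₁
      exact ⟨-k, by rw [mul_neg, ← hk]; ring⟩
    · right
      rw [h.eq_iff] at h₁ ⊢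
      obtain ⟨k, hk⟩ := h₁
      exact ⟨-k, by rw [mul_neg, ← hk]; ring⟩
  · rintro (rfl | rfl)
    · exact (h.mem_iff _).2 ⟨i, rfl⟩
    · exact (h.mem_iff _).2 ⟨i - 1, by rw [Sym2.eq_swap]; ring_nf⟩

theorem mem (h : IsCycleParam G C m p) (i : ℤ) : s(p i, p (i + 1)) ∈ C :=
  (h.mem_iff _).2 ⟨i, rfl⟩

/-- The next vertex is the cycle neighbour different from the previous vertex, so two consecutive
vertices determine everything that follows. The visit time of a token thereby determines the visited
vertex. -/
theorem eq_of_eq {m' : ℕ} {q : ℤ → V} (h : IsCycleParam G C m p) (h' : IsCycleParam G C m' q)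
    (h₀ : p 0 = q 0) (h₁ : p 1 = q 1) (i : ℕ) : p i = q i := by
  have : ∀ i : ℕ, p i = q i ∧ p (i + 1) = q (i + 1) := by
    intro i
    induction i with
    | zero => simpa using ⟨h₀, h₁⟩
    | succ i ih =>
      obtain ⟨e₁, e₂⟩ := ih
      refine ⟨by push_cast; exact e₂, ?_⟩
      push_cast
      have hm := h.mem (i + 1)
      rw [e₂, h'.mem_iff_eq] at hm
      rcases hm with hm | hm
      · exact hm
      · refine absurd ?_ (h.ne (i + 1))
        rw [hm, show (i : ℤ) + 1 - 1 = i by ring, e₁]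
  exact (this i).1

theorem period_eq_zero (h : IsCycleParam G C m p) : p m = p 0 := by
  rw [h.eq_iff]; simp

theorem finite_range_ncard (h : IsCycleParam G C m p) :
    (Set.range p).Finite ∧ (Set.range p).ncard ≤ m := by
  classical
  have : Set.range p ⊆ ((Finset.range m).image fun i : ℕ => p i : Finset V) := by
    rintro _ ⟨i, rfl⟩
    have h3 := h.three_le
    have h₁ := Int.emod_nonneg i (b := m) (by omega)
    have h₂ := Int.emod_lt_of_pos i (b := m) (by omega)
    simp only [Finset.coe_image, Finset.coe_range, Set.mem_image, Set.mem_Iio]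
    refine ⟨(i % m).toNat, by omega, ?_⟩
    rw [Int.toNat_of_nonneg h₁, h.eq_iff]
    exact ⟨-(i / m), by have := Int.emod_add_mul_ediv i m; linarith⟩
  refine ⟨Set.Finite.subset (Finset.finite_toSet _) this, ?_⟩
  refine (Set.ncard_le_ncard this (Finset.finite_toSet _)).trans ?_
  rw [Set.ncard_coe_finset]
  exact Finset.card_image_le.trans (by simp)

end IsCycleParam

/-- Every member of a cycle cover has a parametrization. -/
theorem IsCycleCover.exists_param {d c : ℕ} {ι : Type} {I : Finset ι} {C : ι → Set (Sym2 V)}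
    (h : IsCycleCover G d c I C) {i : ι} (hi : i ∈ I) :
    ∃ m ≤ d, ∃ p, IsCycleParam G (C i) m p := by
  obtain ⟨v, w, hw, hd, he⟩ := h.1 i hi
  obtain ⟨p, hp⟩ := exists_isCycleParam hw
  exact ⟨_, hd, p, he ▸ hp⟩

end Cycle

end PrivateTrees

namespace PrivateTrees

/-! ### Trees given by parent pointers -/

section RootedTree

variable {V : Type} {G : SimpleGraph V}

/-- Parent pointers on `S` with root `ρ`: every vertex of `S` other than `ρ` points to a neighbour
in `S` with a smaller key. -/
structure IsParentMap (G : SimpleGraph V) (S : Set V) (ρ : V) (par : V → V) (key : V → ℕ) :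
    Prop where
  root_mem : ρ ∈ S
  par_mem : ∀ w ∈ S, w ≠ ρ → par w ∈ S
  adj : ∀ w ∈ S, w ≠ ρ → G.Adj w (par w)
  key_lt : ∀ w ∈ S, w ≠ ρ → key (par w) < key w

namespace IsParentMap

variable {S : Set V} {ρ : V} {par : V → V} {key : V → ℕ}

/-- The tree given by parent pointers. -/
def tree (h : IsParentMap G S ρ par key) : G.Subgraph where
  verts := S
  Adj w x := (w ∈ S ∧ w ≠ ρ ∧ x = par w) ∨ (x ∈ S ∧ x ≠ ρ ∧ w = par x)
  adj_sub := by
    rintro w x (⟨h₁, h₂, rfl⟩ | ⟨h₁, h₂, rfl⟩)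
    · exact h.adj _ h₁ h₂
    · exact (h.adj _ h₁ h₂).symm
  edge_vert := by
    rintro w x (⟨h₁, h₂, rfl⟩ | ⟨h₁, h₂, rfl⟩)
    · exact h₁
    · exact h.par_mem _ h₁ h₂
  symm := ⟨fun _ _ hw => hw.symm⟩

theorem tree_adj (h : IsParentMap G S ρ par key) {w : V} (hw : w ∈ S) (hr : w ≠ ρ) :
    h.tree.Adj w (par w) := Or.inl ⟨hw, hr, rfl⟩

/-- The depth is the number of parent steps to the root, finite because keys decrease. Carrying the
minimality of this number through the induction identifies it with a `Nat.find`, which yields the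
recursion for the parent. -/
theorem exists_depth (h : IsParentMap G S ρ par key) :
    ∃ depth : V → ℕ, depth ρ = 0 ∧ (∀ w ∈ S, w ≠ ρ → depth w = depth (par w) + 1) ∧
      ∀ w (hw : w ∈ S), ∃ p : h.tree.coe.Walk ⟨w, hw⟩ ⟨ρ, h.root_mem⟩, p.length = depth w := by
  have key : ∀ k : ℕ, ∀ w (hw : w ∈ S), key w = k →
      ∃ n : ℕ, (par^[n] w = ρ ∧ ∀ i < n, par^[i] w ≠ ρ) ∧
        ∃ p : h.tree.coe.Walk ⟨w, hw⟩ ⟨ρ, h.root_mem⟩, p.length = n := by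
    intro k
    induction k using Nat.strong_induction_on with
    | _ k ih =>
      intro w hw hk
      by_cases hr : w = ρ
      · subst hr
        exact ⟨0, ⟨rfl, by simp⟩, .nil, rfl⟩
      · obtain ⟨n, ⟨h₁, h₂⟩, p, hp⟩ := ih _ (hk ▸ h.key_lt w hw hr) (par w) (h.par_mem w hw hr) rfl
        have hadj : h.tree.coe.Adj ⟨w, hw⟩ ⟨par w, h.par_mem w hw hr⟩ := h.tree_adj hw hr
        refine ⟨n + 1, ⟨h₁, ?_⟩, .cons hadj p, ?_⟩
        · intro i hi
          cases i with
          | zero => exact hr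
          | succ i => exact h₂ i (by omega)
        · simp [hp]
  classical
  have hex : ∀ w ∈ S, ∃ n, par^[n] w = ρ := fun w hw => by
    obtain ⟨n, hn, -⟩ := key _ w hw rfl
    exact ⟨n, hn.1⟩
  have huniq : ∀ w (hw : w ∈ S) n, (par^[n] w = ρ ∧ ∀ i < n, par^[i] w ≠ ρ) →
      Nat.find (hex w hw) = n := by
    intro w hw n hn
    rw [Nat.find_eq_iff]
    exact hn
  refine ⟨fun w => if hw : w ∈ S then Nat.find (hex w hw) else 0, ?_, ?_, ?_⟩
  · simp only [h.root_mem, dif_pos]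
    exact huniq ρ h.root_mem 0 ⟨rfl, by simp⟩
  · intro w hw hr
    have hp := h.par_mem w hw hr
    simp only [hw, hp, dif_pos]
    obtain ⟨n, hn, -⟩ := key _ _ hp rfl
    rw [huniq _ hp n hn]
    refine huniq w hw (n + 1) ⟨hn.1, ?_⟩
    intro i hi
    cases i with
    | zero => exact hr
    | succ i => exact hn.2 i (by omega)
  · intro w hw
    obtain ⟨n, hn, p, hp⟩ := key _ w hw rfl
    simp only [hw, dif_pos]
    exact ⟨p, by rw [hp, huniq w hw n hn]⟩

theorem connected (h : IsParentMap G S ρ par key) : h.tree.coe.Connected := by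
  obtain ⟨depth, -, -, hp⟩ := h.exists_depth
  have : Nonempty h.tree.verts := ⟨⟨ρ, h.root_mem⟩⟩
  refine ⟨fun u v => ?_⟩
  obtain ⟨p, -⟩ := hp u.1 u.2
  obtain ⟨q, -⟩ := hp v.1 v.2
  exact ⟨p.append q.reverse⟩

/-- A connected graph is a tree when it has one edge less than vertices, and every edge here joins a
non-root vertex to its parent. -/
theorem isTree [Finite V] (h : IsParentMap G S ρ par key) : h.tree.coe.IsTree := by
  classical
  have hfin : Finite h.tree.verts := inferInstance
  rw [SimpleGraph.isTree_iff_connected_and_card]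
  refine ⟨h.connected, le_antisymm ?_ h.connected.card_vert_le_card_edgeSet_add_one⟩
  have hsub : h.tree.coe.edgeSet ⊆ (fun w : h.tree.verts =>
      if hw : (w : V) = ρ then s(w, w) else s(w, ⟨par w, h.par_mem w w.2 hw⟩)) ''
        {w | (w : V) ≠ ρ} := by
    intro e
    induction e with
    | h x y =>
      intro he
      have he' : h.tree.Adj x y := he
      rcases he' with ⟨h₁, h₂, h₃⟩ | ⟨h₁, h₂, h₃⟩
      · refine ⟨x, h₂, ?_⟩
        have hy : y = ⟨par x, h.par_mem x h₁ h₂⟩ := Subtype.ext h₃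
        dsimp only
        rw [dif_neg h₂, ← hy]
      · refine ⟨y, h₂, ?_⟩
        have hx : x = ⟨par y, h.par_mem y h₁ h₂⟩ := Subtype.ext h₃
        dsimp only
        rw [dif_neg h₂, ← hx, Sym2.eq_swap]
  have h₁ : Nat.card h.tree.coe.edgeSet ≤ ({w : h.tree.verts | (w : V) ≠ ρ}).ncard := by
    rw [Nat.card_coe_set_eq]
    exact (Set.ncard_le_ncard hsub (Set.toFinite _)).trans (Set.ncard_image_le (Set.toFinite _))
  have h₂ : ({w : h.tree.verts | (w : V) ≠ ρ}).ncard + 1 = Nat.card h.tree.verts := by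
    have e : {w : h.tree.verts | (w : V) ≠ ρ} = {⟨ρ, h.root_mem⟩}ᶜ := by
      ext w
      simp [Subtype.ext_iff]
    rw [e, Set.ncard_compl, Set.ncard_singleton]
    have : 0 < Nat.card h.tree.verts := Nat.card_pos_iff.2 ⟨⟨⟨ρ, h.root_mem⟩⟩, hfin⟩
    omega
  omega

theorem diam_lt [Finite V] (h : IsParentMap G S ρ par key) : h.tree.coe.diam < S.ncard := by
  have : Nonempty h.tree.verts := ⟨⟨ρ, h.root_mem⟩⟩
  have hfin : Fintype h.tree.verts := Fintype.ofFinite _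
  obtain ⟨u, v, huv⟩ := h.tree.coe.exists_dist_eq_diam
  rw [← huv]
  obtain ⟨p, hp, hl⟩ := h.connected.exists_path_of_dist u v
  rw [← hl]
  have := hp.length_lt
  rwa [← Nat.card_eq_fintype_card, show Nat.card h.tree.verts = S.ncard from
    Nat.card_coe_set_eq _] at this

/-- Depth equals distance from the root: following parents gives a walk of that length, and depth
changes by at most one along an edge, so no walk is shorter. -/
theorem isParent (h : IsParentMap G S ρ par key) {w : V} (hw : w ∈ S) (hr : w ≠ ρ) :
    IsParent h.tree ρ w (par w) := by
  obtain ⟨depth, h₀, h₁, hp⟩ := h.exists_depth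
  have hle : ∀ w ∈ S, h.tree.spanningCoe.dist ρ w ≤ depth w := by
    intro w hw
    obtain ⟨p, hl⟩ := hp w hw
    rw [← hl, SimpleGraph.dist_comm]
    have := SimpleGraph.dist_le (p.map
      (⟨Subtype.val, fun h => h⟩ : h.tree.coe →g h.tree.spanningCoe))
    rwa [SimpleGraph.Walk.length_map] at this
  have hwalk : ∀ (x y : V) (p : h.tree.spanningCoe.Walk x y), depth x ≤ depth y + p.length := by
    intro x y p
    induction p with
    | nil => simp
    | @cons x z y hxz p ih =>
      have hxz' : h.tree.Adj x z := hxz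
      rw [SimpleGraph.Walk.length_cons]
      rcases hxz' with ⟨a, b, rfl⟩ | ⟨a, b, rfl⟩
      · rw [h₁ x a b]; omega
      · have := h₁ z a b; omega
  have heq : ∀ w ∈ S, h.tree.spanningCoe.dist ρ w = depth w := by
    intro w hw
    refine le_antisymm (hle w hw) ?_
    obtain ⟨p, hl⟩ := hp w hw
    have hr : h.tree.spanningCoe.Reachable w ρ := ⟨p.map
      (⟨Subtype.val, fun h => h⟩ : h.tree.coe →g h.tree.spanningCoe)⟩
    obtain ⟨q, hq⟩ := hr.exists_walk_length_eq_dist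
    have := hwalk _ _ q
    rw [SimpleGraph.dist_comm, ← hq]
    omega
  exact ⟨h.tree_adj hw hr, by rw [heq w hw, heq _ (h.par_mem w hw hr), h₁ w hw hr]⟩

end IsParentMap

end RootedTree

end PrivateTrees

namespace PrivateTrees

/-! ### Counting -/

/-- The fraction of the functions on `X` whose restriction along an injection `j` satisfies `Q` is
the fraction of the functions that satisfy `Q`. -/
theorem card_comp_injective {X Y S : Type} [Finite X] [Finite Y] [Finite S] [Nonempty S]
    {j : Y → X} (hj : Function.Injective j) (Q : (Y → S) → Prop) :
    (Nat.card {f : X → S // Q (f ∘ j)} : ℝ) / Nat.card (X → S) =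
      (Nat.card {g : Y → S // Q g} : ℝ) / Nat.card (Y → S) := by
  classical
  -- A function on `X` is its restriction along `j` together with its values off the range of `j`;
  -- the second factor is arbitrary and cancels from the fraction.
  let e : (X → S) ≃ (Y → S) × ({x // ¬ x ∈ Set.range j} → S) :=
    (Equiv.piEquivPiSubtypeProd (· ∈ Set.range j) (fun _ => S)).trans
      (Equiv.prodCongr ((Equiv.ofInjective j hj).symm.arrowCongr (Equiv.refl S)) (Equiv.refl _))
  have he : ∀ f, (e f).1 = f ∘ j := fun f => rfl
  have h₁ : Nat.card {f : X → S // Q (f ∘ j)} =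
      Nat.card {g : Y → S // Q g} * Nat.card ({x // ¬ x ∈ Set.range j} → S) := by
    rw [← Nat.card_prod]
    refine Nat.card_congr ((Equiv.subtypeEquiv e (q := fun z => Q z.1) ?_).trans
      Equiv.prodSubtypeFstEquivSubtypeProd)
    intro f
    rw [he]
  have h₂ : Nat.card (X → S) =
      Nat.card (Y → S) * Nat.card ({x // ¬ x ∈ Set.range j} → S) := by
    rw [← Nat.card_prod]
    exact Nat.card_congr e
  have hpos : (Nat.card ({x // ¬ x ∈ Set.range j} → S) : ℝ) ≠ 0 := by
    exact_mod_cast Nat.card_pos.ne'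
  rw [h₁, h₂]
  push_cast
  rw [mul_div_mul_right _ _ hpos]

/-- If, for all values of the other coordinates, an event has probability at most `δ` over the
coordinate `t`, then it has probability at most `δ`. -/
theorem card_le_of_update {L Z : Type} [Finite L] [DecidableEq L] [Finite Z] [Nonempty Z] (t : L)
    (E : (L → Z) → Prop) (δ : ℝ)
    (h : ∀ φ, (Nat.card {z : Z // E (Function.update φ t z)} : ℝ) ≤ δ * Nat.card Z) :
    (Nat.card {φ : L → Z // E φ} : ℝ) ≤ δ * Nat.card (L → Z) := by
  classical
  have := Fintype.ofFinite L
  have := Fintype.ofFinite Z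
  let e : (L → Z) ≃ Z × ({j // j ≠ t} → Z) := Equiv.funSplitAt t Z
  -- The event is sliced by the values of the coordinates other than `t`; each slice has at most the
  -- proportion `δ`.
  let e' : {φ : L → Z // E φ} ≃ (Σ y : {j // j ≠ t} → Z, {z : Z // E (e.symm (z, y))}) :=
    (Equiv.subtypeEquiv (q := fun x => E (e.symm (x.2, x.1))) (e.trans (Equiv.prodComm _ _))
      (fun φ => by simp)).trans
      (Equiv.subtypeProdEquivSigmaSubtype (fun y z => E (e.symm (z, y))))
  have h₁ : ∀ y : {j // j ≠ t} → Z,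
      (Nat.card {z : Z // E (e.symm (z, y))} : ℝ) ≤ δ * Nat.card Z := by
    intro y
    obtain ⟨z₀⟩ := ‹Nonempty Z›
    have h₂ := h (e.symm (z₀, y))
    have h₃ : ∀ z, Function.update (e.symm (z₀, y)) t z = e.symm (z, y) := by
      intro z
      funext j
      by_cases hj : j = t
      · subst hj
        simp [e, Equiv.funSplitAt_symm_apply]
      · simp [e, Equiv.funSplitAt_symm_apply, hj]
    simpa only [h₃] using h₂
  rw [Nat.card_congr e', Nat.card_sigma, Nat.card_congr e, Nat.card_prod]
  push_cast
  refine (Finset.sum_le_sum fun y _ => h₁ y).trans (le_of_eq ?_)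
  rw [Finset.sum_const, nsmul_eq_mul, Finset.card_univ, Nat.card_eq_fintype_card]
  simp only [Nat.card_eq_fintype_card]
  ring

/-! ### Values that are computable by message passing -/

section Computable

/-- The messages with letters from an arbitrary type that `v` receives. -/
noncomputable def received {V Y : Type} (G : SimpleGraph V) (ident : V → ℕ)
    (out : V → ℕ → Option Y) (v : V) : ℕ → Option Y :=
  open Classical in
  fun x => if h : ∃ u, G.Adj v u ∧ ident u = x then out h.choose (ident v) else none

theorem received_of_adj {V Y : Type} {G : SimpleGraph V} {ident : V → ℕ}
    (hi : Function.Injective ident) (out : V → ℕ → Option Y) {v u : V} (h : G.Adj v u) :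
    received G ident out v (ident u) = out u (ident v) := by
  have hex : ∃ w, G.Adj v w ∧ ident w = ident u := ⟨u, h, rfl⟩
  have := hi hex.choose_spec.2
  simp only [received, hex, dif_pos, this]

theorem received_eq_none {V Y : Type} {G : SimpleGraph V} {ident : V → ℕ}
    (out : V → ℕ → Option Y) {v : V} {x : ℕ} (h : ¬ ∃ u, G.Adj v u ∧ ident u = x) :
    received G ident out v x = none := by
  simp only [received, h, dif_neg, not_false_eq_true]

/-- A deterministic protocol in which a node initially knows its identifier, the identifiers of its
neighbours and its random seed. -/
structure Protocol (M : ℕ) (Seed X : Type) where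
  State : Type
  start : ℕ → Finset ℕ → Seed → State
  send : ℕ → State → ℕ → Option (Fin M)
  receive : ℕ → State → (ℕ → Option (Fin M)) → State
  output : State → X

/-- The states of the nodes after the given number of rounds. -/
noncomputable def Protocol.states {M : ℕ} {Seed X : Type} (P : Protocol M Seed X) {V : Type}
    [Fintype V] (G : SimpleGraph V) (ident : V → ℕ) (φ : V → Seed) : ℕ → V → P.State
  | 0 => fun v => P.start (ident v) (neighborIdents G ident v) (φ v)
  | t + 1 => fun v => P.receive t (P.states G ident φ t v)
      (received G ident (fun u => P.send t (P.states G ident φ t u)) v)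

/-- Values at the nodes of networks whose nodes have random seeds. -/
abbrev LocalValue (Seed X : Type) : Type 1 :=
  ∀ (V : Type) [Fintype V] (_G : SimpleGraph V) (_ident : V → ℕ), (V → Seed) → V → X

/-- The value `F` is computable in `T` rounds with messages from an alphabet of `M` letters. -/
def ComputableIn {Seed X : Type} (M T : ℕ) (F : LocalValue Seed X) : Prop :=
  ∃ P : Protocol M Seed X, ∀ (V : Type) [Fintype V] (G : SimpleGraph V) (ident : V → ℕ)
    (φ : V → Seed) (v : V), P.output (P.states G ident φ T v) = F V G ident φ v

/-- The messages `Option Y` can be transmitted by `q` letters from an alphabet of size `M`, silence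
being transmitted by silence. -/
def Transmissible (M q : ℕ) (Y : Type) : Prop :=
  ∃ e : Option Y → Fin q → Option (Fin M), Function.Injective e ∧ e none = fun _ => none

theorem transmissible_of_card_le {M q : ℕ} {Y : Type} [Finite Y]
    (h : Nat.card Y + 1 ≤ (M + 1) ^ q) : Transmissible M q Y := by
  classical
  have := Fintype.ofFinite Y
  have hc : Fintype.card (Option Y) ≤ Fintype.card (Fin q → Option (Fin M)) := by
    rw [Fintype.card_option, ← Nat.card_eq_fintype_card]
    simpa using h
  obtain ⟨e⟩ := Function.Embedding.nonempty_of_card_le hc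
  -- The swap moves the code of `none` to silence without destroying injectivity.
  refine ⟨fun y => Equiv.swap (e none) (fun _ => none) (e y),
    (Equiv.injective _).comp e.injective, ?_⟩
  simp

variable {Seed X Y S : Type} {M T q : ℕ} {F : LocalValue Seed X}

theorem computableIn_init : ComputableIn M 0
    (fun _ _ G ident φ v => (ident v, neighborIdents G ident v, φ v) :
      LocalValue Seed (ℕ × Finset ℕ × Seed)) :=
  ⟨⟨_, fun i nb s => (i, nb, s), fun _ _ _ => none, fun _ s _ => s, id⟩, fun _ _ _ _ _ _ => rfl⟩

theorem ComputableIn.congr {F' : LocalValue Seed X} (h : ComputableIn M T F)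
    (hF : ∀ (V : Type) [Fintype V] (G : SimpleGraph V) (ident : V → ℕ) (φ : V → Seed) (v : V),
      F V G ident φ v = F' V G ident φ v) : ComputableIn M T F' := by
  obtain ⟨P, hP⟩ := h
  exact ⟨P, fun V _ G ident φ v => (hP V G ident φ v).trans (hF V G ident φ v)⟩

theorem ComputableIn.map (h : ComputableIn M T F) (g : X → Y) :
    ComputableIn M T (fun V _ G ident φ v => g (F V G ident φ v)) := by
  obtain ⟨P, hP⟩ := h
  let P' : Protocol M Seed Y := ⟨P.State, P.start, P.send, P.receive, g ∘ P.output⟩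
  refine ⟨P', fun V _ G ident φ v => ?_⟩
  have : ∀ t, P'.states G ident φ t = P.states G ident φ t := by
    intro t
    induction t with
    | zero => rfl
    | succ t ih => funext v; simp only [Protocol.states, ih]; rfl
  rw [this]
  exact congrArg g (hP V G ident φ v)

/-- The protocol for `F` runs unchanged for `T` rounds; its state is then frozen, and the extra
round sends messages computed from its output. -/
theorem ComputableIn.exchangeLetter (h : ComputableIn M T F)
    (msg : X → ℕ → Option (Fin M)) : ComputableIn M (T + 1) (fun V _ G ident φ v =>
      (F V G ident φ v, received G ident (fun u => msg (F V G ident φ u)) v)) := by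
  obtain ⟨P, hP⟩ := h
  let P' : Protocol M Seed (X × (ℕ → Option (Fin M))) :=
    { State := P.State × (ℕ → Option (Fin M))
      start := fun i nb s => (P.start i nb s, fun _ => none)
      send := fun t s => if t < T then P.send t s.1 else msg (P.output s.1)
      receive := fun t s m => if t < T then (P.receive t s.1 m, s.2) else (s.1, m)
      output := fun s => (P.output s.1, s.2) }
  refine ⟨P', fun V _ G ident φ v => ?_⟩
  have key : ∀ t ≤ T, ∀ v, (P'.states G ident φ t v).1 = P.states G ident φ t v := by
    intro t
    induction t with
    | zero => exact fun _ _ => rfl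
    | succ t ih =>
      intro ht v
      have hlt : t < T := ht
      simp only [Protocol.states, P', hlt, if_true]
      congr 1
      · exact ih hlt.le v
      · congr 1
        funext u
        congr 1
        exact ih hlt.le u
  have hlast : P'.states G ident φ (T + 1) v = (P.states G ident φ T v,
      received G ident (fun u => msg (F V G ident φ u)) v) := by
    have hT : ¬ T < T := lt_irrefl T
    simp only [Protocol.states, P', hT, if_false]
    refine Prod.ext (key T le_rfl v) ?_
    dsimp only
    congr 1
    funext u
    rw [← hP]
    congr 2
    exact key T le_rfl u
  rw [hlast]
  exact Prod.ext (hP V G ident φ v) rfl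

theorem ComputableIn.exchangeLetters (h : ComputableIn M T F)
    (msg : X → ℕ → ℕ → Option (Fin M)) (q : ℕ) : ComputableIn M (T + q) (fun V _ G ident φ v =>
      (F V G ident φ v, fun (i x : ℕ) => if i < q then
        received G ident (fun u y => msg (F V G ident φ u) y i) v x else none)) := by
  induction q with
  | zero =>
    refine (h.map (fun x => (x, fun (_ _ : ℕ) => (none : Option (Fin M))))).congr ?_
    intros
    simp
  | succ q ih =>
    have h₁ := (ih.exchangeLetter (fun s y => msg s.1 y q)).map
      (fun s => (s.1.1, fun (i x : ℕ) => if i = q then s.2 x else s.1.2 i x))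
    refine h₁.congr fun V _ G ident φ v => Prod.ext rfl ?_
    funext i x
    rcases lt_trichotomy i q with hi | hi | hi
    · simp [hi, hi.ne, hi.trans (Nat.lt_succ_self q)]
    · simp [hi]
    · simp [show ¬ i < q + 1 by omega, show ¬ i < q by omega, hi.ne']

/-- One exchange of messages. -/
theorem ComputableIn.exchange (h : ComputableIn M T F) (hY : Transmissible M q Y)
    (msg : X → ℕ → Option Y) : ComputableIn M (T + q) (fun V _ G ident φ v =>
      (F V G ident φ v, received G ident (fun u => msg (F V G ident φ u)) v)) := by
  classical
  obtain ⟨e, he, he0⟩ := hY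
  have h₁ := (h.exchangeLetters
    (fun s y i => if hi : i < q then e (msg s y) ⟨i, hi⟩ else none) q).map
    (fun s => (s.1, fun x => Function.invFun e (fun i => s.2 i x)))
  refine h₁.congr fun V _ G ident φ v => Prod.ext rfl ?_
  funext x
  by_cases hx : ∃ u, G.Adj v u ∧ ident u = x
  · simp only [received, hx, dif_pos, Fin.is_lt, if_true]
    exact Function.leftInverse_invFun he _
  -- At an identifier of no neighbour all letters are silent, and silence decodes to `none`.
  · refine Eq.trans ?_
      (received_eq_none (fun u => msg (F V G ident φ u)) hx).symm
    have : (fun i : Fin q => if (i : ℕ) < q then received G ident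
        (fun u y => if hi : (i : ℕ) < q then e (msg (F V G ident φ u) y) ⟨i, hi⟩ else none) v x
        else none) = e none := by
      funext i
      rw [received_eq_none _ hx, he0]
      simp
    exact (congrArg _ this).trans (Function.leftInverse_invFun he _)

/-- The states of an iterated exchange of messages; `env` is constant during the iteration. -/
noncomputable def iterate {V : Type} (G : SimpleGraph V) (ident : V → ℕ) (env : V → X)
    (init : X → S) (msg : ℕ → X → S → ℕ → Option Y)
    (upd : ℕ → X → S → (ℕ → Option Y) → S) : ℕ → V → S
  | 0 => fun v => init (env v)
  | i + 1 => fun v => upd i (env v) (iterate G ident env init msg upd i v)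
      (received G ident (fun u => msg i (env u) (iterate G ident env init msg upd i u)) v)

theorem ComputableIn.iterate {Z : Type} (h : ComputableIn M T F) (hY : Transmissible M q Y)
    (g : X → Z) (init : Z → S) (msg : ℕ → Z → S → ℕ → Option Y)
    (upd : ℕ → Z → S → (ℕ → Option Y) → S) (R : ℕ) :
    ComputableIn M (T + R * q) (fun V _ G ident φ v => (F V G ident φ v,
      PrivateTrees.iterate G ident (fun u => g (F V G ident φ u)) init msg upd R v)) := by
  induction R with
  | zero =>
    rw [Nat.zero_mul]
    exact h.map (fun x => (x, init (g x)))
  | succ R ih =>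
    have h₁ := (ih.exchange hY (fun s => msg R (g s.1) s.2)).map
      (fun s => (s.1.1, upd R (g s.1.1) s.1.2 s.2))
    rw [Nat.add_assoc, ← Nat.succ_mul] at h₁
    exact h₁

/-- A computable value is the output of an algorithm that takes the seeds from its first round. -/
theorem ComputableIn.exists_algorithm [Finite Seed] [Nonempty Seed] (h : ComputableIn M T F) :
    ∃ B : Algorithm (T + 1) M X, ∀ (V : Type) [Fintype V] (G : SimpleGraph V) (ident : V → ℕ)
      (Q : (V → X) → Prop), B.failureProb G ident Q =
        (Nat.card {φ : V → Seed // ¬ Q (F V G ident φ)} : ℝ) / Nat.card (V → Seed) := by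
  obtain ⟨P, hP⟩ := h
  let B : Algorithm (T + 1) M X :=
    { State := (ℕ × Finset ℕ) ⊕ P.State
      Seed := Seed
      seedFinite := inferInstance
      seedNonempty := inferInstance
      init := fun i nb => Sum.inl (i, nb)
      step := fun t s m ω =>
        -- The first round only uses the seed to start the protocol and sends its first messages.
        -- All protocol rounds are therefore delayed by one, which accounts for `t - 1` and for the
        -- additional round.
        let s' := Sum.elim (fun k => P.start k.1 k.2 ω) (fun s => P.receive (t - 1) s m) s
        (Sum.inr s', P.send t s')
      output := Sum.elim (fun k => P.output (P.start k.1 k.2 (Classical.arbitrary Seed))) P.output }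
  refine ⟨B, fun V _ G ident Q => ?_⟩
  have key : ∀ (ω : V → Fin (T + 1) → Seed) (t : ℕ), t ≤ T → ∀ v,
      B.config G ident ω (t + 1) v = (Sum.inr (P.states G ident (fun v => ω v 0) t v),
        P.send t (P.states G ident (fun v => ω v 0) t v)) := by
    intro ω t
    induction t with
    | zero =>
      intro _ v
      simp only [Algorithm.config, Nat.zero_lt_succ, dif_pos]
      rfl
    | succ t ih =>
      intro ht v
      have h₁ : t + 1 < T + 1 := by omega
      have hin : inbox G ident (fun u => (B.config G ident ω (t + 1) u).2) v =
          received G ident (fun u => P.send t (P.states G ident (fun v => ω v 0) t u)) v := by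
        simp only [ih (by omega)]
        rfl
      rw [Algorithm.config]
      dsimp only
      rw [dif_pos h₁, hin, ih (by omega) v]
      rfl
  have hres : ∀ ω : V → Fin (T + 1) → Seed,
      B.result G ident ω = F V G ident (fun v => ω v 0) := by
    intro ω
    funext v
    rw [Algorithm.result, key ω T le_rfl v, ← hP]
    rfl
  -- Only the randomness of round `0` is read, so the other rounds are averaged out.
  have hcount := card_comp_injective (X := V × Fin (T + 1)) (Y := V) (S := Seed)
    (j := fun v => (v, 0)) (fun a b hab => congrArg Prod.fst hab)
    (fun φ => ¬ Q (F V G ident φ))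
  rw [← hcount, Algorithm.failureProb]
  congr 2
  · refine Nat.card_congr (Equiv.subtypeEquiv (Equiv.curry V (Fin (T + 1)) Seed).symm ?_)
    intro ω
    rw [hres]
    rfl
  · exact Nat.card_congr (Equiv.curry V (Fin (T + 1)) Seed).symm

end Computable

end PrivateTrees

namespace PrivateTrees

/-! ### Simulating the split graph -/

section Simulation

variable {V : Type} {G : SimpleGraph V} {ident : V → ℕ} {rep : V → ℕ → ℕ} {N : ℕ}

open SplitVertex

/-- What a node knows about its cluster in the split graph: its identifier, the identifiers of its
neighbours, the classes of its neighbours, and its own classes at its neighbours. -/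
structure ClusterInfo where
  id : ℕ
  nbrs : Finset ℕ
  rep : ℕ → ℕ
  their : ℕ → ℕ

/-- The adjacency of the member `a` of the cluster to the vertex with identifier `y`. -/
def ClusterInfo.Adj (N : ℕ) (k : ClusterInfo) (a y : ℕ) : Prop :=
  (y / N = k.id ∧ ((a = k.id ∧ ∃ x ∈ k.nbrs, k.rep x = y % N) ∨
    (y % N = k.id ∧ ∃ x ∈ k.nbrs, k.rep x = a))) ∨
  (y / N ∈ k.nbrs ∧ k.rep (y / N) = a ∧ k.their (y / N) = y % N)

/-- The message that is sent over the edge to `x` when the members of the cluster prepare the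
messages `outs`. -/
def ClusterInfo.message {Y : Type} (N : ℕ) (k : ClusterInfo) (outs : ℕ → ℕ → Option Y) (x : ℕ) :
    Option Y := outs (k.rep x) (x * N + k.their x)

/-- The messages that the members of the cluster receive. -/
noncomputable def ClusterInfo.received {Y : Type} (N : ℕ) (k : ClusterInfo)
    (outs : ℕ → ℕ → Option Y) (m : ℕ → Option Y) (a y : ℕ) : Option Y :=
  open Classical in
  if k.Adj N a y then if y / N = k.id then outs (y % N) (k.id * N + a) else m (y / N) else none

/-- The identifiers of the neighbours of the member `a` of the cluster. -/
noncomputable def ClusterInfo.neighbors (N : ℕ) (k : ClusterInfo) (a : ℕ) : Finset ℕ :=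
  open Classical in (Finset.range (N * N)).filter (k.Adj N a)

/-- The nodes have the correct information about their clusters. -/
structure IsClusterInfo [Fintype V] (G : SimpleGraph V) (ident : V → ℕ) (rep : V → ℕ → ℕ)
    (k : V → ClusterInfo) : Prop where
  id_eq : ∀ u, (k u).id = ident u
  nbrs_eq : ∀ u, (k u).nbrs = neighborIdents G ident u
  rep_eq : ∀ u, (k u).rep = rep u
  their_eq : ∀ u v, G.Adj u v → (k u).their (ident v) = rep v (ident u)

theorem mem_neighborIdents [Fintype V] {u : V} {x : ℕ} :
    x ∈ neighborIdents G ident u ↔ ∃ v, G.Adj u v ∧ ident v = x := by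
  simp [neighborIdents]

variable [Fintype V] {k : V → ClusterInfo}

theorem IsClusterInfo.exists_of_adj (hk : IsClusterInfo G ident rep k) {u : V} {a y : ℕ}
    (h : (k u).Adj N a y) : ∃ q : SplitVertex G ident rep, q.base = u ∧ q.name = a := by
  have hport : ∀ x ∈ (k u).nbrs, (k u).rep x = a →
      ∃ q : SplitVertex G ident rep, q.base = u ∧ q.name = a := by
    intro x hx e
    rw [hk.nbrs_eq, mem_neighborIdents] at hx
    obtain ⟨v, hv, rfl⟩ := hx
    rw [hk.rep_eq] at e
    exact ⟨port hv, rfl, e⟩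
  rcases h with ⟨-, ⟨h, -⟩ | ⟨-, x, hx, h⟩⟩ | ⟨hx, h, -⟩
  · exact ⟨center u, rfl, by rw [h, hk.id_eq]; rfl⟩
  · exact hport x hx h
  · exact hport _ hx h

/-- The quotient of an identifier by `N` names the cluster and the remainder the member. The cases
of `ClusterInfo.Adj` are the edges centre to leaf, leaf to centre, and leaf to leaf of another
cluster, all decidable from local knowledge. -/
theorem IsClusterInfo.adj_iff (hk : IsClusterInfo G ident rep k) (hs : IsSplitting G ident rep)
    (hi : Function.Injective ident) (hN : ∀ v, ident v < N) (q : SplitVertex G ident rep) (y : ℕ) :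
    (k q.base).Adj N q.name y ↔
      ∃ q', (splitGraph G ident rep).Adj q q' ∧ splitIdent N G ident rep q' = y := by
  have hy : y / N * N + y % N = y := by rw [Nat.mul_comm]; exact Nat.div_add_mod y N
  constructor
  · rintro (⟨h₁, ⟨h₂, x, hx, h₃⟩ | ⟨h₂, x, hx, h₃⟩⟩ | ⟨hx, h₂, h₃⟩)
    · rw [hk.nbrs_eq, mem_neighborIdents] at hx
      obtain ⟨v, hv, rfl⟩ := hx
      rw [hk.rep_eq] at h₃
      rw [hk.id_eq] at h₁ h₂
      have e : q = center q.base := ext' rfl h₂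
      refine ⟨port hv, ?_, ?_⟩
      · have := hs.adj_center_port hi hv
        rwa [← e] at this
      · rw [← hy, h₁, ← h₃]
        rfl
    · rw [hk.nbrs_eq, mem_neighborIdents] at hx
      obtain ⟨v, hv, rfl⟩ := hx
      rw [hk.rep_eq] at h₃
      rw [hk.id_eq] at h₁ h₂
      have e : q = port hv := ext' rfl h₃.symm
      refine ⟨center q.base, ?_, ?_⟩
      · have := (hs.adj_center_port hi hv).symm
        rwa [← e] at this
      · rw [← hy, h₁, h₂]
        rfl
    · rw [hk.nbrs_eq, mem_neighborIdents] at hx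
      obtain ⟨v, hv, hx⟩ := hx
      rw [← hx, hk.rep_eq] at h₂
      rw [← hx, hk.their_eq _ _ hv] at h₃
      have e : q = port hv := ext' rfl h₂.symm
      refine ⟨port hv.symm, ?_, ?_⟩
      · have := splitGraph_adj_port (ident := ident) (rep := rep) hv
        rwa [← e] at this
      · rw [← hy, ← h₃, ← hx]
        rfl
  · rintro ⟨q', hq, rfl⟩
    rw [ClusterInfo.Adj, hs.splitIdent_div hN, hs.splitIdent_mod hN, hk.id_eq, hk.nbrs_eq,
      hk.rep_eq]
    have hmem : ∀ {u x : V}, G.Adj u x → ident x ∈ neighborIdents G ident u := fun h =>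
      mem_neighborIdents.2 ⟨_, h, rfl⟩
    rcases hq with ⟨h₁, h₂, h₃⟩ | ⟨h₁, h₂, h₃⟩
    · refine Or.inl ⟨by rw [h₁], ?_⟩
      rcases h₃ with h₃ | h₃
      · left
        refine ⟨h₃, ?_⟩
        rcases q'.name_cases with h₄ | ⟨x, hx, h₄⟩
        · exact absurd (by rw [h₃, h₄, h₁]) h₂
        · rw [← h₁] at hx h₄
          exact ⟨_, hmem hx, h₄⟩
      · right
        rw [h₁]
        refine ⟨h₃, ?_⟩
        rcases q.name_cases with h₄ | ⟨x, hx, h₄⟩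
        · exact absurd (by rw [h₃, h₄, h₁]) h₂
        · rw [h₁] at hx h₄
          exact ⟨_, hmem hx, h₄⟩
    · exact Or.inr ⟨hmem h₁, h₂.symm, by rw [hk.their_eq _ _ h₁, h₃]⟩

/-- Messages inside a cluster are delivered locally. Between the clusters of two adjacent nodes
there is only one edge of the split graph, and both nodes know its ends, so one message over the
edge of `G` suffices. -/
theorem IsClusterInfo.received_eq {Y : Type} (hk : IsClusterInfo G ident rep k)
    (hs : IsSplitting G ident rep) (hi : Function.Injective ident) (hN : ∀ v, ident v < N)
    (outs : V → ℕ → ℕ → Option Y) (q : SplitVertex G ident rep) :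
    (k q.base).received N (outs q.base)
      (received G ident (fun u => (k u).message N (outs u)) q.base) q.name =
    received (splitGraph G ident rep) (splitIdent N G ident rep)
      (fun q => outs q.base q.name) q := by
  funext y
  rw [ClusterInfo.received]
  split_ifs with h₁ h₂
  · obtain ⟨q', hq, rfl⟩ := (hk.adj_iff hs hi hN q y).1 h₁
    rw [received_of_adj (hs.injective_splitIdent hi hN) _ hq, hs.splitIdent_mod hN]
    rw [hs.splitIdent_div hN, hk.id_eq] at h₂
    rw [hk.id_eq, hi h₂]
    rfl
  · obtain ⟨q', hq, rfl⟩ := (hk.adj_iff hs hi hN q y).1 h₁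
    rw [received_of_adj (hs.injective_splitIdent hi hN) _ hq, hs.splitIdent_div hN]
    rw [hs.splitIdent_div hN, hk.id_eq] at h₂
    have hne : q.base ≠ q'.base := fun e => h₂ (by rw [e])
    obtain ⟨hG, e, e'⟩ := eq_port_of_adj hq hne
    rw [received_of_adj hi _ hG, ClusterInfo.message, hk.rep_eq, hk.their_eq _ _ hG.symm]
    have a₁ : rep q'.base (ident q.base) = q'.name := (congrArg name e').symm
    have a₂ : rep q.base (ident q'.base) = q.name := (congrArg name e).symm
    rw [a₁, a₂]
    rfl
  · rw [received_eq_none]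
    rwa [← hk.adj_iff hs hi hN]

theorem IsClusterInfo.neighbors_eq [Fintype (SplitVertex G ident rep)]
    (hk : IsClusterInfo G ident rep k) (hs : IsSplitting G ident rep)
    (hi : Function.Injective ident) (hN : ∀ v, ident v < N) (q : SplitVertex G ident rep) :
    (k q.base).neighbors N q.name =
      neighborIdents (splitGraph G ident rep) (splitIdent N G ident rep) q := by
  ext y
  rw [mem_neighborIdents, ← hk.adj_iff hs hi hN]
  simp only [ClusterInfo.neighbors, Finset.mem_filter]
  rw [and_iff_right_iff_imp, hk.adj_iff hs hi hN, Finset.mem_range]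
  rintro ⟨q', -, rfl⟩
  exact hs.splitIdent_lt hN q'

/-! ### Running the given algorithm on the clusters. -/

variable {r M : ℕ} {Out : Type} (A : Algorithm r M Out)

/-- The initial states in the simulation of `A` on the split graph. -/
noncomputable def simInit (N : ℕ) (z : ClusterInfo × (Fin r → Fin N → A.Seed)) (a : ℕ) :
    A.State × (ℕ → Option (Fin M)) :=
  (A.init (z.1.id * N + a) (z.1.neighbors N a), fun _ => none)

/-- The messages in the simulation of `A` on the split graph. -/
def simMsg (N : ℕ) (z : ClusterInfo × (Fin r → Fin N → A.Seed))
    (σ : ℕ → A.State × (ℕ → Option (Fin M))) : ℕ → Option (Fin M) :=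
  z.1.message N (fun b => (σ b).2)

/-- One round in the simulation of `A` on the split graph. -/
noncomputable def simUpd (N : ℕ) [NeZero N] (i : ℕ) (z : ClusterInfo × (Fin r → Fin N → A.Seed))
    (σ : ℕ → A.State × (ℕ → Option (Fin M))) (m : ℕ → Option (Fin M)) (a : ℕ) :
    A.State × (ℕ → Option (Fin M)) :=
  if h : i < r then A.step ⟨i, h⟩ (σ a).1 (z.1.received N (fun b => (σ b).2) m a)
    (z.2 ⟨i, h⟩ (Fin.ofNat N a)) else σ a

/-- The outputs of all members of the clusters in the simulation of `A` on the split graph. -/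
noncomputable def simOutput (N : ℕ) [NeZero N] (G : SimpleGraph V) (ident : V → ℕ)
    (z : V → ClusterInfo × (Fin r → Fin N → A.Seed)) (v : V) (a : ℕ) : Out :=
  A.output (iterate G ident z (simInit A N) (fun _ => simMsg A N) (simUpd A N) r v a).1

/-- The seeds of the vertices of the split graph in the simulation. -/
def splitSeed {Ψ : Type} (N : ℕ) [NeZero N] (G : SimpleGraph V) (ident : V → ℕ)
    (rep : V → ℕ → ℕ) (ψ : V → Fin r → Fin N → Ψ) (q : SplitVertex G ident rep) (i : Fin r) : Ψ :=
  ψ q.base i (Fin.ofNat N q.name)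

theorem simOutput_eq [NeZero N] [Fintype (SplitVertex G ident rep)]
    (hk : IsClusterInfo G ident rep k) (hs : IsSplitting G ident rep)
    (hi : Function.Injective ident) (hN : ∀ v, ident v < N) (ψ : V → Fin r → Fin N → A.Seed)
    (q : SplitVertex G ident rep) :
    simOutput A N G ident (fun v => (k v, ψ v)) q.base q.name =
      A.result (splitGraph G ident rep) (splitIdent N G ident rep)
        (splitSeed N G ident rep ψ) q := by
  have key : ∀ t (q : SplitVertex G ident rep),
      iterate G ident (fun v => (k v, ψ v)) (simInit A N) (fun _ => simMsg A N) (simUpd A N) t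
        q.base q.name =
      A.config (splitGraph G ident rep) (splitIdent N G ident rep)
        (splitSeed N G ident rep ψ) t q := by
    intro t
    induction t with
    | zero =>
      intro q
      simp only [iterate, simInit, Algorithm.config, hk.id_eq, hk.neighbors_eq hs hi hN]
      rfl
    | succ t ih =>
      intro q
      rw [Algorithm.config, iterate]
      unfold simUpd
      dsimp only
      by_cases h : t < r
      · rw [dif_pos h, dif_pos h]
        congr 1
        · exact congrArg Prod.fst (ih q)
        · have := hk.received_eq hs hi hN (fun u b => (iterate G ident (fun v => (k v, ψ v))
            (simInit A N) (fun _ => simMsg A N) (simUpd A N) t u b).2) q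
          refine Eq.trans this ?_
          simp only [ih]
          rfl
      · rw [dif_neg h, dif_neg h]
        exact ih q
  rw [simOutput, key]
  rfl

end Simulation

end PrivateTrees

namespace PrivateTrees

/-! ### Tokens that travel along the cycles of a cover -/

section Token

open SplitVertex

/-- A token carries the identifier of its origin and one further number. -/
abbrev Token (N : ℕ) : Type := Fin N × Fin N

/-- The position of `l` in `S`. -/
def slot (S : Finset ℕ) (l : ℕ) : ℕ := (S.filter (· < l)).card

theorem slot_lt_card {S : Finset ℕ} {l : ℕ} (h : l ∈ S) : slot S l < S.card :=
  Finset.card_lt_card (Finset.filter_ssubset.2 ⟨l, h, lt_irrefl l⟩)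

theorem slot_strictMono {S : Finset ℕ} {l l' : ℕ} (h : l ∈ S) (hl : l < l') :
    slot S l < slot S l' := by
  refine Finset.card_lt_card ?_
  rw [Finset.ssubset_iff_of_subset]
  · exact ⟨l, by simp [h, hl], by simp⟩
  · intro x hx
    rw [Finset.mem_filter] at hx ⊢
    exact ⟨hx.1, hx.2.trans hl⟩

theorem slot_inj {S : Finset ℕ} {l l' : ℕ} (h : l ∈ S) (h' : l' ∈ S)
    (e : slot S l = slot S l') : l = l' := by
  rcases lt_trichotomy l l' with hl | hl | hl
  · exact absurd e (slot_strictMono h hl).ne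
  · exact hl
  · exact absurd e (slot_strictMono h' hl).ne'

/-- Arrange values that are indexed by the labels in `S` as a vector. -/
noncomputable def pack {Y : Type} (c : ℕ) (S : Finset ℕ) (f : ℕ → Option Y) : Fin c → Option Y :=
  open Classical in fun j => if h : ∃ l ∈ S, slot S l = j then f h.choose else none

/-- Recover the values that are indexed by the labels in `S` from a vector. -/
def unpack {Y : Type} (c : ℕ) (S : Finset ℕ) (g : Fin c → Option Y) (l : ℕ) : Option Y :=
  if h : l ∈ S ∧ slot S l < c then g ⟨slot S l, h.2⟩ else none

/-- Distinct labels occupy distinct slots, and at most `c` labels fit into `c` slots; the labels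
themselves need not be sent because both ends of an edge know the same set. -/
theorem unpack_pack {Y : Type} {c : ℕ} {S : Finset ℕ} (f : ℕ → Option Y) (hS : S.card ≤ c)
    {l : ℕ} (hl : l ∈ S) : unpack c S (pack c S f) l = f l := by
  have hlt : slot S l < c := (slot_lt_card hl).trans_le hS
  have hex : ∃ l' ∈ S, slot S l' = slot S l := ⟨l, hl, rfl⟩
  simp only [unpack, hl, hlt, and_self, dif_pos, pack, hex]
  congr 1
  exact slot_inj hex.choose_spec.1 hl hex.choose_spec.2

theorem mem_of_unpack {Y : Type} {c : ℕ} {S : Finset ℕ} {g : Fin c → Option Y} {l : ℕ} {y : Y}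
    (h : unpack c S g l = some y) : l ∈ S := by
  by_contra hl
  simp [unpack, hl] at h

/-- What a node knows before the tokens are sent: its cluster, the labels of the cycles through the
edges at the members of its cluster, and the tokens that it emits. -/
structure TokenEnv (N : ℕ) where
  info : ClusterInfo
  labels : ℕ → ℕ → Finset ℕ
  emit : ℕ → ℕ → ℕ → Option (Token N)

/-- The tokens that are to be sent from a cluster, and the tokens received in every step. -/
abbrev TokenState (N : ℕ) : Type :=
  (ℕ → ℕ → ℕ → Option (Token N)) × (ℕ → ℕ → ℕ → ℕ → Option (Token N))

variable {N c : ℕ}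

/-- The messages of the members of the cluster. -/
noncomputable def tokenOuts (c : ℕ) (z : TokenEnv N) (σ : TokenState N) (a y : ℕ) :
    Option (Fin c → Option (Token N)) := some (pack c (z.labels a y) (σ.1 a y))

/-- The tokens received by the members of the cluster. -/
noncomputable def tokenRecv (c : ℕ) (z : TokenEnv N) (σ : TokenState N)
    (m : ℕ → Option (Fin c → Option (Token N))) (a y l : ℕ) : Option (Token N) :=
  (z.info.received N (tokenOuts c z σ) m a y).bind fun g => unpack c (z.labels a y) g l

/-- The initial state. -/
def tokenInit (z : TokenEnv N) : TokenState N := (z.emit, fun _ _ _ _ => none)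

/-- The messages sent by the node. -/
noncomputable def tokenMsg (c : ℕ) (z : TokenEnv N) (σ : TokenState N) :
    ℕ → Option (Fin c → Option (Token N)) := z.info.message N (tokenOuts c z σ)

/-- A token that does not come from the node itself is forwarded along the other edge with the
same label. -/
noncomputable def tokenUpd (c i : ℕ) (z : TokenEnv N) (σ : TokenState N)
    (m : ℕ → Option (Fin c → Option (Token N))) : TokenState N :=
  open Classical in
  (fun a y l => if h : ∃ x, x ≠ y ∧ z.info.Adj N a x ∧ l ∈ z.labels a x then
      (tokenRecv c z σ m a h.choose l).filter (fun τ => (τ.1 : ℕ) ≠ z.info.id)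
    else none,
    Function.update σ.2 i (tokenRecv c z σ m))

/-- The states of the nodes after `s` steps. -/
noncomputable def tokenRun {V : Type} (c : ℕ) (G : SimpleGraph V) (ident : V → ℕ)
    (z : V → TokenEnv N) (s : ℕ) (v : V) : TokenState N :=
  iterate G ident z tokenInit (fun _ => tokenMsg c) (tokenUpd c) s v

/-- The tokens that `v` receives in step `s`. -/
noncomputable def tokenAt {V : Type} (c : ℕ) (G : SimpleGraph V) (ident : V → ℕ)
    (z : V → TokenEnv N) (s : ℕ) (v : V) : ℕ → ℕ → ℕ → Option (Token N) :=
  tokenRecv c (z v) (tokenRun c G ident z s v)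
    (received G ident (fun u => tokenMsg c (z u) (tokenRun c G ident z s u)) v)

theorem tokenRun_history {V : Type} {G : SimpleGraph V} {ident : V → ℕ}
    {z : V → TokenEnv N} {s R : ℕ} (h : s < R) (v : V) :
    (tokenRun c G ident z R v).2 s = tokenAt c G ident z s v := by
  induction R with
  | zero => omega
  | succ R ih =>
    change Function.update (tokenRun c G ident z R v).2 R (tokenAt c G ident z R v) s = _
    rcases Nat.lt_succ_iff_lt_or_eq.1 h with h₁ | rfl
    · rw [Function.update_of_ne h₁.ne, ih h₁]
    · rw [Function.update_self]

variable {V : Type} {G : SimpleGraph V} {ident : V → ℕ} {rep : V → ℕ → ℕ}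

/-- The labels known to the nodes are those of the cycles of a cover of the split graph. -/
structure IsCoverInfo [Fintype V] (G : SimpleGraph V) (ident : V → ℕ) (rep : V → ℕ → ℕ)
    (d c : ℕ) (I : Finset ℕ) (C : ℕ → Set (Sym2 (SplitVertex G ident rep)))
    (z : V → TokenEnv N) : Prop where
  isSplitting : IsSplitting G ident rep
  injective : Function.Injective ident
  ident_lt : ∀ v, ident v < N
  info : IsClusterInfo G ident rep (fun v => (z v).info)
  cover : IsCycleCover (splitGraph G ident rep) d c I C
  mem_labels : ∀ q q', (splitGraph G ident rep).Adj q q' → ∀ l,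
    l ∈ (z q.base).labels q.name (splitIdent N G ident rep q') ↔ l ∈ I ∧ s(q, q') ∈ C l

namespace IsCoverInfo

variable [Fintype V] {d : ℕ} {I : Finset ℕ} {C : ℕ → Set (Sym2 (SplitVertex G ident rep))}
  {z : V → TokenEnv N}

theorem labels_symm (h : IsCoverInfo G ident rep d c I C z) {q q' : SplitVertex G ident rep}
    (hq : (splitGraph G ident rep).Adj q q') :
    (z q.base).labels q.name (splitIdent N G ident rep q') =
      (z q'.base).labels q'.name (splitIdent N G ident rep q) := by
  ext l
  rw [h.mem_labels _ _ hq, h.mem_labels _ _ hq.symm, Sym2.eq_swap]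

theorem card_labels_le (h : IsCoverInfo G ident rep d c I C z) {q q' : SplitVertex G ident rep}
    (hq : (splitGraph G ident rep).Adj q q') :
    ((z q.base).labels q.name (splitIdent N G ident rep q')).card ≤ c := by
  have h₁ := (h.cover.2 s(q, q') hq).2
  rw [← Set.ncard_coe_finset]
  convert h₁ using 2
  ext l
  simp [h.mem_labels _ _ hq]

/-- The sender packs and the receiver unpacks with the same label set, so the token in the sender's
slot for this edge and cycle arrives intact. -/
theorem tokenAt_eq (h : IsCoverInfo G ident rep d c I C z) {q q' : SplitVertex G ident rep}
    (hq : (splitGraph G ident rep).Adj q q') {l : ℕ} (hl : l ∈ I) (hC : s(q, q') ∈ C l) (s : ℕ) :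
    tokenAt c G ident z s q.base q.name (splitIdent N G ident rep q') l =
      (tokenRun c G ident z s q'.base).1 q'.name (splitIdent N G ident rep q) l := by
  have h₁ := congrFun (h.info.received_eq h.isSplitting h.injective h.ident_lt
    (fun u => tokenOuts c (z u) (tokenRun c G ident z s u)) q) (splitIdent N G ident rep q')
  rw [received_of_adj (h.isSplitting.injective_splitIdent h.injective h.ident_lt) _ hq] at h₁
  unfold tokenAt tokenRecv tokenMsg
  rw [h₁, tokenOuts, Option.bind_some, h.labels_symm hq]
  refine unpack_pack _ (h.card_labels_le hq.symm) ?_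
  rw [h.mem_labels _ _ hq.symm, Sym2.eq_swap]
  exact ⟨hl, hC⟩

theorem exists_of_tokenAt (h : IsCoverInfo G ident rep d c I C z) {s : ℕ} {v : V} {a y l : ℕ}
    {τ : Token N} (hτ : tokenAt c G ident z s v a y l = some τ) :
    l ∈ I ∧ ∃ q q', (splitGraph G ident rep).Adj q q' ∧ s(q, q') ∈ C l ∧ q.base = v ∧
      q.name = a ∧ splitIdent N G ident rep q' = y := by
  unfold tokenAt tokenRecv at hτ
  obtain ⟨g, hg, hu⟩ := Option.bind_eq_some_iff.1 hτ
  have hadj : (z v).info.Adj N a y := by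
    by_contra hn
    simp [ClusterInfo.received, hn] at hg
  obtain ⟨q, rfl, rfl⟩ := h.info.exists_of_adj hadj
  obtain ⟨q', hq', rfl⟩ := (h.info.adj_iff h.isSplitting h.injective h.ident_lt q y).1 hadj
  have := (h.mem_labels _ _ hq' _).1 (mem_of_unpack hu)
  exact ⟨this.1, q, q', hq', this.2, rfl, rfl, rfl⟩

/-- Each direction of each edge of a cycle holds at most one token, and every step shifts all of
them by one position. What is about to be sent at `p s` after `s` steps was therefore emitted at `p
0`, unless a cluster on the way absorbed it as its own. -/
theorem tokenRun_eq_some (h : IsCoverInfo G ident rep d c I C z) {l m : ℕ} (hl : l ∈ I)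
    {p : ℤ → SplitVertex G ident rep} (hp : IsCycleParam (splitGraph G ident rep) (C l) m p)
    (τ : Token N) (s : ℕ) :
    (tokenRun c G ident z s (p s).base).1 (p s).name (splitIdent N G ident rep (p (s + 1))) l =
      some τ ↔ (z (p 0).base).emit (p 0).name (splitIdent N G ident rep (p 1)) l = some τ ∧
        ∀ i : ℕ, 1 ≤ i → i ≤ s → ident (p i).base ≠ τ.1 := by
  induction s with
  | zero =>
    have : (∀ i : ℕ, 1 ≤ i → i ≤ 0 → ident (p i).base ≠ τ.1) := fun i h₁ h₂ => by omega
    exact Iff.trans Iff.rfl (and_iff_left this).symm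
  | succ s ih =>
    have hback : (splitGraph G ident rep).Adj (p (s + 1)) (p s) := (hp.adj s).symm
    have hCback : s(p (s + 1), p s) ∈ C l := by rw [Sym2.eq_swap]; exact hp.mem s
    have hinj := h.isSplitting.injective_splitIdent h.injective h.ident_lt
    have hex : ∃ x, x ≠ splitIdent N G ident rep (p (s + 1 + 1)) ∧
        (z (p (s + 1)).base).info.Adj N (p (s + 1)).name x ∧
        l ∈ (z (p (s + 1)).base).labels (p (s + 1)).name x := by
      refine ⟨splitIdent N G ident rep (p s), ?_, ?_, ?_⟩
      · intro e
        have := hp.ne (s + 1)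
        rw [show (s : ℤ) + 1 - 1 = s by ring] at this
        exact this (hinj e).symm
      · exact (h.info.adj_iff h.isSplitting h.injective h.ident_lt _ _).2 ⟨_, hback, rfl⟩
      · exact (h.mem_labels _ _ hback l).2 ⟨hl, hCback⟩
    -- Besides the edge towards the successor, only the edge from the predecessor carries the label
    -- `l`, so the choice in `tokenUpd` is forced.
    have huniq : ∀ x, x ≠ splitIdent N G ident rep (p (s + 1 + 1)) ∧
        (z (p (s + 1)).base).info.Adj N (p (s + 1)).name x ∧
        l ∈ (z (p (s + 1)).base).labels (p (s + 1)).name x →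
        x = splitIdent N G ident rep (p s) := by
      rintro x ⟨h₁, h₂, h₃⟩
      obtain ⟨q', hq', rfl⟩ := (h.info.adj_iff h.isSplitting h.injective h.ident_lt _ _).1 h₂
      have h₄ := ((h.mem_labels _ _ hq' l).1 h₃).2
      rw [hp.mem_iff_eq] at h₄
      rcases h₄ with rfl | rfl
      · exact absurd rfl h₁
      · congr 2
        ring
    have hstep : (tokenRun c G ident z (s + 1) (p (s + 1)).base).1 (p (s + 1)).name
        (splitIdent N G ident rep (p (s + 1 + 1))) l =
        ((tokenRun c G ident z s (p s).base).1 (p s).name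
          (splitIdent N G ident rep (p (s + 1))) l).filter
            (fun τ => (τ.1 : ℕ) ≠ ident (p (s + 1)).base) := by
      rw [← h.tokenAt_eq hback hl hCback, ← huniq _ hex.choose_spec, ← h.info.id_eq]
      exact dif_pos hex
    push_cast
    rw [hstep, Option.filter_eq_some_iff, ih, and_assoc]
    refine and_congr_right fun _ => ?_
    simp only [decide_eq_true_eq]
    constructor
    · rintro ⟨h₁, h₂⟩ i hi hi'
      rcases Nat.lt_succ_iff_lt_or_eq.1 (Nat.lt_succ_of_le hi') with hlt | rfl
      · exact h₁ i hi (by omega)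
      · push_cast
        exact h₂.symm
    · intro h₁
      refine ⟨fun i hi hi' => h₁ i hi (by omega), ?_⟩
      have := h₁ (s + 1) (by omega) le_rfl
      push_cast at this
      exact this.symm

/-- A token that follows a cycle arrives. -/
theorem tokenAt_of_param (h : IsCoverInfo G ident rep d c I C z) {l m : ℕ} (hl : l ∈ I)
    {p : ℤ → SplitVertex G ident rep} (hp : IsCycleParam (splitGraph G ident rep) (C l) m p)
    {τ : Token N} {s : ℕ}
    (hemit : (z (p 0).base).emit (p 0).name (splitIdent N G ident rep (p 1)) l = some τ)
    (hne : ∀ i : ℕ, 1 ≤ i → i ≤ s → ident (p i).base ≠ τ.1) :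
    tokenAt c G ident z s (p (s + 1)).base (p (s + 1)).name
      (splitIdent N G ident rep (p s)) l = some τ := by
  rw [h.tokenAt_eq (hp.adj s).symm hl (by rw [Sym2.eq_swap]; exact hp.mem s)]
  exact (h.tokenRun_eq_some hl hp τ s).2 ⟨hemit, hne⟩

/-- Every token that arrives has followed a cycle. -/
theorem exists_param_of_tokenAt (h : IsCoverInfo G ident rep d c I C z) {s : ℕ} {v : V}
    {a y l : ℕ} {τ : Token N} (hτ : tokenAt c G ident z s v a y l = some τ) :
    l ∈ I ∧ ∃ m ≤ d, ∃ p, IsCycleParam (splitGraph G ident rep) (C l) m p ∧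
      (p (s + 1)).base = v ∧ splitIdent N G ident rep (p s) = y ∧
      (z (p 0).base).emit (p 0).name (splitIdent N G ident rep (p 1)) l = some τ ∧
      ∀ i : ℕ, 1 ≤ i → i ≤ s → ident (p i).base ≠ τ.1 := by
  obtain ⟨hl, q, q', hq, hC, rfl, rfl, rfl⟩ := h.exists_of_tokenAt hτ
  obtain ⟨m, hm, p₀, hp₀⟩ := h.cover.exists_param hl
  rw [Sym2.eq_swap] at hC
  obtain ⟨p₁, hp₁, e₀, e₁⟩ := hp₀.exists_of_mem hC
  -- With this shift the emission has index `0` and the arrival index `s + 1`.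
  have hp := hp₁.shift (-s)
  have es : p₁ (s + -s) = q' := by rw [← e₀]; congr 1; ring
  have es' : p₁ (s + 1 + -s) = q := by rw [← e₁]; congr 1; ring
  refine ⟨hl, m, hm, _, hp, congrArg base es', congrArg _ es, ?_⟩
  have key := h.tokenRun_eq_some hl hp τ s
  rw [← h.tokenAt_eq (hp.adj s).symm hl (by rw [Sym2.eq_swap]; exact hp.mem s)] at key
  rw [es, es'] at key
  exact key.1 hτ

end IsCoverInfo

end Token

end PrivateTrees

namespace PrivateTrees

/-! ### Classes and explorations -/

section Classes

variable {S : Finset ℕ} {E : ℕ → ℕ → Prop}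

/-- The name of the class of `x` in the partition of `S` by `E`; a partition with a single class is
replaced by the partition into singletons. -/
noncomputable def classRep (S : Finset ℕ) (E : ℕ → ℕ → Prop) (x : ℕ) : ℕ :=
  open Classical in if ∀ a ∈ S, ∀ b ∈ S, E a b then x else sInf {y | y ∈ S ∧ E x y}

theorem classRep_spec (hE : Equivalence E) {x : ℕ} (hx : x ∈ S) :
    classRep S E x ∈ S ∧ E x (classRep S E x) := by
  unfold classRep
  split_ifs with h
  · exact ⟨hx, hE.refl x⟩
  · have hne : {y | y ∈ S ∧ E x y}.Nonempty := ⟨x, hx, hE.refl x⟩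
    exact Nat.sInf_mem hne

theorem rel_of_classRep_eq (hE : Equivalence E) {x y : ℕ} (hx : x ∈ S) (hy : y ∈ S)
    (h : classRep S E x = classRep S E y) : E x y := by
  have h₁ := (classRep_spec hE hx).2
  have h₂ := (classRep_spec hE hy).2
  rw [h] at h₁
  exact hE.trans h₁ (hE.symm h₂)

/-- Different names mean unrelated elements only as long as the relation is not total; in the total
case the names are those of the artificial singletons. -/
theorem not_rel_of_classRep_ne (hE : Equivalence E) (ht : ¬ ∀ a ∈ S, ∀ b ∈ S, E a b) {x y : ℕ}
    (h : classRep S E x ≠ classRep S E y) : ¬ E x y := by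
  intro hxy
  apply h
  unfold classRep
  rw [if_neg ht, if_neg ht]
  congr 1
  ext z
  exact ⟨fun hz => ⟨hz.1, hE.trans (hE.symm hxy) hz.2⟩, fun hz => ⟨hz.1, hE.trans hxy hz.2⟩⟩

/-- The fallback to singletons keeps at least two classes even at a node whose neighbours are
already all linked, as the connectivity of the split graph requires. -/
theorem exists_classRep_ne (hE : Equivalence E) (hS : 2 ≤ S.card) :
    ∃ x ∈ S, ∃ y ∈ S, classRep S E x ≠ classRep S E y := by
  by_cases h : ∀ a ∈ S, ∀ b ∈ S, E a b
  · obtain ⟨x, hx, y, hy, hxy⟩ := Finset.one_lt_card.1 hS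
    exact ⟨x, hx, y, hy, by unfold classRep; rwa [if_pos h, if_pos h]⟩
  · have h' := h
    push Not at h'
    obtain ⟨x, hx, y, hy, hxy⟩ := h'
    exact ⟨x, hx, y, hy, fun e => hxy (rel_of_classRep_eq hE hx hy e)⟩

/-- If every class merges with another one in each of `L` steps, then a single class remains of a set
with fewer than `2 ^ (L + 1)` elements. -/
theorem rel_of_merge {E : ℕ → ℕ → ℕ → Prop} {L : ℕ} (hE : ∀ t, Equivalence (E t))
    (hmono : ∀ t x y, E t x y → E (t + 1) x y)
    (hmerge : ∀ t < L, (¬ ∀ a ∈ S, ∀ b ∈ S, E t a b) →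
      ∀ x ∈ S, ∃ y ∈ S, E (t + 1) x y ∧ ¬ E t x y)
    (hcard : S.card < 2 ^ (L + 1)) : ∀ x ∈ S, ∀ y ∈ S, E L x y := by
  classical
  have hunion : ∀ t x y, ¬ E t x y →
      (S.filter (E t x)).card + (S.filter (E t y)).card =
        (S.filter (E t x) ∪ S.filter (E t y)).card := by
    intro t x y hxy
    rw [Finset.card_union_of_disjoint]
    rw [Finset.disjoint_filter]
    intro z _ h₁ h₂
    exact hxy ((hE t).trans h₁ ((hE t).symm h₂))
  -- While several classes remain, the minimal class size at least doubles in every step, because a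
  -- class of the next step contains two disjoint classes of the present one.
  have key : ∀ t ≤ L, (∀ a ∈ S, ∀ b ∈ S, E t a b) ∨ ∀ x ∈ S, 2 ^ t ≤ (S.filter (E t x)).card := by
    intro t
    induction t with
    | zero =>
      intro _
      right
      intro x hx
      rw [pow_zero, Nat.one_le_iff_ne_zero, Finset.card_ne_zero]
      exact ⟨x, by simp [hx, (hE 0).refl x]⟩
    | succ t ih =>
      intro ht
      by_cases htot : ∀ a ∈ S, ∀ b ∈ S, E t a b
      · exact Or.inl fun a ha b hb => hmono t a b (htot a ha b hb)
      · right
        have h₁ := (ih (by omega)).resolve_left htot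
        intro x hx
        obtain ⟨y, hy, hxy, hnot⟩ := hmerge t (by omega) htot x hx
        have h₂ : S.filter (E t x) ∪ S.filter (E t y) ⊆ S.filter (E (t + 1) x) := by
          refine Finset.union_subset ?_ ?_
          · intro w hw
            rw [Finset.mem_filter] at hw ⊢
            exact ⟨hw.1, hmono t _ _ hw.2⟩
          · intro w hw
            rw [Finset.mem_filter] at hw ⊢
            exact ⟨hw.1, (hE (t + 1)).trans hxy (hmono t _ _ hw.2)⟩
        have h₃ := Finset.card_le_card h₂
        rw [← hunion t x y hnot] at h₃
        have h₄ := h₁ x hx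
        have h₅ := h₁ y hy
        rw [pow_succ]
        omega
  rcases key L le_rfl with h | h
  · exact h
  · intro x hx y hy
    -- Two distinct classes would contain `2 ^ L` elements each, too many for `S`.
    by_contra hxy
    have h₁ := h x hx
    have h₂ := h y hy
    have h₃ := Finset.card_le_card (Finset.union_subset (Finset.filter_subset (E L x) S)
      (Finset.filter_subset (E L y) S))
    rw [← hunion L x y hxy] at h₃
    rw [pow_succ] at hcard
    omega

/-- A sequence of `m` oriented links that explores `S`: every link starts at the root, which is the
start of the first link, or at the end of an earlier link. A link is a label with its start and its
end. -/
structure IsExploration {α : Type} (S : Finset ℕ) (R : α → ℕ → ℕ → Prop) (m : ℕ)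
    (f : ℕ → α × ℕ × ℕ) : Prop where
  pos : 0 < m
  lt_card : m < S.card
  rel : ∀ j < m, R (f j).1 (f j).2.1 (f j).2.2
  start : ∀ j < m, (f j).2.1 = (f 0).2.1 ∨ ∃ i < j, (f i).2.2 = (f j).2.1
  cover : ∀ x ∈ S, x = (f 0).2.1 ∨ ∃ j < m, (f j).2.2 = x

/-- If no pair of `r` left `U`, then membership in `U` would be invariant under the generated
equivalence. -/
theorem exists_crossing {r : ℕ → ℕ → Prop} {U : Finset ℕ} {x y : ℕ}
    (h : Relation.EqvGen r x y) (hx : x ∈ U) (hy : y ∉ U) :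
    ∃ a b, a ∈ U ∧ b ∉ U ∧ (r a b ∨ r b a) := by
  by_contra! hcon
  have : ∀ a b, Relation.EqvGen r a b → (a ∈ U ↔ b ∈ U) := by
    intro a b hab
    induction hab with
    | rel a b hab =>
      constructor
      · intro ha
        by_contra hb
        exact (hcon a b ha hb).1 hab
      · intro hb
        by_contra ha
        exact (hcon b a hb ha).2 hab
    | refl => exact Iff.rfl
    | symm _ _ _ ih => exact ih.symm
    | trans _ _ _ _ _ ih₁ ih₂ => exact ih₁.trans ih₂
  exact hy ((this x y h).1 hx)

/-- Grow the explored set from a single element: while it is not all of `S`, connectivity provides a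
link that leaves it, and symmetry orients the link outwards. Each link adds exactly one element, so
`S.card - 1` links suffice. -/
theorem exists_isExploration {α : Type} [Nonempty α] {R : α → ℕ → ℕ → Prop} (hS : 2 ≤ S.card)
    (hR : ∀ l b a, R l b a → b ∈ S ∧ a ∈ S) (hsymm : ∀ l b a, R l b a → R l a b)
    (hconn : ∀ x ∈ S, ∀ y ∈ S, Relation.EqvGen (fun b a => ∃ l, R l b a) x y) :
    ∃ m f, IsExploration S R m f := by
  classical
  obtain ⟨ρ, hρ⟩ : S.Nonempty := Finset.card_pos.1 (by omega)
  let U : ℕ → (ℕ → α × ℕ × ℕ) → Finset ℕ := fun m f =>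
    insert ρ ((Finset.range m).image fun j => (f j).2.2)
  have key : ∀ m < S.card, ∃ f : ℕ → α × ℕ × ℕ, (∀ j < m, R (f j).1 (f j).2.1 (f j).2.2) ∧
      (∀ j < m, (f j).2.1 = ρ ∨ ∃ i < j, (f i).2.2 = (f j).2.1) ∧
      U m f ⊆ S ∧ (U m f).card = m + 1 := by
    intro m
    induction m with
    | zero =>
      intro _
      exact ⟨fun _ => Classical.arbitrary _, by simp, by simp, by simpa [U] using hρ, by simp [U]⟩
    | succ m ih =>
      intro hm
      obtain ⟨f, h₁, h₂, h₃, h₄⟩ := ih (by omega)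
      obtain ⟨y, hy, hyU⟩ : ∃ y ∈ S, y ∉ U m f := by
        by_contra! hcon
        have := Finset.card_le_card (show S ⊆ U m f from hcon)
        omega
      obtain ⟨b, a, hb, ha, hba⟩ := exists_crossing (hconn ρ hρ y hy)
        (Finset.mem_insert_self ρ _ : ρ ∈ U m f) hyU
      obtain ⟨l, hl⟩ : ∃ l, R l b a := by
        rcases hba with ⟨l, hl⟩ | ⟨l, hl⟩
        · exact ⟨l, hl⟩
        · exact ⟨l, hsymm _ _ _ hl⟩
      have hlt : ∀ j < m, Function.update f m (l, b, a) j = f j := fun j hj =>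
        Function.update_of_ne hj.ne _ _
      have hU : U (m + 1) (Function.update f m (l, b, a)) = insert a (U m f) := by
        ext x
        simp only [U, Finset.mem_insert, Finset.mem_image, Finset.mem_range]
        constructor
        · rintro (rfl | ⟨j, hj, rfl⟩)
          · exact Or.inr (Or.inl rfl)
          · rcases Nat.lt_succ_iff_lt_or_eq.1 hj with hj | rfl
            · rw [hlt j hj]
              exact Or.inr (Or.inr ⟨j, hj, rfl⟩)
            · simp
        · rintro (rfl | rfl | ⟨j, hj, rfl⟩)
          · exact Or.inr ⟨m, by omega, by simp⟩
          · exact Or.inl rfl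
          · exact Or.inr ⟨j, by omega, by rw [hlt j hj]⟩
      refine ⟨Function.update f m (l, b, a), ?_, ?_, ?_, ?_⟩
      · intro j hj
        rcases Nat.lt_succ_iff_lt_or_eq.1 hj with hj | rfl
        · rw [hlt j hj]
          exact h₁ j hj
        · simpa using hl
      · intro j hj
        rcases Nat.lt_succ_iff_lt_or_eq.1 hj with hj | rfl
        · rw [hlt j hj]
          rcases h₂ j hj with h | ⟨i, hi, h⟩
          · exact Or.inl h
          · exact Or.inr ⟨i, hi, by rw [hlt i (hi.trans hj), h]⟩
        · simp only [Finset.mem_insert, Finset.mem_image, Finset.mem_range] at hb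
          rcases hb with hb | ⟨i, hi, hb⟩
          · exact Or.inl (by simpa using hb)
          · exact Or.inr ⟨i, hi, by rw [hlt i hi, hb]; simp⟩
      · rw [hU]
        exact Finset.insert_subset (hR _ _ _ hl).2 h₃
      · rw [hU, Finset.card_insert_of_notMem ha, h₄]
  obtain ⟨f, h₁, h₂, h₃, h₄⟩ := key (S.card - 1) (by omega)
  have h₀ : (f 0).2.1 = ρ := by
    rcases h₂ 0 (by omega) with h | ⟨i, hi, -⟩
    · exact h
    · omega
  have hUS : U (S.card - 1) f = S := Finset.eq_of_subset_of_card_le h₃ (by omega)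
  refine ⟨S.card - 1, f, by omega, by omega, h₁, by rwa [h₀], ?_⟩
  intro x hx
  rw [← hUS] at hx
  simpa [U, h₀] using hx

/-- An exploration, if there is one. -/
noncomputable def exploration {α : Type} [Inhabited α] (S : Finset ℕ) (R : α → ℕ → ℕ → Prop) :
    ℕ × (ℕ → α × ℕ × ℕ) :=
  open Classical in
  if h : ∃ m f, IsExploration S R m f then (h.choose, h.choose_spec.choose) else (0, default)

theorem exploration_spec {α : Type} [Inhabited α] {R : α → ℕ → ℕ → Prop}
    (h : ∃ m f, IsExploration S R m f) :
    IsExploration S R (exploration S R).1 (exploration S R).2 := by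
  rw [exploration, dif_pos h]
  exact h.choose_spec.choose_spec

/-- The first position of the link with label `l` and start `b` in the exploration. -/
noncomputable def rank {α : Type} [Inhabited α] (S : Finset ℕ) (R : α → ℕ → ℕ → Prop) (l : α)
    (b : ℕ) : Option ℕ :=
  open Classical in
  if h : ∃ j, j < (exploration S R).1 ∧ ((exploration S R).2 j).1 = l ∧
    ((exploration S R).2 j).2.1 = b then some (Nat.find h) else none

theorem rank_spec {α : Type} [Inhabited α] {R : α → ℕ → ℕ → Prop} {l : α} {b j : ℕ}
    (h : rank S R l b = some j) : j < (exploration S R).1 ∧ ((exploration S R).2 j).1 = l ∧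
      ((exploration S R).2 j).2.1 = b := by
  classical
  unfold rank at h
  split_ifs at h with hex
  rw [← Option.some_inj.1 h]
  exact Nat.find_spec hex

/-- A token is determined by its cycle and start, so a repeated pair would be sent only once, with
its first position. An earlier position is harmless, since the end of the link is only reached
sooner. -/
theorem exists_rank_le {α : Type} [Inhabited α] {R : α → ℕ → ℕ → Prop} {j : ℕ}
    (h : j < (exploration S R).1) : ∃ i ≤ j, rank S R ((exploration S R).2 j).1
      ((exploration S R).2 j).2.1 = some i := by
  classical
  have hex : ∃ i, i < (exploration S R).1 ∧ ((exploration S R).2 i).1 =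
      ((exploration S R).2 j).1 ∧ ((exploration S R).2 i).2.1 = ((exploration S R).2 j).2.1 :=
    ⟨j, h, rfl, rfl⟩
  refine ⟨Nat.find hex, Nat.find_min' hex ⟨h, rfl, rfl⟩, ?_⟩
  unfold rank
  rw [dif_pos hex]

end Classes

end PrivateTrees

namespace PrivateTrees

/-! ### Links between the neighbours of a node -/

section Link

open SplitVertex

variable {V : Type} {G : SimpleGraph V} {ident : V → ℕ} {rep : V → ℕ → ℕ} {N c d : ℕ}

/-- A part of a parametrized cycle of the split graph from its exit from the cluster of `u` to its
first return. -/
structure IsSegment (G : SimpleGraph V) (ident : V → ℕ) (rep : V → ℕ → ℕ)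
    (C : Set (Sym2 (SplitVertex G ident rep))) (d : ℕ) (u : V) (s : ℕ)
    (p : ℤ → SplitVertex G ident rep) : Prop where
  param : ∃ m ≤ d, IsCycleParam (splitGraph G ident rep) C m p
  base_zero : (p 0).base = u
  one_le : 1 ≤ s
  base_last : (p (s + 1)).base = u
  base_ne : ∀ i : ℕ, 1 ≤ i → i ≤ s → (p i).base ≠ u

namespace IsSegment

variable {C : Set (Sym2 (SplitVertex G ident rep))} {u : V} {s : ℕ}
  {p : ℤ → SplitVertex G ident rep}

/-- After one period the cycle is back at `p 0`, hence in the cluster of `u`, so the first return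
comes within `m ≤ d` steps. -/
theorem lt (h : IsSegment G ident rep C d u s p) : s < d := by
  obtain ⟨m, hm, hp⟩ := h.param
  by_contra hs
  have h3 := hp.three_le
  refine h.base_ne m (by omega) (by omega) ?_
  rw [hp.period_eq_zero, h.base_zero]

/-- Links are symmetric because a cycle can be traversed in both directions; an exploration may need
either orientation. -/
theorem reverse (h : IsSegment G ident rep C d u s p) :
    IsSegment G ident rep C d u s (fun i => p (s + 1 - i)) where
  param := by
    obtain ⟨m, hm, hp⟩ := h.param
    refine ⟨m, hm, ?_⟩
    convert hp.reverse.shift (-(s + 1)) using 2 with i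
    congr 1
    ring
  base_zero := by rw [sub_zero]; exact h.base_last
  one_le := h.one_le
  base_last := by rw [sub_self]; exact h.base_zero
  base_ne i hi hi' := by
    have := h.base_ne (s + 1 - i) (by omega) (by omega)
    rwa [show (((s + 1 - i : ℕ)) : ℤ) = s + 1 - i by omega] at this

theorem adj_first (h : IsSegment G ident rep C d u s p) :
    ∃ hG : G.Adj u (p 1).base, p 0 = port hG ∧ p 1 = port hG.symm := by
  obtain ⟨m, hm, hp⟩ := h.param
  have h₁ := h.base_ne 1 le_rfl h.one_le
  have h₂ := hp.adj 0
  rw [zero_add] at h₂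
  have h₀ := h.base_zero
  obtain ⟨hG, e₁, e₂⟩ := eq_port_of_adj h₂ (by rw [h₀]; exact h₁.symm)
  subst h₀
  exact ⟨hG, e₁, e₂⟩

theorem adj_last (h : IsSegment G ident rep C d u s p) :
    ∃ hG : G.Adj u (p s).base, p (s + 1) = port hG ∧ p s = port hG.symm := by
  have := h.reverse.adj_first
  simpa using this

end IsSegment

/-- The emission of tokens by which the links are found. -/
def linkEmit (N : ℕ) [NeZero N] (k : ClusterInfo) (_a y _l : ℕ) : Option (Token N) :=
  if y / N = k.id then none else some (Fin.ofNat N k.id, Fin.ofNat N (y / N))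

/-- A token of the node with identifier `id` that left towards `b` on the cycle `l` has come back
from `a`. -/
def IsLink (N d id : ℕ) (h : ℕ → ℕ → ℕ → ℕ → Option (Token N)) (l b a : ℕ) : Prop :=
  ∃ s < d, ∃ x y, ∃ τ : Token N, h s x y l = some τ ∧ (τ.1 : ℕ) = id ∧ (τ.2 : ℕ) = b ∧ y / N = a

variable [Fintype V] {I : Finset ℕ} {C : ℕ → Set (Sym2 (SplitVertex G ident rep))}
  {z : V → TokenEnv N}

/-- A token is absorbed by its own cluster on return, so the arrivals at home are exactly the first
returns; the token itself recalls through which neighbour it left. -/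
theorem IsCoverInfo.isLink_iff [NeZero N] (h : IsCoverInfo G ident rep d c I C z)
    (hz : ∀ v, (z v).emit = linkEmit N (z v).info) (u : V) (l b a : ℕ) :
    IsLink N d (ident u) (tokenRun c G ident z d u).2 l b a ↔
      l ∈ I ∧ ∃ s p, IsSegment G ident rep (C l) d u s p ∧ ident (p 1).base = b ∧
        ident (p s).base = a := by
  have hdiv := h.isSplitting.splitIdent_div h.ident_lt
  have hval : ∀ v, ((Fin.ofNat N (ident v) : Fin N) : ℕ) = ident v := fun v =>
    Nat.mod_eq_of_lt (h.ident_lt v)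
  constructor
  · rintro ⟨s, hs, x, y, τ, hτ, h₁, h₂, h₃⟩
    rw [tokenRun_history hs] at hτ
    obtain ⟨hl, m, hm, p, hp, hb, rfl, hemit, hne⟩ := h.exists_param_of_tokenAt hτ
    rw [hz, linkEmit, hdiv, h.info.id_eq] at hemit
    split_ifs at hemit with hif
    have e := Option.some_inj.1 hemit
    rw [← e, hval] at h₁ h₂
    have hu : (p 0).base = u := h.injective h₁
    have hne' : ∀ i : ℕ, 1 ≤ i → i ≤ s → (p i).base ≠ u := by
      intro i hi hi' e'
      refine hne i hi hi' ?_
      rw [← e, hval, hu, e']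
    refine ⟨hl, s, p, ⟨⟨m, hm, hp⟩, hu, ?_, hb, hne'⟩, h₂, by rw [← h₃, hdiv]⟩
    -- An arrival at home in step `0` would come from an edge inside the cluster, on which no token
    -- is emitted.
    rcases Nat.eq_zero_or_pos s with rfl | hs'
    · refine absurd ?_ hif
      rw [hu, ← hb]
      rfl
    · exact hs'
  · rintro ⟨hl, s, p, hseg, rfl, rfl⟩
    obtain ⟨m, hm, hp⟩ := hseg.param
    have hu := hseg.base_zero
    have h₁ := hseg.base_ne 1 le_rfl hseg.one_le
    refine ⟨s, hseg.lt, (p (s + 1)).name, splitIdent N G ident rep (p s),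
      (Fin.ofNat N (ident u), Fin.ofNat N (ident (p 1).base)), ?_, hval _, hval _, hdiv _⟩
    rw [tokenRun_history hseg.lt]
    conv_lhs => rw [← hseg.base_last]
    refine h.tokenAt_of_param hl hp ?_ ?_
    · rw [hz, linkEmit, hdiv, h.info.id_eq, hu, if_neg]
      exact fun e => h₁ (h.injective e)
    · intro i hi hi' e
      rw [hval] at e
      exact hseg.base_ne i hi hi' (h.injective e)

/-- Some segment leaves from the class of `v` at `u` and returns to another class. -/
theorem IsCoverInfo.exists_segment (h : IsCoverInfo G ident rep d c I C z) {u v : V}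
    (huv : G.Adj u v) : ∃ l ∈ I, ∃ s p, IsSegment G ident rep (C l) d u s p ∧
      rep u (ident (p 1).base) = rep u (ident v) ∧
      rep u (ident (p s).base) ≠ rep u (ident v) := by
  classical
  have hadj := h.isSplitting.adj_center_port h.injective huv
  have hpos := (h.cover.2 s(center u, port huv) hadj).1
  obtain ⟨l, hl, hC⟩ : {l | l ∈ I ∧ s(center u, port huv) ∈ C l}.Nonempty := by
    by_contra hcon
    rw [Set.not_nonempty_iff_eq_empty] at hcon
    rw [hcon, Set.ncard_empty] at hpos
    omega
  obtain ⟨m, hm, p₀, hp₀⟩ := h.cover.exists_param hl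
  obtain ⟨p, hp, e₀, e₁⟩ := hp₀.exists_of_mem hC
  have h3 := hp.three_le
  -- The cycle runs from the centre `p 0` to the leaf `p 1`. A return to the cluster at an index
  -- from `2` on exists because `p m = p 0`; the first one ends the segment.
  have hex : ∃ i : ℕ, 2 ≤ i ∧ (p i).base = u :=
    ⟨m, by omega, by rw [hp.period_eq_zero, e₀]; rfl⟩
  obtain ⟨hi2, hiu⟩ := Nat.find_spec hex
  have hmin : ∀ j : ℕ, 2 ≤ j → j < Nat.find hex → (p j).base ≠ u := fun j hj hj' e =>
    Nat.find_min hex hj' ⟨hj, e⟩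
  have him : Nat.find hex ≤ m := Nat.find_min' hex
    ⟨by omega, by rw [hp.period_eq_zero, e₀]; rfl⟩
  generalize Nat.find hex = i at hi2 hiu hmin him
  -- Inside its cluster the leaf is adjacent only to the centre `p 0`, and a cycle does not turn
  -- back.
  have h2 : (p 2).base ≠ u := by
    intro e
    have hadj2 := hp.adj 1
    rw [show (1 : ℤ) + 1 = 2 by norm_num, e₁] at hadj2
    rcases hadj2 with ⟨-, -, h₂ | h₂⟩ | ⟨h₁, -, -⟩
    · exact h.isSplitting.rep_ne h.injective huv h₂
    · have : p 2 = p 0 := by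
        rw [e₀]
        exact ext' e (h₂.trans (by rw [e]; rfl))
      rw [hp.eq_iff] at this
      have := Int.le_of_dvd (by norm_num) this
      omega
    · rw [e] at h₁
      exact G.irrefl h₁
  have hi3 : 3 ≤ i := by
    rcases Nat.lt_or_ge 2 i with h | h
    · exact h
    · have : i = 2 := by omega
      subst this
      exact absurd hiu h2
  have hseg : IsSegment G ident rep (C l) d u (i - 2) (fun j => p (j + 1)) := by
    refine ⟨⟨m, hm, hp.shift 1⟩, ?_, by omega, ?_, ?_⟩
    · rw [zero_add, e₁]
      rfl
    · rw [show ((i - 2 : ℕ) : ℤ) + 1 + 1 = i by omega]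
      exact hiu
    · intro j hj hj'
      have := hmin (j + 1) (by omega) (by omega)
      push_cast at this
      exact this
  refine ⟨l, hl, i - 2, _, hseg, ?_, ?_⟩
  · obtain ⟨hG, ea, -⟩ := hseg.adj_first
    have h₁ := congrArg name ea
    rw [zero_add, e₁] at h₁
    exact h₁.symm
  · obtain ⟨hG, ea, -⟩ := hseg.adj_last
    have h₁ := congrArg name ea
    rw [show ((i - 2 : ℕ) : ℤ) + 1 + 1 = i by omega] at h₁
    intro e
    -- If the return were to the class of `v`, it would be to the leaf `p 1` itself, which a cycle
    -- does not meet again before a full period.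
    have hpi : p i = p 1 := by
      rw [e₁]
      exact ext' hiu (h₁.trans e)
    have hlt : i < m ∨ i = m := by omega
    rcases hlt with hlt | rfl
    · rw [hp.eq_iff] at hpi
      have := Int.le_of_dvd (by omega) hpi
      omega
    · rw [hp.period_eq_zero, hp.eq_iff] at hpi
      rw [zero_sub, dvd_neg] at hpi
      have := Int.le_of_dvd (by norm_num) hpi
      omega

end Link

end PrivateTrees

namespace PrivateTrees

/-! ### The trees given by an exploration -/

section Visit

open SplitVertex

/-- Visits `Visit w k y` of the vertices `w` from `y` at the times `k` such that the first visits
define a tree that avoids `u`. -/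
structure IsVisitPlan {V : Type} (G : SimpleGraph V) (u ρ : V) (B : ℕ)
    (Visit : V → ℕ → V → Prop) : Prop where
  root_ne : ρ ≠ u
  root : Visit ρ 0 u
  earlier : ∀ w k y, Visit w k y → w ≠ u → y ≠ u → ∃ k' < k, ∃ y', Visit y k' y'
  start : ∀ w k, Visit w k u → w ≠ u → w = ρ ∨ ∃ k' < k, ∃ y', Visit w k' y'
  adj : ∀ w k y, Visit w k y → w ≠ u → y ≠ u → y ≠ w → G.Adj w y
  unique : ∀ w w' k y y', Visit w k y → Visit w' k y' → w = w'
  lt : ∀ w k y, Visit w k y → k < B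

/-- The first visit of each vertex provides its key and its parent. Keys are distinct because a time
belongs to only one vertex, so there are at most `B` vertices, which bounds the diameter. -/
theorem IsVisitPlan.exists_tree {V : Type} [Finite V] {G : SimpleGraph V} {u ρ : V} {B : ℕ}
    {Visit : V → ℕ → V → Prop} (h : IsVisitPlan G u ρ B Visit) {α : Type} (name : V → α)
    (out : V → Option α)
    (hout : ∀ w, w ≠ u → (∃ k y, Visit w k y) → ∃ k y, Visit w k y ∧
      (∀ k' y', Visit w k' y' → k ≤ k') ∧ ((y = u → out w = none) ∧ (y ≠ u → out w = some (name y))))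
    (hnone : ∀ w, (w = u ∨ ¬ ∃ k y, Visit w k y) → out w = none) :
    ∃ T : G.Subgraph, T.coe.IsTree ∧ T.verts = {w | w ≠ u ∧ ∃ k y, Visit w k y} ∧
      T.coe.diam ≤ B ∧
      (ρ ∈ T.verts ∧ ∀ w, (∃ p, IsParent T ρ w p ∧ out w = some (name p)) ∨
        ((w = ρ ∨ w ∉ T.verts) ∧ out w = none)) ∧
      ∀ e ∈ T.edgeSet, ∃ w k y, e = s(w, y) ∧ Visit w k y ∧ w ≠ u ∧ y ≠ u := by
  classical
  have hout' : ∀ w, ∃ (k : ℕ) (y : V), (w ≠ u ∧ ∃ k y, Visit w k y) → Visit w k y ∧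
      (∀ k' y', Visit w k' y' → k ≤ k') ∧
        ((y = u → out w = none) ∧ (y ≠ u → out w = some (name y))) := by
    intro w
    by_cases hw : w ≠ u ∧ ∃ k y, Visit w k y
    · obtain ⟨k, y, h₁⟩ := hout w hw.1 hw.2
      exact ⟨k, y, fun _ => h₁⟩
    · exact ⟨0, u, fun h => absurd h hw⟩
  choose key par hkp using hout'
  have hne : ∀ w ∈ {w | w ≠ u ∧ ∃ k y, Visit w k y}, w ≠ ρ → par w ≠ u := by
    intro w hw hr e
    obtain ⟨h₁, h₂, -⟩ := hkp w hw
    rw [e] at h₁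
    rcases h.start w _ h₁ hw.1 with h₃ | ⟨k', hk', y', h₃⟩
    · exact hr h₃
    · exact absurd (h₂ _ _ h₃) (by omega)
  have hpar : ∀ w ∈ {w | w ≠ u ∧ ∃ k y, Visit w k y}, w ≠ ρ →
      par w ∈ {w | w ≠ u ∧ ∃ k y, Visit w k y} ∧ key (par w) < key w := by
    intro w hw hr
    obtain ⟨h₁, h₂, -⟩ := hkp w hw
    have hn := hne w hw hr
    obtain ⟨k', hk', y', h₃⟩ := h.earlier w _ _ h₁ hw.1 hn
    have hmem : par w ≠ u ∧ ∃ k y, Visit (par w) k y := ⟨hn, k', y', h₃⟩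
    exact ⟨hmem, ((hkp _ hmem).2.1 _ _ h₃).trans_lt hk'⟩
  have hmap : IsParentMap G {w | w ≠ u ∧ ∃ k y, Visit w k y} ρ par key := by
    refine ⟨⟨h.root_ne, 0, u, h.root⟩, fun w hw hr => (hpar w hw hr).1, fun w hw hr => ?_,
      fun w hw hr => (hpar w hw hr).2⟩
    refine h.adj w _ _ (hkp w hw).1 hw.1 (hne w hw hr) ?_
    -- Tokens also move inside a cluster, which looks like a visit of `w` from `w`, but such a visit
    -- has an earlier one before it and is never the first.
    intro e
    have := (hpar w hw hr).2
    rw [e] at this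
    omega
  refine ⟨hmap.tree, hmap.isTree, rfl, ?_, ⟨hmap.root_mem, ?_⟩, ?_⟩
  · refine hmap.diam_lt.le.trans ?_
    have hinj : Set.InjOn key {w | w ≠ u ∧ ∃ k y, Visit w k y} := by
      intro w hw w' hw' e
      have h₁ := (hkp w hw).1
      rw [e] at h₁
      exact h.unique _ _ _ _ _ h₁ (hkp w' hw').1
    have := Set.ncard_le_ncard_of_injOn (t := (Finset.range B : Set ℕ)) key
      (fun w hw => by simpa using h.lt _ _ _ (hkp w hw).1) hinj (Finset.finite_toSet _)
    rwa [Set.ncard_coe_finset, Finset.card_range] at this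
  · intro w
    by_cases hw : w ∈ {w | w ≠ u ∧ ∃ k y, Visit w k y}
    · by_cases hr : w = ρ
      · refine Or.inr ⟨Or.inl hr, ?_⟩
        obtain ⟨h₁, h₂, h₃⟩ := hkp w hw
        refine h₃.1 ?_
        by_contra hn
        obtain ⟨k', hk', -⟩ := h.earlier w _ _ h₁ hw.1 hn
        have := h₂ 0 u (hr ▸ h.root)
        omega
      · exact Or.inl ⟨par w, hmap.isParent hw hr, (hkp w hw).2.2.2 (hne w hw hr)⟩
    · refine Or.inr ⟨Or.inr hw, hnone w ?_⟩
      by_contra hcon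
      push Not at hcon
      exact hw hcon
  · intro e
    induction e with
    | h x y =>
      rintro (⟨h₁, h₂, h₃⟩ | ⟨h₁, h₂, h₃⟩)
      · have e : y = par x := h₃
        exact ⟨x, key x, y, rfl, e ▸ (hkp x h₁).1, h₁.1, e ▸ hne x h₁ h₂⟩
      · have e : x = par y := h₃
        exact ⟨y, key y, x, Sym2.eq_swap, e ▸ (hkp y h₁).1, h₁.1, e ▸ hne y h₁ h₂⟩

variable {V : Type} {G : SimpleGraph V} {ident : V → ℕ} {rep : ℕ → V → ℕ → ℕ} {d L : ℕ}
  {I : ℕ → Finset ℕ} {C : ∀ t, ℕ → Set (Sym2 (SplitVertex G ident (rep t)))}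

/-- In phase `t < L`, the token that `u` sends along the cycle `l` with number `j` arrives in step
`s` at `w` from `y`; the time of this visit is `j * d + s`. -/
def Visit (G : SimpleGraph V) (ident : V → ℕ) (rep : ℕ → V → ℕ → ℕ) (d L : ℕ)
    (I : ℕ → Finset ℕ) (C : ∀ t, ℕ → Set (Sym2 (SplitVertex G ident (rep t))))
    (rk : ℕ × ℕ → ℕ → Option ℕ) (u w : V) (k : ℕ) (y : V) : Prop :=
  ∃ t < L, ∃ l ∈ I t, ∃ (p : ℤ → SplitVertex G ident (rep t)) (s j : ℕ),
    (∃ m ≤ d, IsCycleParam (splitGraph G ident (rep t)) (C t l) m p) ∧ s < d ∧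
    rk (t, l) (ident (p 1).base) = some j ∧ (p 0).base = u ∧ (p 1).base ≠ u ∧
    (∀ i : ℕ, 1 ≤ i → i ≤ s → (p i).base ≠ u) ∧ (p (s + 1)).base = w ∧ (p s).base = y ∧
    k = j * d + s

/-- The neighbours of `u` linked by a segment in one of the phases. -/
def SegmentLink (G : SimpleGraph V) (ident : V → ℕ) (rep : ℕ → V → ℕ → ℕ) (d L : ℕ)
    (I : ℕ → Finset ℕ) (C : ∀ t, ℕ → Set (Sym2 (SplitVertex G ident (rep t)))) (u : V)
    (x : ℕ × ℕ) (b a : ℕ) : Prop :=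
  x.1 < L ∧ x.2 ∈ I x.1 ∧ ∃ s p, IsSegment G ident (rep x.1) (C x.1 x.2) d u s p ∧
    ident (p 1).base = b ∧ ident (p s).base = a

/-- A token takes fewer than `d` steps along a segment, so the link with number `i` is served within
the time window from `i * d` to `(i + 1) * d`. -/
theorem visit_of_segmentLink {u : V} {rk : ℕ × ℕ → ℕ → Option ℕ} {x : ℕ × ℕ} {b a i : ℕ}
    (h : SegmentLink G ident rep d L I C u x b a) (hi : rk x b = some i) :
    ∃ v w : V, ident v = b ∧ ident w = a ∧ v ≠ u ∧ w ≠ u ∧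
      Visit G ident rep d L I C rk u v (i * d) u ∧
      ∃ k < (i + 1) * d, ∃ y, Visit G ident rep d L I C rk u w k y := by
  obtain ⟨hL, hI, s, p, hp, rfl, rfl⟩ := h
  have hs := hp.lt
  have h₁ := hp.base_ne 1 le_rfl hp.one_le
  obtain ⟨s, rfl⟩ := Nat.exists_eq_add_of_le' hp.one_le
  refine ⟨(p 1).base, (p (s + 1 : ℕ)).base, rfl, rfl, h₁, hp.base_ne _ (by omega) le_rfl,
    ⟨x.1, hL, x.2, hI, p, 0, i, hp.param, by omega, hi, hp.base_zero, h₁,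
      fun i h h' => by omega, rfl, hp.base_zero, rfl⟩,
    i * d + s, by rw [Nat.succ_mul]; omega, (p s).base,
    ⟨x.1, hL, x.2, hI, p, s, i, hp.param, by omega, hi, hp.base_zero, h₁,
      fun i h h' => hp.base_ne i h (by omega), rfl, rfl, rfl⟩⟩

/-- The exploration of the links at `u` defines the tree of `u`. -/
theorem isVisitPlan (hi : Function.Injective ident) {u : V} {S : Finset ℕ}
    (hE : IsExploration S (SegmentLink G ident rep d L I C u)
      (exploration S (SegmentLink G ident rep d L I C u)).1
      (exploration S (SegmentLink G ident rep d L I C u)).2) :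
    ∃ ρ, IsVisitPlan G u ρ ((exploration S (SegmentLink G ident rep d L I C u)).1 * d)
      (Visit G ident rep d L I C (rank S (SegmentLink G ident rep d L I C u)) u) ∧
      ∀ v, ident v ∈ S → v ≠ u ∧
        ∃ k y, Visit G ident rep d L I C (rank S (SegmentLink G ident rep d L I C u)) u v k y := by
  set R := SegmentLink G ident rep d L I C u with hR
  obtain ⟨i₀, hi₀, hr₀⟩ := exists_rank_le hE.pos
  obtain rfl : i₀ = 0 := by omega
  obtain ⟨ρ, -, hρ, -, hρu, -, hvisit, -⟩ := visit_of_segmentLink (hE.rel 0 hE.pos) hr₀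
  rw [Nat.zero_mul] at hvisit
  have hend : ∀ j < (exploration S R).1, ∃ w : V, ident w = ((exploration S R).2 j).2.2 ∧ w ≠ u ∧
      ∃ k < (j + 1) * d, ∃ y, Visit G ident rep d L I C (rank S R) u w k y := by
    intro j hj
    obtain ⟨i, hij, hr⟩ := exists_rank_le hj
    obtain ⟨-, w, -, hw, -, hwu, -, k, hk, y, hy⟩ := visit_of_segmentLink (hE.rel j hj) hr
    exact ⟨w, hw, hwu, k, hk.trans_le (Nat.mul_le_mul_right d (by omega)), y, hy⟩
  refine ⟨ρ, ⟨hρu, hvisit, ?_, ?_, ?_, ?_, ?_⟩, ?_⟩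
  · rintro w k y ⟨t, ht, l, hl, p, s, j, hp, hs, hr, hu, h₁, hne, rfl, rfl, rfl⟩ hw hy
    rcases Nat.eq_zero_or_pos s with rfl | hs'
    · exact absurd hu hy
    · obtain ⟨s, rfl⟩ := Nat.exists_eq_add_of_le' hs'
      exact ⟨j * d + s, by omega, (p s).base, t, ht, l, hl, p, s, j, hp, by omega, hr, hu, h₁,
        fun i h h' => hne i h (by omega), rfl, rfl, rfl⟩
  · rintro w k ⟨t, ht, l, hl, p, s, j, hp, hs, hr, hu, h₁, hne, rfl, hy, rfl⟩ hw
    obtain rfl : s = 0 := by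
      by_contra hs'
      exact hne s (by omega) le_rfl hy
    have hj := rank_spec hr
    -- A link starts at the root or at the end of an earlier link; in the second case that end was
    -- visited in an earlier time window.
    rcases hE.start j hj.1 with h₂ | ⟨i, hij, h₂⟩
    · left
      apply hi
      rw [hρ, ← h₂, hj.2.2]
      rfl
    · right
      obtain ⟨w, hw₁, -, k, hk, y, hy'⟩ := hend i (hij.trans hj.1)
      have e : w = (p ((0 : ℕ) + 1)).base := by
        apply hi
        rw [hw₁, h₂, hj.2.2]
        rfl
      subst e
      refine ⟨k, ?_, y, hy'⟩
      have := Nat.mul_le_mul_right d (show i + 1 ≤ j by omega)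
      omega
  · rintro w k y ⟨t, ht, l, hl, p, s, j, ⟨m, hm, hp⟩, hs, hr, hu, h₁, hne, rfl, rfl, rfl⟩ hw hy hyw
    obtain ⟨hG, -⟩ := eq_port_of_adj (hp.adj s) hyw
    exact hG.symm
  · rintro w w' k y y' ⟨t, ht, l, hl, p, s, j, ⟨m, hm, hp⟩, hs, hr, hu, h₁, hne, rfl, rfl, rfl⟩
      ⟨t', ht', l', hl', p', s', j', ⟨m', hm', hp'⟩, hs', hr', hu', h₁', hne', rfl, rfl, hk⟩
    -- As steps are below `d`, the time determines the step as its remainder and the number of the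
    -- link as its quotient. The link then determines cycle and first edge, hence the whole run.
    have hss : s = s' := by
      have := congrArg (· % d) hk
      simpa [Nat.mul_add_mod', Nat.mod_eq_of_lt, hs, hs'] using this
    subst hss
    have hjj : j = j' := Nat.eq_of_mul_eq_mul_right (by omega) (Nat.add_right_cancel hk)
    subst hjj
    have e₁ := rank_spec hr
    have e₂ := rank_spec hr'
    have e₃ : (t, l) = (t', l') := e₁.2.1.symm.trans e₂.2.1
    have e₄ : (p 1).base = (p' 1).base := hi (e₁.2.2.symm.trans e₂.2.2)
    obtain ⟨rfl, rfl⟩ := Prod.mk.inj e₃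
    have a₁ := hp.adj 0
    have a₂ := hp'.adj 0
    rw [zero_add] at a₁ a₂
    obtain ⟨g₁, b₁, c₁⟩ := eq_port_of_adj a₁ (by rw [hu]; exact h₁.symm)
    obtain ⟨g₂, b₂, c₂⟩ := eq_port_of_adj a₂ (by rw [hu']; exact h₁'.symm)
    have f₀ : p 0 = p' 0 := by
      refine ext' (hu.trans hu'.symm) ?_
      rw [congrArg name b₁, congrArg name b₂, name_port, name_port, hu, hu', e₄]
    have f₁ : p 1 = p' 1 := by
      refine ext' e₄ ?_
      rw [congrArg name c₁, congrArg name c₂, name_port, name_port, hu, hu', e₄]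
    have := hp.eq_of_eq hp' f₀ f₁ (s + 1)
    push_cast at this
    rw [this]
  · rintro w k y ⟨t, ht, l, hl, p, s, j, hp, hs, hr, hu, h₁, hne, rfl, rfl, rfl⟩
    have hj := (rank_spec hr).1
    have := Nat.mul_le_mul_right d (show j + 1 ≤ _ from hj)
    rw [Nat.succ_mul] at this
    omega
  · intro v hv
    rcases hE.cover _ hv with h | ⟨j, hj, h⟩
    · have : v = ρ := hi (by rw [h, hρ])
      subst this
      exact ⟨hρu, 0, u, hvisit⟩
    · obtain ⟨w, hw, hwu, k, -, y, hy⟩ := hend j hj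
      have : v = w := hi (by rw [hw, h])
      subst this
      exact ⟨hwu, k, y, hy⟩

/-- Only few nodes have a token that traverses a given edge. -/
theorem ncard_visit_le [Finite V] {c : ℕ} {rk : V → ℕ × ℕ → ℕ → Option ℕ}
    (hcover : ∀ t < L, IsCycleCover (splitGraph G ident (rep t)) d c (I t) (C t))
    {e : Sym2 V} (he : e ∈ G.edgeSet) :
    {u | ∃ w k y, e = s(w, y) ∧ Visit G ident rep d L I C (rk u) u w k y}.ncard ≤
      c * d * L := by
  classical
  have := Fintype.ofFinite V
  induction e with
  | h a b =>
  have hab : G.Adj a b := he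
  -- In every phase the edge `a b` of `G` corresponds to the single edge `E t` of the split graph,
  -- so the cover property bounds the number of cycles that use it.
  let E : ∀ t, Sym2 (SplitVertex G ident (rep t)) := fun t => s(port hab, port hab.symm)
  let F : ℕ → Finset V := fun t => ((I t).filter (fun l => E t ∈ C t l)).biUnion fun l =>
    Finset.univ.filter fun u => ∃ q q', s(q, q') ∈ C t l ∧ q.base = u
  have hsub : {u | ∃ w k y, s(a, b) = s(w, y) ∧ Visit G ident rep d L I C (rk u) u w k y} ⊆
      ((Finset.range L).biUnion F : Finset V) := by
    rintro u ⟨w, k, y, hwy, t, ht, l, hl, p, s, j, ⟨m, hm, hp⟩, hs, hr, hu, h₁, hne, rfl, rfl, rfl⟩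
    simp only [Finset.coe_biUnion, Finset.coe_range, Set.mem_iUnion, Set.mem_Iio, F,
      Finset.mem_coe, Finset.mem_filter, Finset.mem_univ, true_and]
    refine ⟨t, ht, l, ⟨hl, ?_⟩, p 0, p (0 + 1), hp.mem 0, hu⟩
    have hne : (p s).base ≠ (p (s + 1)).base := by
      intro e
      rw [e] at hwy
      have : G.Adj (p (s + 1)).base (p (s + 1)).base := by
        rw [← SimpleGraph.mem_edgeSet, ← hwy]
        exact hab
      exact G.irrefl this
    obtain ⟨hG, e₁, e₂⟩ := eq_port_of_adj (hp.adj s) hne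
    have hedge : s(p s, p (s + 1)) = s(port hG, port hG.symm) :=
      congrArg₂ (fun q q' => s(q, q')) e₁ e₂
    have hmem : s(port hG, port hG.symm) ∈ C t l := hedge ▸ hp.mem s
    have hmem' : s(port hG.symm, port hG) ∈ C t l := by rwa [Sym2.eq_swap] at hmem
    clear e₁ e₂ hedge
    generalize (p (s + 1)).base = w at *
    generalize (p s).base = y at *
    rcases Sym2.eq_iff.1 hwy with ⟨rfl, rfl⟩ | ⟨rfl, rfl⟩
    · exact hmem'
    · exact hmem
  -- A cycle of at most `d` vertices meets at most `d` clusters, and only the nodes of these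
  -- clusters send tokens along it.
  have hinner : ∀ t < L, ∀ l ∈ (I t).filter (fun l => E t ∈ C t l),
      (Finset.univ.filter fun u => ∃ q q', s(q, q') ∈ C t l ∧ q.base = u).card ≤ d := by
    intro t ht l hl
    obtain ⟨m, hm, p, hp⟩ := (hcover t ht).exists_param (Finset.mem_filter.1 hl).1
    obtain ⟨hfin, hcard⟩ := hp.finite_range_ncard
    rw [← Set.ncard_coe_finset]
    refine le_trans ?_ (hcard.trans hm)
    refine le_trans (Set.ncard_le_ncard ?_ (hfin.image base)) (Set.ncard_image_le hfin)
    intro u hu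
    simp only [Finset.coe_filter, Finset.mem_univ, true_and] at hu
    obtain ⟨q, q', hq, rfl⟩ := hu
    obtain ⟨i, hi⟩ := (hp.mem_iff _).1 hq
    rcases Sym2.eq_iff.1 hi with ⟨rfl, -⟩ | ⟨rfl, -⟩
    · exact ⟨_, ⟨_, rfl⟩, rfl⟩
    · exact ⟨_, ⟨_, rfl⟩, rfl⟩
  have houter : ∀ t ∈ Finset.range L, (F t).card ≤ c * d := by
    intro t ht
    have ht' := Finset.mem_range.1 ht
    refine (Finset.card_biUnion_le_card_mul _ _ d (hinner t ht')).trans ?_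
    refine Nat.mul_le_mul_right d ?_
    have := ((hcover t ht').2 (E t) (splitGraph_adj_port hab)).2
    rw [← Set.ncard_coe_finset]
    convert this using 2
    ext l
    simp
  refine (Set.ncard_le_ncard hsub (Finset.finite_toSet _)).trans ?_
  rw [Set.ncard_coe_finset]
  refine (Finset.card_biUnion_le_card_mul _ _ _ houter).trans (le_of_eq ?_)
  rw [Finset.card_range, Nat.mul_comm]

end Visit

end PrivateTrees

namespace PrivateTrees

/-! ### The algorithm -/

section Construction

open SplitVertex

variable {r M : ℕ} (A : Algorithm r M (ℕ → Finset ℕ)) (N d c L : ℕ)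

/-- What a node remembers of a phase: its cluster in the split graph, the labels of the cycles
through the edges at its cluster, and the tokens received in every step. -/
structure PhaseRecord (N : ℕ) where
  info : ClusterInfo
  labels : ℕ → ℕ → Finset ℕ
  history : ℕ → ℕ → ℕ → ℕ → Option (Token N)

instance : Inhabited (PhaseRecord N) :=
  ⟨⟨⟨0, ∅, fun _ => 0, fun _ => 0⟩, fun _ _ => ∅, fun _ _ _ _ => none⟩⟩

/-- The equivalence relation generated by the links found in the first `t` phases. -/
def Linked (R : ℕ → PhaseRecord N) (t : ℕ) : ℕ → ℕ → Prop :=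
  Relation.EqvGen fun b a => ∃ i < t, ∃ l, IsLink N d (R i).info.id (R i).history l b a

/-- The links found in the first `L` phases; their labels consist of a phase and the label of a
cycle. -/
def PhaseLink (R : ℕ → PhaseRecord N) (x : ℕ × ℕ) (b a : ℕ) : Prop :=
  x.1 < L ∧ IsLink N d (R x.1).info.id (R x.1).history x.2 b a

/-- The emission of tokens by which the trees are built, in phase `t`, by a node with identifier
`id`. -/
noncomputable def treeEmit [NeZero N] (id : ℕ) (S : Finset ℕ) (R : ℕ → PhaseRecord N)
    (t _a y l : ℕ) : Option (Token N) :=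
  if y / N = id then none else
    (rank S (PhaseLink N d L R) (t, l) (y / N)).map fun j => (Fin.ofNat N id, Fin.ofNat N j)

/-- A token of the node with identifier `o` has arrived from the node with identifier `y`; `k` is the
time of this visit. -/
def IsCandidate (h : ℕ → ℕ → ℕ → ℕ → ℕ → Option (Token N)) (o k y : ℕ) : Prop :=
  ∃ t < L, ∃ s < d, ∃ a x l, ∃ τ : Token N, h t s a x l = some τ ∧ (τ.1 : ℕ) = o ∧
    k = τ.2 * d + s ∧ y = x / N

/-- The output of the node with identifier `id`: its parent in the tree of `o` is the node from
which the first token of `o` has arrived. -/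
noncomputable def treeOutput (id : ℕ) (h : ℕ → ℕ → ℕ → ℕ → ℕ → Option (Token N)) (o : ℕ) :
    Option ℕ :=
  open Classical in
  if hex : o ≠ id ∧ ∃ k y, IsCandidate N d L h o k y then
    if (Nat.find_spec hex.2).choose = o then none else some (Nat.find_spec hex.2).choose
  else none

variable {V : Type} [Fintype V] (G : SimpleGraph V) (ident : V → ℕ)

/-- The knowledge about the clusters after every node has announced the classes of its
neighbours. -/
noncomputable def clusterInfo [NeZero N] (rep : V → ℕ → ℕ) (u : V) : ClusterInfo :=
  ⟨ident u, neighborIdents G ident u, rep u, fun x =>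
    (received G ident (fun v y => some (Fin.ofNat N (rep v y))) u x).elim 0 Fin.val⟩

/-- The knowledge of the nodes before the links are found. -/
noncomputable def linkEnv [NeZero N] (rep : V → ℕ → ℕ) (ψ : V → Fin r → Fin N → A.Seed) (u : V) :
    TokenEnv N :=
  ⟨clusterInfo N G ident rep u,
    simOutput A N G ident (fun v => (clusterInfo N G ident rep v, ψ v)) u,
    linkEmit N (clusterInfo N G ident rep u)⟩

/-- The records of a phase. -/
noncomputable def phaseRecord [NeZero N] (rep : V → ℕ → ℕ) (ψ : V → Fin r → Fin N → A.Seed)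
    (u : V) : PhaseRecord N :=
  ⟨(linkEnv A N G ident rep ψ u).info, (linkEnv A N G ident rep ψ u).labels,
    (tokenRun c G ident (linkEnv A N G ident rep ψ) d u).2⟩

/-- The records of the first `t` phases. -/
noncomputable def records [NeZero N] (ψ : ℕ → V → Fin r → Fin N → A.Seed) :
    ℕ → V → ℕ → PhaseRecord N
  | 0 => fun _ _ => default
  | t + 1 => fun u => Function.update (records ψ t u) t
      (phaseRecord A N d c G ident (fun v => classRep (neighborIdents G ident v)
        (Linked N d (records ψ t v) t)) (ψ t) u)

/-- The classes of the neighbours in phase `t`. -/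
noncomputable def repAt [NeZero N] (ψ : ℕ → V → Fin r → Fin N → A.Seed) (t : ℕ) (u : V) : ℕ → ℕ :=
  classRep (neighborIdents G ident u) (Linked N d (records A N d c G ident ψ t u) t)

/-- The knowledge of the nodes before the tokens of phase `t` by which the trees are built are
sent. -/
noncomputable def treeEnv [NeZero N] (R : V → ℕ → PhaseRecord N) (t : ℕ) (u : V) : TokenEnv N :=
  ⟨(R u t).info, (R u t).labels, treeEmit N d L (ident u) (neighborIdents G ident u) (R u) t⟩

/-- The tokens by which the trees are built that are received in phase `t`. -/
noncomputable def treeHistory [NeZero N] (R : V → ℕ → PhaseRecord N) (u : V) (t : ℕ) :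
    ℕ → ℕ → ℕ → ℕ → Option (Token N) :=
  (tokenRun c G ident (treeEnv N d L G ident R t) d u).2

/-- The output of the algorithm. -/
noncomputable def finalOutput [NeZero N] (ψ : ℕ → V → Fin r → Fin N → A.Seed) (u : V) :
    ℕ → Option ℕ :=
  treeOutput N d L (ident u) (treeHistory N d c L G ident (records A N d c G ident ψ L) u)

/-- The simulation of the given algorithm on the split graph succeeds. -/
def SplitSucceeds [NeZero N] (rep : V → ℕ → ℕ) (ψ : V → Fin r → Fin N → A.Seed) : Prop :=
  ∀ _ : Fintype (SplitVertex G ident rep),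
    IsCycleCoverOutput (splitGraph G ident rep) (splitIdent N G ident rep) d c
      (A.result (splitGraph G ident rep) (splitIdent N G ident rep) (splitSeed N G ident rep ψ))

/-- The simulation of the given algorithm in phase `t` succeeds. -/
def PhaseSucceeds [NeZero N] (ψ : ℕ → V → Fin r → Fin N → A.Seed) (t : ℕ) : Prop :=
  SplitSucceeds A N d c G ident (repAt A N d c G ident ψ t) (ψ t)

variable {A N d c L G ident}

/-! ### Stability of the records and success of the phases. -/

theorem linked_equivalence (R : ℕ → PhaseRecord N) (t : ℕ) : Equivalence (Linked N d R t) :=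
  Relation.EqvGen.is_equivalence _

theorem linked_mono {R : ℕ → PhaseRecord N} {t t' : ℕ} (h : t ≤ t') {x y : ℕ}
    (hxy : Linked N d R t x y) : Linked N d R t' x y :=
  Relation.EqvGen.mono (fun _ _ ⟨i, hi, hl⟩ => ⟨i, hi.trans_le h, hl⟩) x y hxy

theorem linked_congr {R R' : ℕ → PhaseRecord N} {t : ℕ} (h : ∀ i < t, R i = R' i) :
    Linked N d R t = Linked N d R' t := by
  unfold Linked
  congr 1
  funext b a
  refine propext (exists_congr fun i => and_congr_right fun hi => ?_)
  rw [h i hi]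

variable [NeZero N] {ψ : ℕ → V → Fin r → Fin N → A.Seed}

theorem records_eq {t i : ℕ} (h : i < t) (u : V) : records A N d c G ident ψ t u i =
    phaseRecord A N d c G ident (repAt A N d c G ident ψ i) (ψ i) u := by
  induction t with
  | zero => omega
  | succ t ih =>
    rw [records]
    dsimp only
    rcases Nat.lt_succ_iff_lt_or_eq.1 h with h₁ | rfl
    · rw [Function.update_of_ne h₁.ne, ih h₁]
    · rw [Function.update_self]
      rfl

/-- A record is never overwritten, and the classes of phase `t` depend only on the records of
earlier phases, so they can be read off the final records. -/
theorem repAt_eq {t : ℕ} (h : t ≤ L) (u : V) : repAt A N d c G ident ψ t u =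
    classRep (neighborIdents G ident u) (Linked N d (records A N d c G ident ψ L u) t) := by
  unfold repAt
  rw [linked_congr]
  intro i hi
  rw [records_eq hi, records_eq (hi.trans_le h)]

-- Connectivity gives one neighbour `v`; connectivity after the removal of `v` gives a second one.
omit [NeZero N] in
theorem TwoVertexConnected.two_le_card (hG : TwoVertexConnected G)
    (hi : Function.Injective ident) (u : V) : 2 ≤ (neighborIdents G ident u).card := by
  obtain ⟨w, hw, -⟩ := hG.exists_ne_ne u u
  obtain ⟨v, hv⟩ : ∃ v, G.Adj u v := by
    obtain ⟨p⟩ := hG.connected.preconnected u w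
    cases p with
    | nil => exact absurd rfl hw
    | cons h _ => exact ⟨_, h⟩
  obtain ⟨x, hxu, hxv⟩ := hG.exists_ne_ne u v
  obtain ⟨v', hv', hne⟩ : ∃ v', G.Adj u v' ∧ v' ≠ v := by
    obtain ⟨p⟩ := (hG.2 v).preconnected ⟨u, hv.ne⟩ ⟨x, hxv⟩
    cases p with
    | nil => exact absurd rfl hxu
    | @cons _ y _ h _ => exact ⟨y.1, h, y.2⟩
  refine Finset.one_lt_card.2 ⟨ident v, mem_neighborIdents.2 ⟨v, hv, rfl⟩, ident v',
    mem_neighborIdents.2 ⟨v', hv', rfl⟩, fun e => hne (hi e).symm⟩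

theorem isSplitting_repAt (hG : TwoVertexConnected G) (hi : Function.Injective ident) (t : ℕ) :
    IsSplitting G ident (repAt A N d c G ident ψ t) where
  exists_ident u v h := by
    have := (classRep_spec (linked_equivalence (d := d) (records A N d c G ident ψ t u) t)
      (mem_neighborIdents.2 ⟨v, h, rfl⟩ : ident v ∈ neighborIdents G ident u)).1
    obtain ⟨w, hw, e⟩ := mem_neighborIdents.1 this
    exact ⟨w, hw, e.symm⟩
  exists_ne u := by
    obtain ⟨x, hx, y, hy, hne⟩ := exists_classRep_ne
      (linked_equivalence (d := d) (records A N d c G ident ψ t u) t) (hG.two_le_card hi u)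
    obtain ⟨v, hv, rfl⟩ := mem_neighborIdents.1 hx
    obtain ⟨w, hw, rfl⟩ := mem_neighborIdents.1 hy
    exact ⟨v, w, hv, hw, hne⟩

theorem isClusterInfo_clusterInfo {rep : V → ℕ → ℕ} (hs : IsSplitting G ident rep)
    (hi : Function.Injective ident) (hN : ∀ v, ident v < N) :
    IsClusterInfo G ident rep (clusterInfo N G ident rep) where
  id_eq _ := rfl
  nbrs_eq _ := rfl
  rep_eq _ := rfl
  their_eq u v h := by
    obtain ⟨w, -, e⟩ := hs.exists_ident v u h.symm
    simp only [clusterInfo, received_of_adj hi _ h, Option.elim_some]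
    exact Nat.mod_eq_of_lt (e ▸ hN w)

/-- In a successful phase the nodes know a cycle cover of the split graph. -/
theorem PhaseSucceeds.exists_isCoverInfo {t : ℕ} (h : PhaseSucceeds A N d c G ident ψ t)
    (hG : TwoVertexConnected G) (hi : Function.Injective ident) (hN : ∀ v, ident v < N) :
    ∃ I C, IsCoverInfo G ident (repAt A N d c G ident ψ t) d c I C
      (linkEnv A N G ident (repAt A N d c G ident ψ t) (ψ t)) := by
  have hs := isSplitting_repAt (A := A) (N := N) (d := d) (c := c) (ψ := ψ) hG hi t
  have := hs.finite
  have := Fintype.ofFinite (SplitVertex G ident (repAt A N d c G ident ψ t))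
  obtain ⟨I, C, hC, hl⟩ := h this
  have hk := isClusterInfo_clusterInfo hs hi hN
  refine ⟨I, C, hs, hi, hN, hk, hC, fun q q' hq l => ?_⟩
  rw [← hl q q' hq l, ← simOutput_eq A hk hs hi hN]
  rfl

omit [NeZero N] in
theorem IsCoverInfo.congr {rep : V → ℕ → ℕ} {I : Finset ℕ}
    {C : ℕ → Set (Sym2 (SplitVertex G ident rep))} {z z' : V → TokenEnv N}
    (h : IsCoverInfo G ident rep d c I C z) (h₁ : ∀ v, (z' v).info = (z v).info)
    (h₂ : ∀ v, (z' v).labels = (z v).labels) : IsCoverInfo G ident rep d c I C z' where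
  isSplitting := h.isSplitting
  injective := h.injective
  ident_lt := h.ident_lt
  info := by simpa only [h₁] using h.info
  cover := h.cover
  mem_labels := by simpa only [h₂] using h.mem_labels

/-- If all phases succeed, then all neighbours of a node are linked. -/
theorem linked_of_succeeds (hG : TwoVertexConnected G) (hi : Function.Injective ident)
    (hN : ∀ v, ident v < N) (hall : ∀ t < L, PhaseSucceeds A N d c G ident ψ t) (u : V)
    (hcard : (neighborIdents G ident u).card < 2 ^ (L + 1)) :
    ∀ x ∈ neighborIdents G ident u, ∀ y ∈ neighborIdents G ident u,
      Linked N d (records A N d c G ident ψ L u) L x y := by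
  refine rel_of_merge (fun t => linked_equivalence _ t) (fun t x y => linked_mono t.le_succ) ?_
    hcard
  intro t ht htot x hx
  obtain ⟨v, hv, rfl⟩ := mem_neighborIdents.1 hx
  obtain ⟨I, C, hinfo⟩ := (hall t ht).exists_isCoverInfo hG hi hN
  obtain ⟨l, hl, s, p, hp, h₁, h₂⟩ := hinfo.exists_segment hv
  have hlink := (hinfo.isLink_iff (fun _ => rfl) u l _ _).2 ⟨hl, s, p, hp, rfl, rfl⟩
  rw [repAt_eq ht.le] at h₁ h₂
  have hE := linked_equivalence (d := d) (records A N d c G ident ψ L u) t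
  obtain ⟨a₁, -⟩ := hp.adj_first
  obtain ⟨a₂, -⟩ := hp.adj_last
  have m₁ : ident (p 1).base ∈ neighborIdents G ident u := mem_neighborIdents.2 ⟨_, a₁, rfl⟩
  have m₂ : ident (p s).base ∈ neighborIdents G ident u := mem_neighborIdents.2 ⟨_, a₂, rfl⟩
  -- The segment starts in the class of `x`, already linked to `x` in phase `t`, and ends in another
  -- class; its link merges the two.
  refine ⟨ident (p s).base, m₂, ?_, ?_⟩
  · refine (linked_equivalence _ _).trans
      (linked_mono t.le_succ (hE.symm (rel_of_classRep_eq hE m₁ hx h₁))) ?_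
    refine Relation.EqvGen.rel _ _ ⟨t, t.lt_succ_self, l, ?_⟩
    rw [records_eq ht]
    exact hlink
  · exact fun h => not_rel_of_classRep_ne hE htot h₂ (hE.symm h)

end Construction

end PrivateTrees

namespace PrivateTrees

/-! ### Correctness of the construction when all phases succeed. -/

section Correctness

open SplitVertex

variable {r M : ℕ} {A : Algorithm r M (ℕ → Finset ℕ)} {N d c L : ℕ} [NeZero N]
  {V : Type} [Fintype V] {G : SimpleGraph V} {ident : V → ℕ}
  {ψ : ℕ → V → Fin r → Fin N → A.Seed}
  {I : ℕ → Finset ℕ} {C : ∀ t, ℕ → Set (Sym2 (SplitVertex G ident (repAt A N d c G ident ψ t)))}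

theorem phaseLink_eq (hinfo : ∀ t < L, IsCoverInfo G ident (repAt A N d c G ident ψ t) d c (I t)
      (C t) (linkEnv A N G ident (repAt A N d c G ident ψ t) (ψ t))) (u : V) :
    PhaseLink N d L (records A N d c G ident ψ L u) =
      SegmentLink G ident (repAt A N d c G ident ψ) d L I C u := by
  funext x b a
  refine propext (and_congr_right fun hx => ?_)
  rw [records_eq hx]
  exact (hinfo x.1 hx).isLink_iff (fun _ => rfl) u x.2 b a

/-- The links of all phases together connect the neighbours of `u`, and reversal of segments makes
them symmetric, so `exists_isExploration` applies. -/
theorem exists_exploration (hG : TwoVertexConnected G) (hi : Function.Injective ident)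
    (hN : ∀ v, ident v < N) (hall : ∀ t < L, PhaseSucceeds A N d c G ident ψ t)
    (hinfo : ∀ t < L, IsCoverInfo G ident (repAt A N d c G ident ψ t) d c (I t)
      (C t) (linkEnv A N G ident (repAt A N d c G ident ψ t) (ψ t))) (u : V)
    (hcard : (neighborIdents G ident u).card < 2 ^ (L + 1)) :
    ∃ m f, IsExploration (neighborIdents G ident u)
      (SegmentLink G ident (repAt A N d c G ident ψ) d L I C u) m f := by
  refine exists_isExploration (hG.two_le_card hi u) ?_ ?_ ?_
  · rintro x b a ⟨-, -, s, p, hp, rfl, rfl⟩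
    obtain ⟨h₁, -⟩ := hp.adj_first
    obtain ⟨h₂, -⟩ := hp.adj_last
    exact ⟨mem_neighborIdents.2 ⟨_, h₁, rfl⟩, mem_neighborIdents.2 ⟨_, h₂, rfl⟩⟩
  · rintro x b a ⟨hx, hl, s, p, hp, rfl, rfl⟩
    refine ⟨hx, hl, s, _, hp.reverse, ?_, ?_⟩
    · rw [show (s : ℤ) + 1 - 1 = s by ring]
    · rw [show (s : ℤ) + 1 - s = 1 by ring]
  · intro x hx y hy
    refine Relation.EqvGen.mono ?_ x y (linked_of_succeeds hG hi hN hall u hcard x hx y hy)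
    rintro b a ⟨i, hi', l, hl⟩
    refine ⟨(i, l), ?_⟩
    rw [← phaseLink_eq hinfo]
    exact ⟨hi', hl⟩

/-- The candidates for the parent are the senders of visiting tokens. -/
theorem isCandidate_iff (hinfo : ∀ t < L, IsCoverInfo G ident (repAt A N d c G ident ψ t) d c (I t)
      (C t) (linkEnv A N G ident (repAt A N d c G ident ψ t) (ψ t)))
    (hi : Function.Injective ident) (hN : ∀ v, ident v < N)
    (hE : ∀ u, IsExploration (neighborIdents G ident u)
      (SegmentLink G ident (repAt A N d c G ident ψ) d L I C u)
      (exploration (neighborIdents G ident u)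
        (SegmentLink G ident (repAt A N d c G ident ψ) d L I C u)).1
      (exploration (neighborIdents G ident u)
        (SegmentLink G ident (repAt A N d c G ident ψ) d L I C u)).2) (w : V) (o k x : ℕ) :
    IsCandidate N d L (treeHistory N d c L G ident (records A N d c G ident ψ L) w) o k x ↔
      ∃ u y, ident u = o ∧ ident y = x ∧ Visit G ident (repAt A N d c G ident ψ) d L I C
        (rank (neighborIdents G ident u)
          (SegmentLink G ident (repAt A N d c G ident ψ) d L I C u)) u w k y := by
  have hinfo' : ∀ t < L, IsCoverInfo G ident (repAt A N d c G ident ψ t) d c (I t)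
      (C t) (treeEnv N d L G ident (records A N d c G ident ψ L) t) := fun t ht =>
    (hinfo t ht).congr (fun v => by rw [treeEnv, records_eq ht]; rfl)
      (fun v => by rw [treeEnv, records_eq ht]; rfl)
  have hval : ∀ v, ((Fin.ofNat N (ident v) : Fin N) : ℕ) = ident v := fun v =>
    Nat.mod_eq_of_lt (hN v)
  -- A position is smaller than the number of neighbours, hence than `N`, so storing it in a token
  -- loses nothing.
  have hrank : ∀ {u l b j}, rank (neighborIdents G ident u)
      (SegmentLink G ident (repAt A N d c G ident ψ) d L I C u) l b = some j →
      ((Fin.ofNat N j : Fin N) : ℕ) = j := by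
    intro u l b j hj
    refine Nat.mod_eq_of_lt ?_
    have h₁ := (rank_spec hj).1
    have h₂ := (hE u).lt_card
    have h₃ : neighborIdents G ident u ⊆ Finset.range N := by
      intro x hx
      obtain ⟨v, -, rfl⟩ := mem_neighborIdents.1 hx
      exact Finset.mem_range.2 (hN v)
    have h₄ := Finset.card_le_card h₃
    rw [Finset.card_range] at h₄
    omega
  constructor
  · rintro ⟨t, ht, s, hs, a, y, l, τ, hτ, rfl, rfl, rfl⟩
    rw [treeHistory, tokenRun_history hs] at hτ
    obtain ⟨hl, m, hm, p, hp, hb, rfl, hemit, hne⟩ := (hinfo' t ht).exists_param_of_tokenAt hτ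
    have hdiv := (hinfo' t ht).isSplitting.splitIdent_div hN
    simp only [treeEnv, treeEmit, hdiv] at hemit
    split_ifs at hemit with hif
    rw [phaseLink_eq hinfo, Option.map_eq_some_iff] at hemit
    obtain ⟨j, hj, e⟩ := hemit
    have e₁ : (τ.1 : ℕ) = ident (p 0).base := by rw [← e, hval]
    have e₂ : (τ.2 : ℕ) = j := by rw [← e]; exact hrank hj
    refine ⟨(p 0).base, (p s).base, e₁.symm, (hdiv _).symm, t, ht, l, hl, p, s, j, ⟨m, hm, hp⟩, hs,
      hj, rfl, fun e => hif (by rw [e]), fun i h h' e => ?_, hb, rfl, by rw [e₂]⟩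
    exact hne i h h' (by rw [e, e₁])
  · rintro ⟨u, y, rfl, rfl, t, ht, l, hl, p, s, j, ⟨m, hm, hp⟩, hs, hr, rfl, h₁, hne, rfl, rfl, rfl⟩
    have hdiv := (hinfo' t ht).isSplitting.splitIdent_div hN
    refine ⟨t, ht, s, hs, (p (s + 1)).name, splitIdent N G ident _ (p s), l,
      (Fin.ofNat N (ident (p 0).base), Fin.ofNat N j), ?_, hval _, ?_, (hdiv _).symm⟩
    · rw [treeHistory, tokenRun_history hs]
      refine (hinfo' t ht).tokenAt_of_param hl hp ?_ ?_
      · simp only [treeEnv, treeEmit, hdiv]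
        rw [if_neg (fun e => h₁ (hi e)), phaseLink_eq hinfo, hr]
        rfl
      · intro i h h' e
        rw [hval] at e
        exact hne i h h' (hi e)
    · rw [hrank hr]

/-- If all phases succeed, then the algorithm constructs private neighbourhood trees. -/
theorem isPrivateTreesOutput_finalOutput {Δ : ℕ} (hG : TwoVertexConnected G)
    (hi : Function.Injective ident) (hN : ∀ v, ident v < N)
    (hΔ : ∀ v, (G.neighborSet v).ncard ≤ Δ)
    (hL : ∀ v, (neighborIdents G ident v).card < 2 ^ (L + 1))
    (hall : ∀ t < L, PhaseSucceeds A N d c G ident ψ t) :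
    IsPrivateTreesOutput G ident (d * Δ) (c * d * L)
      (finalOutput A N d c L G ident ψ) := by
  classical
  have hex : ∀ t, ∃ (I : Finset ℕ)
      (C : ℕ → Set (Sym2 (SplitVertex G ident (repAt A N d c G ident ψ t)))), t < L →
      IsCoverInfo G ident (repAt A N d c G ident ψ t) d c I C
        (linkEnv A N G ident (repAt A N d c G ident ψ t) (ψ t)) := by
    intro t
    by_cases ht : t < L
    · obtain ⟨I, C, h⟩ := (hall t ht).exists_isCoverInfo hG hi hN
      exact ⟨I, C, fun _ => h⟩
    -- Arbitrary values for `t ≥ L`, so that covers can be chosen for all `t` at once.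
    · exact ⟨∅, fun _ => ∅, fun h => absurd h ht⟩
  choose I C hinfo using hex
  have hE := fun u => exploration_spec (exists_exploration hG hi hN hall hinfo u (hL u))
  have hcand := isCandidate_iff hinfo hi hN hE
  set rk := fun u : V => rank (neighborIdents G ident u)
    (SegmentLink G ident (repAt A N d c G ident ψ) d L I C u) with hrk
  have htree : ∀ u, ∃ T : G.Subgraph, (T.coe.IsTree ∧ G.neighborSet u ⊆ T.verts ∧ u ∉ T.verts ∧
      T.coe.diam ≤ d * Δ) ∧
      (∃ ρ ∈ T.verts, ∀ w, (∃ p, IsParent T ρ w p ∧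
          finalOutput A N d c L G ident ψ w (ident u) = some (ident p)) ∨
        ((w = ρ ∨ w ∉ T.verts) ∧ finalOutput A N d c L G ident ψ w (ident u) = none)) ∧
      ∀ e ∈ T.edgeSet, ∃ w k y, e = s(w, y) ∧
        Visit G ident (repAt A N d c G ident ψ) d L I C (rk u) u w k y := by
    intro u
    obtain ⟨ρ, hplan, hcover⟩ := isVisitPlan hi (hE u)
    have hvc : ∀ w k y, Visit G ident (repAt A N d c G ident ψ) d L I C (rk u) u w k y →
        IsCandidate N d L (treeHistory N d c L G ident (records A N d c G ident ψ L) w)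
          (ident u) k (ident y) := fun w k y h => (hcand w _ k _).2 ⟨u, y, rfl, rfl, h⟩
    have hcv : ∀ w k x, IsCandidate N d L
        (treeHistory N d c L G ident (records A N d c G ident ψ L) w) (ident u) k x →
        ∃ y, ident y = x ∧ Visit G ident (repAt A N d c G ident ψ) d L I C (rk u) u w k y := by
      intro w k x h
      obtain ⟨u', y, h₁, h₂, h₃⟩ := (hcand w _ k _).1 h
      obtain rfl := hi h₁
      exact ⟨y, h₂, h₃⟩
    obtain ⟨T, h₁, h₂, h₃, h₄, h₅⟩ := hplan.exists_tree ident
      (fun w => finalOutput A N d c L G ident ψ w (ident u)) (by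
        intro w hw ⟨k, y, hky⟩
        have hex : ident u ≠ ident w ∧ ∃ k y, IsCandidate N d L
            (treeHistory N d c L G ident (records A N d c G ident ψ L) w) (ident u) k y :=
          ⟨fun e => hw (hi e).symm, k, _, hvc w k y hky⟩
        obtain ⟨y', hy', hv⟩ := hcv w _ _ (Nat.find_spec hex.2).choose_spec
        refine ⟨Nat.find hex.2, y', hv, fun k' y'' h => Nat.find_min' hex.2 ⟨_, hvc _ _ _ h⟩, ?_, ?_⟩
        · rintro rfl
          unfold finalOutput treeOutput
          rw [dif_pos hex, if_pos hy'.symm]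
        · intro hne
          unfold finalOutput treeOutput
          rw [dif_pos hex, if_neg (fun e => hne (hi (hy'.trans e))), hy'])
      (by
        intro w hw
        unfold finalOutput treeOutput
        rw [dif_neg]
        rintro ⟨h₁, k, x, h₂⟩
        rcases hw with rfl | hw
        · exact h₁ rfl
        · obtain ⟨y, -, hy⟩ := hcv w k x h₂
          exact hw ⟨k, y, hy⟩)
    refine ⟨T, ⟨h₁, ?_, ?_, ?_⟩, ⟨ρ, h₄⟩, ?_⟩
    · intro v hv
      rw [h₂]
      exact hcover v (mem_neighborIdents.2 ⟨v, hv, rfl⟩)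
    · rw [h₂]
      exact fun h => h.1 rfl
    · refine h₃.trans ?_
      have h₆ := (hE u).lt_card
      have h₇ : (neighborIdents G ident u).card ≤ Δ := by
        refine le_trans ?_ (hΔ u)
        rw [neighborIdents, ← Set.ncard_coe_finset, Finset.coe_image]
        refine (Set.ncard_image_le (Finset.finite_toSet _)).trans (le_of_eq ?_)
        congr 1
        ext v
        simp
      rw [Nat.mul_comm d]
      exact Nat.mul_le_mul_right d (by omega)
    · intro e he
      obtain ⟨w, k, y, h₆, h₇, -⟩ := h₅ e he
      exact ⟨w, k, y, h₆, h₇⟩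
  choose T hT₁ hT₂ hT₃ using htree
  refine ⟨T, ⟨hT₁, fun e he => ?_⟩, hT₂, ?_⟩
  · refine le_trans (Set.ncard_le_ncard (fun u hu => hT₃ u e hu) (Set.toFinite _)) ?_
    exact ncard_visit_le (fun t ht => (hinfo t ht).cover) he
  · intro w x hx
    unfold finalOutput treeOutput
    rw [dif_neg]
    rintro ⟨-, k, y, h⟩
    obtain ⟨u, -, hu, -⟩ := (hcand w x k y).1 h
    exact hx u hu

end Correctness

end PrivateTrees

namespace PrivateTrees

/-! ### The failure probability -/

section Probability

open SplitVertex

variable {r M : ℕ} {A : Algorithm r M (ℕ → Finset ℕ)} {N d c L : ℕ} [NeZero N]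
  {V : Type} [Fintype V] {G : SimpleGraph V} {ident : V → ℕ}

theorem records_congr {ψ ψ' : ℕ → V → Fin r → Fin N → A.Seed} {t : ℕ}
    (h : ∀ i < t, ψ i = ψ' i) :
    records A N d c G ident ψ t = records A N d c G ident ψ' t := by
  induction t with
  | zero => rfl
  | succ t ih =>
    rw [records, records, ih fun i hi => h i (by omega), h t (by omega)]

/-- The split graph of phase `t` does not depend on the seeds of phase `t` or later; this
independence allows the failure bound of the given algorithm to be used in every phase. -/
theorem repAt_congr {ψ ψ' : ℕ → V → Fin r → Fin N → A.Seed} {t : ℕ}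
    (h : ∀ i < t, ψ i = ψ' i) :
    repAt A N d c G ident ψ t = repAt A N d c G ident ψ' t := by
  unfold repAt
  rw [records_congr h]

/-- The seeds of all nodes in all phases. -/
noncomputable def phaseSeeds (A : Algorithm r M (ℕ → Finset ℕ)) (N L : ℕ)
    (φ : V → Fin L → Fin r → Fin N → A.Seed) (t : ℕ) (v : V) : Fin r → Fin N → A.Seed :=
  have := A.seedNonempty
  if h : t < L then φ v ⟨t, h⟩ else Classical.arbitrary _

/-- The simulation on a split graph fails with the failure probability of the simulated
algorithm. -/
theorem card_not_splitSucceeds_le {n D Δ κ : ℕ} {δ : ℝ} (hκ : N = n ^ κ)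
    (hA : ConstructsCycleCovers A (n ^ 2) (3 * D + 2) Δ κ d c δ)
    (hG : IsNetwork n D Δ κ G ident) {rep : V → ℕ → ℕ} (hs : IsSplitting G ident rep) :
    (Nat.card {z : V → Fin r → Fin N → A.Seed // ¬ SplitSucceeds A N d c G ident rep z} : ℝ) ≤
      δ * Nat.card (V → Fin r → Fin N → A.Seed) := by
  have := A.seedFinite
  have := A.seedNonempty
  have := hs.finite
  have inst := Fintype.ofFinite (SplitVertex G ident rep)
  have hid : ∀ v, ident v < N := by rw [hκ]; exact hG.2.2.2.2.2
  have hfail := hA _ _ _ (hs.isNetwork hG)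
  rw [← hκ] at hfail
  -- A node draws a seed for every possible name and round. The members of its cluster that exist
  -- use distinct ones, so the simulated seeds are independent and uniform.
  let j : SplitVertex G ident rep × Fin r → V × Fin r × Fin N :=
    fun x => (x.1.base, x.2, Fin.ofNat N x.1.name)
  have hj : Function.Injective j := by
    rintro ⟨q, i⟩ ⟨q', i'⟩ h
    simp only [j, Prod.mk.injEq] at h
    obtain ⟨w, hw, -⟩ := hs.exists_name q
    obtain ⟨w', hw', -⟩ := hs.exists_name q'
    have hval := congrArg Fin.val h.2.2
    have h₁ : q.name % N = q'.name % N := hval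
    rw [Nat.mod_eq_of_lt (hw ▸ hid w), Nat.mod_eq_of_lt (hw' ▸ hid w')] at h₁
    rw [ext' h.1 h₁, h.2.1]
  let P : (SplitVertex G ident rep → ℕ → Finset ℕ) → Prop :=
    IsCycleCoverOutput (splitGraph G ident rep) (splitIdent N G ident rep) d c
  have hcount := card_comp_injective (S := A.Seed) hj (fun g => ¬ P (A.result
    (splitGraph G ident rep) (splitIdent N G ident rep) (fun q i => g (q, i))))
  have h₁ : Nat.card {f : V × Fin r × Fin N → A.Seed // ¬ P (A.result
      (splitGraph G ident rep) (splitIdent N G ident rep) (fun q i => (f ∘ j) (q, i)))} =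
      Nat.card {z : V → Fin r → Fin N → A.Seed // ¬ SplitSucceeds A N d c G ident rep z} := by
    let e : (V × Fin r × Fin N → A.Seed) ≃ (V → Fin r → Fin N → A.Seed) :=
      (Equiv.curry _ _ _).trans (Equiv.arrowCongr (Equiv.refl V) (Equiv.curry _ _ _))
    refine Nat.card_congr (Equiv.subtypeEquiv e ?_)
    intro f
    refine not_congr ⟨fun h inst' => ?_, fun h => h inst⟩
    rw [Subsingleton.elim inst' inst]
    exact h
  have h₂ : Nat.card (V × Fin r × Fin N → A.Seed) = Nat.card (V → Fin r → Fin N → A.Seed) :=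
    Nat.card_congr ((Equiv.curry _ _ _).trans (Equiv.arrowCongr (Equiv.refl V) (Equiv.curry _ _ _)))
  have h₃ : (Nat.card {g : SplitVertex G ident rep × Fin r → A.Seed // ¬ P (A.result
      (splitGraph G ident rep) (splitIdent N G ident rep) (fun q i => g (q, i)))} : ℝ) /
      Nat.card (SplitVertex G ident rep × Fin r → A.Seed) ≤ δ := by
    refine le_trans (le_of_eq ?_) hfail
    unfold Algorithm.failureProb
    congr 2
    · exact Nat.card_congr (Equiv.subtypeEquiv (Equiv.curry _ _ _) fun g => Iff.rfl)
    · exact Nat.card_congr (Equiv.curry _ _ _)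
  rw [← hcount, h₁, h₂, div_le_iff₀ (by exact_mod_cast Nat.card_pos)] at h₃
  exact h₃

/-- The probability that some phase fails. -/
theorem card_not_finalOutput_le {n D Δ κ : ℕ} {δ : ℝ} (hκ : N = n ^ κ)
    (hA : ConstructsCycleCovers A (n ^ 2) (3 * D + 2) Δ κ d c δ)
    (hG : IsNetwork n D Δ κ G ident)
    (hL : ∀ v, (neighborIdents G ident v).card < 2 ^ (L + 1)) :
    (Nat.card {φ : V → Fin L → Fin r → Fin N → A.Seed // ¬ IsPrivateTreesOutput G ident (d * Δ)
      (c * d * L) (finalOutput A N d c L G ident (phaseSeeds A N L φ))} : ℝ) ≤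
      L * δ * Nat.card (V → Fin L → Fin r → Fin N → A.Seed) := by
  classical
  have := A.seedFinite
  have := A.seedNonempty
  obtain ⟨h2, -, -, hΔ, hi, hid⟩ := id hG
  rw [← hκ] at hid
  have hphase : ∀ t : Fin L, (Nat.card {φ : V → Fin L → Fin r → Fin N → A.Seed //
      ¬ PhaseSucceeds A N d c G ident (phaseSeeds A N L φ) t} : ℝ) ≤
      δ * Nat.card (V → Fin L → Fin r → Fin N → A.Seed) := by
    intro t
    let e : (V → Fin L → Fin r → Fin N → A.Seed) ≃ (Fin L → V → Fin r → Fin N → A.Seed) :=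
      Equiv.piComm _
    -- With the seeds of the other phases fixed, the split graph is fixed and only the seeds of
    -- phase `t` vary.
    have hupd := card_le_of_update t (fun Φ : Fin L → V → Fin r → Fin N → A.Seed =>
      ¬ PhaseSucceeds A N d c G ident (phaseSeeds A N L (e.symm Φ)) t) δ (by
        intro Φ
        refine le_trans (le_of_eq ?_) (card_not_splitSucceeds_le hκ hA hG
          (isSplitting_repAt (A := A) (N := N) (d := d) (c := c)
            (ψ := phaseSeeds A N L (e.symm Φ)) h2 hi t))
        congr 2
        refine congrArg (fun Q : (V → Fin r → Fin N → A.Seed) → Prop => Subtype Q) ?_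
        funext z
        refine congrArg Not ?_
        unfold PhaseSucceeds
        rw [repAt_congr (ψ' := phaseSeeds A N L (e.symm Φ))]
        · congr 1
          funext v
          simp [phaseSeeds, e, Equiv.piComm, Function.swap]
        · intro i hit
          funext v
          have hiL : i < L := hit.trans t.2
          have hne : (⟨i, hiL⟩ : Fin L) ≠ t := fun h => by
            have := congrArg Fin.val h
            simp only at this
            omega
          simp [phaseSeeds, e, Equiv.piComm, Function.swap, hiL, Function.update_of_ne hne])
    have h₁ : Nat.card {φ : V → Fin L → Fin r → Fin N → A.Seed //
        ¬ PhaseSucceeds A N d c G ident (phaseSeeds A N L φ) t} =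
        Nat.card {Φ : Fin L → V → Fin r → Fin N → A.Seed //
          ¬ PhaseSucceeds A N d c G ident (phaseSeeds A N L (e.symm Φ)) t} :=
      Nat.card_congr (Equiv.subtypeEquiv e fun φ => by simp)
    rw [h₁, Nat.card_congr e]
    exact hupd
  have hunion : Nat.card {φ : V → Fin L → Fin r → Fin N → A.Seed // ¬ IsPrivateTreesOutput G ident
      (d * Δ) (c * d * L) (finalOutput A N d c L G ident (phaseSeeds A N L φ))} ≤
      ∑ t : Fin L, Nat.card {φ : V → Fin L → Fin r → Fin N → A.Seed //
        ¬ PhaseSucceeds A N d c G ident (phaseSeeds A N L φ) t} := by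
    rw [← Nat.card_sigma]
    have hex : ∀ φ : {φ : V → Fin L → Fin r → Fin N → A.Seed // ¬ IsPrivateTreesOutput G ident
        (d * Δ) (c * d * L) (finalOutput A N d c L G ident (phaseSeeds A N L φ))},
        ∃ t : Fin L, ¬ PhaseSucceeds A N d c G ident (phaseSeeds A N L φ.1) t := by
      intro φ
      by_contra! hcon
      exact φ.2 (isPrivateTreesOutput_finalOutput h2 hi hid hΔ hL fun t ht => hcon ⟨t, ht⟩)
    choose t ht using hex
    refine Nat.card_le_card_of_injective (fun φ => ⟨t φ, φ.1, ht φ⟩) ?_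
    intro φ φ' h
    have := congrArg (fun x : (Σ t : Fin L, {φ : V → Fin L → Fin r → Fin N → A.Seed //
        ¬ PhaseSucceeds A N d c G ident (phaseSeeds A N L φ) t}) => x.2.1) h
    exact Subtype.ext this
  have hcast : (Nat.card {φ : V → Fin L → Fin r → Fin N → A.Seed // ¬ IsPrivateTreesOutput G ident
      (d * Δ) (c * d * L) (finalOutput A N d c L G ident (phaseSeeds A N L φ))} : ℝ) ≤
      ∑ t : Fin L, (Nat.card {φ : V → Fin L → Fin r → Fin N → A.Seed //
        ¬ PhaseSucceeds A N d c G ident (phaseSeeds A N L φ) t} : ℝ) := by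
    exact_mod_cast hunion
  refine hcast.trans ((Finset.sum_le_sum fun t _ => hphase t).trans (le_of_eq ?_))
  rw [Finset.sum_const, Finset.card_univ, Fintype.card_fin, nsmul_eq_mul, mul_assoc]

end Probability

end PrivateTrees

namespace PrivateTrees

/-! ### Running time -/

section RunningTime

variable {r M' : ℕ} (A : Algorithm r M' (ℕ → Finset ℕ)) (N d c L : ℕ) [NeZero N]
  {M qN qA qT : ℕ}

/-- The initial knowledge of the nodes together with the records of the first `t` phases. -/
noncomputable def phaseValue (t : ℕ) : LocalValue (Fin L → Fin r → Fin N → A.Seed)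
    ((ℕ × Finset ℕ × (Fin L → Fin r → Fin N → A.Seed)) × (ℕ → PhaseRecord N)) :=
  fun _ _ G ident φ v => ((ident v, neighborIdents G ident v, φ v),
    records A N d c G ident (phaseSeeds A N L φ) t v)

variable {A N d c L}

/-- A phase consists of one exchange of class names, `r` simulated rounds and `d` token steps, each
multiplied by the number of letters per message. -/
theorem computableIn_phaseValue (hN : Transmissible M qN (Fin N))
    (hA : Transmissible M qA (Fin M')) (hT : Transmissible M qT (Fin c → Option (Token N)))
    (t : ℕ) : ComputableIn M (t * (qN + r * qA + d * qT)) (phaseValue A N d c L t) := by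
  classical
  have := A.seedNonempty
  induction t with
  | zero =>
    rw [Nat.zero_mul]
    exact computableIn_init.map fun x => (x, fun _ => default)
  | succ t ih =>
    have h₁ := (ih.exchange hN (fun x y =>
      some (Fin.ofNat N (classRep x.1.2.1 (Linked N d x.2 t) y)))).map (fun x =>
        (x.1, (⟨x.1.1.1, x.1.1.2.1, classRep x.1.1.2.1 (Linked N d x.1.2 t),
          fun y => (x.2 y).elim 0 Fin.val⟩ : ClusterInfo)))
    have h₂ := (h₁.iterate hA (fun x => (x.2, if h : t < L then x.1.1.2.2 ⟨t, h⟩ else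
      Classical.arbitrary _)) (simInit A N) (fun _ => simMsg A N) (simUpd A N) r).map (fun x =>
        (x.1.1, x.1.2, fun a => A.output (x.2 a).1))
    have h₃ := (h₂.iterate hT (fun x => (⟨x.2.1, x.2.2, linkEmit N x.2.1⟩ : TokenEnv N))
      tokenInit (fun _ => tokenMsg c) (tokenUpd c) d).map (fun x =>
        (x.1.1.1, Function.update x.1.1.2 t (⟨x.1.2.1, x.1.2.2, x.2.2⟩ : PhaseRecord N)))
    have e : (t + 1) * (qN + r * qA + d * qT) =
        t * (qN + r * qA + d * qT) + qN + r * qA + d * qT := by ring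
    rw [e]
    exact h₃.congr fun _ _ _ _ _ _ => rfl

/-- The knowledge of the nodes together with the tokens received in the first `t` phases of the
construction of the trees. -/
noncomputable def treeValue (A : Algorithm r M' (ℕ → Finset ℕ)) (N d c L : ℕ) [NeZero N] (t : ℕ) :
    LocalValue (Fin L → Fin r → Fin N → A.Seed)
      (((ℕ × Finset ℕ × (Fin L → Fin r → Fin N → A.Seed)) × (ℕ → PhaseRecord N)) ×
        (ℕ → ℕ → ℕ → ℕ → ℕ → Option (Token N))) :=
  fun V _ G ident φ v => (phaseValue A N d c L L V G ident φ v,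
    fun i => if i < t then treeHistory N d c L G ident
      (records A N d c G ident (phaseSeeds A N L φ) L) v i else fun _ _ _ _ => none)

theorem computableIn_treeValue {T : ℕ} (h : ComputableIn M T (phaseValue A N d c L L))
    (hT : Transmissible M qT (Fin c → Option (Token N))) (t : ℕ) :
    ComputableIn M (T + t * (d * qT)) (treeValue A N d c L t) := by
  induction t with
  | zero =>
    rw [Nat.zero_mul]
    refine (h.map fun x => (x, fun (_ _ _ _ _ : ℕ) => (none : Option (Token N)))).congr ?_
    intro V _ G ident φ v
    simp [treeValue]
  | succ t ih =>
    have h₁ := (ih.iterate hT (fun x => (⟨(x.1.2 t).info, (x.1.2 t).labels,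
      treeEmit N d L x.1.1.1 x.1.1.2.1 x.1.2 t⟩ : TokenEnv N))
      tokenInit (fun _ => tokenMsg c) (tokenUpd c) d).map (fun x =>
        (x.1.1, fun i => if i = t then x.2.2 else x.1.2 i))
    have e : T + (t + 1) * (d * qT) = T + t * (d * qT) + d * qT := by ring
    rw [e]
    refine h₁.congr fun V _ G ident φ v => Prod.ext rfl ?_
    funext i
    rcases lt_trichotomy i t with hi | rfl | hi
    · simp only [treeValue, if_pos hi, if_neg hi.ne, if_pos (hi.trans (Nat.lt_succ_self t))]
    · simp only [treeValue, if_true, Nat.lt_succ_self]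
      rfl
    · have h₁ : ¬ i < t + 1 := by omega
      simp only [treeValue, if_neg h₁, if_neg hi.not_gt, if_neg hi.ne']

omit [NeZero N] in
theorem treeOutput_congr {id : ℕ} {h h' : ℕ → ℕ → ℕ → ℕ → ℕ → Option (Token N)}
    (hh : ∀ t < L, h t = h' t) : treeOutput N d L id h = treeOutput N d L id h' := by
  have : IsCandidate N d L h = IsCandidate N d L h' := by
    funext o k y
    refine propext (exists_congr fun t => and_congr_right fun ht => ?_)
    rw [hh t ht]
  classical
  -- The output depends on the candidates also through a proof used by `Nat.find_spec`; as a
  -- function of the relation it can be rewritten as a whole.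
  let F (P : ℕ → ℕ → ℕ → Prop) (o : ℕ) : Option ℕ :=
    if hex : o ≠ id ∧ ∃ k y, P o k y then
      if (Nat.find_spec hex.2).choose = o then none else some (Nat.find_spec hex.2).choose
    else none
  exact (congrArg F this : F _ = F _)

theorem computableIn_finalOutput (hN : Transmissible M qN (Fin N))
    (hA : Transmissible M qA (Fin M')) (hT : Transmissible M qT (Fin c → Option (Token N))) :
    ComputableIn M (L * (qN + r * qA + d * qT) + L * (d * qT))
      (fun _ _ G ident φ v => finalOutput A N d c L G ident (phaseSeeds A N L φ) v :
        LocalValue (Fin L → Fin r → Fin N → A.Seed) (ℕ → Option ℕ)) := by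
  refine ((computableIn_treeValue (computableIn_phaseValue hN hA hT L) hT L).map
    fun x => treeOutput N d L x.1.1.1 x.2).congr fun V _ G ident φ v => ?_
  refine treeOutput_congr fun t ht => ?_
  simp [treeValue, ht]

/-! ### Alphabet sizes and the number of rounds. -/

theorem transmissible_ident {n κ β : ℕ} (hκ : 1 ≤ κ) (hβ : 1 ≤ β) :
    Transmissible (n ^ β) κ (Fin (n ^ κ)) := by
  refine transmissible_of_card_le ?_
  rw [Nat.card_fin]
  have h₁ : n ≤ n ^ β := Nat.le_self_pow (by omega) n
  exact Nat.pow_lt_pow_left (by omega) (by omega)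

/-- `(n ^ 2) ^ β = (n ^ β) ^ 2`, so a message on the larger network is two letters on the smaller
one; silence as an extra symbol leaves room for `none`. -/
theorem transmissible_letter {n β : ℕ} : Transmissible (n ^ β) 2 (Fin ((n ^ 2) ^ β)) := by
  refine transmissible_of_card_le ?_
  rw [Nat.card_fin, ← pow_mul, Nat.mul_comm, pow_mul]
  exact Nat.pow_lt_pow_left (by omega) (by omega)

/-- A slot, empty or with two numbers below `n ^ κ`, fits into `2 * κ` letters; the one letter
beyond the `c` slots distinguishes a vector from silence. -/
theorem transmissible_token {n κ β : ℕ} (hκ : 1 ≤ κ) (hβ : 1 ≤ β) (hn : 1 ≤ n) (c : ℕ) :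
    Transmissible (n ^ β) (2 * κ * c + 1) (Fin c → Option (Token (n ^ κ))) := by
  refine transmissible_of_card_le ?_
  have hcard : Nat.card (Fin c → Option (Token (n ^ κ))) = (n ^ κ * n ^ κ + 1) ^ c := by
    simp [Nat.card_eq_fintype_card]
  rw [hcard]
  have h₁ : n ≤ n ^ β := Nat.le_self_pow (by omega) n
  have h₂ : n ^ κ * n ^ κ + 1 ≤ (n ^ β + 1) ^ (2 * κ) := by
    rw [← pow_add, ← two_mul]
    exact Nat.pow_lt_pow_left (by omega) (by omega)
  have h₃ : (n ^ κ * n ^ κ + 1) ^ c ≤ (n ^ β + 1) ^ (2 * κ * c) := by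
    rw [pow_mul _ (2 * κ)]
    exact Nat.pow_le_pow_left h₂ c
  have h₄ : 1 ≤ (n ^ β + 1) ^ (2 * κ * c) := Nat.one_le_pow _ _ (by omega)
  have h₅ : (n ^ β + 1) ^ (2 * κ * c) * 2 ≤ (n ^ β + 1) ^ (2 * κ * c) * (n ^ β + 1) :=
    Nat.mul_le_mul_left _ (by omega)
  rw [pow_succ]
  omega

/-- All terms of a phase are bounded by multiples of `r + d * c`, using `1 ≤ d * c` for the exchange
of class names; the starting round is absorbed by the `+ 1` in `l + 1`. -/
theorem rounds_le {κ d c r L l : ℕ} (hL : L ≤ l) (hdc : 1 ≤ d * c) :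
    L * (κ + r * 2 + d * (2 * κ * c + 1)) + L * (d * (2 * κ * c + 1)) + 1 ≤
      (5 * κ + 5) * (l + 1) ^ 1 * (r + d * c) := by
  have hd : d ≤ d * c := Nat.le_mul_of_pos_right d (Nat.pos_of_mul_pos_left hdc)
  have h₁ : κ + r * 2 + d * (2 * κ * c + 1) + d * (2 * κ * c + 1) ≤
      (5 * κ + 4) * (r + d * c) := by
    have : κ ≤ κ * (d * c) := Nat.le_mul_of_pos_right κ hdc
    have e : d * (2 * κ * c + 1) = 2 * (κ * (d * c)) + d := by ring
    have e' : (5 * κ + 4) * (r + d * c) =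
        5 * (κ * (d * c)) + 4 * (d * c) + 5 * (κ * r) + 4 * r := by
      ring
    rw [e, e']
    omega
  calc L * (κ + r * 2 + d * (2 * κ * c + 1)) + L * (d * (2 * κ * c + 1)) + 1
      = L * (κ + r * 2 + d * (2 * κ * c + 1) + d * (2 * κ * c + 1)) + 1 := by ring
    _ ≤ l * ((5 * κ + 4) * (r + d * c)) + (r + d * c) :=
        Nat.add_le_add (Nat.mul_le_mul hL h₁) (by omega)
    _ ≤ (5 * κ + 5) * (l + 1) ^ 1 * (r + d * c) := by
        rw [pow_one]
        nlinarith [Nat.zero_le (κ * (r + d * c)), Nat.zero_le (l * (r + d * c))]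

end RunningTime

/-! ### Degenerate parameters -/

theorem failureProb_nonneg {r M : ℕ} {Out : Type} (A : Algorithm r M Out) {V : Type} [Fintype V]
    (G : SimpleGraph V) (ident : V → ℕ) (P : (V → Out) → Prop) : 0 ≤ A.failureProb G ident P :=
  div_nonneg (Nat.cast_nonneg _) (Nat.cast_nonneg _)

theorem failureProb_le_one {r M : ℕ} {Out : Type} (A : Algorithm r M Out) {V : Type} [Fintype V]
    (G : SimpleGraph V) (ident : V → ℕ) (P : (V → Out) → Prop) : A.failureProb G ident P ≤ 1 := by
  have := A.seedFinite
  refine div_le_one_of_le₀ ?_ (Nat.cast_nonneg _)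
  exact_mod_cast Nat.card_le_card_of_injective _ Subtype.val_injective

theorem failureProb_eq_one {r M : ℕ} {Out : Type} (A : Algorithm r M Out) {V : Type} [Fintype V]
    (G : SimpleGraph V) (ident : V → ℕ) {P : (V → Out) → Prop} (hP : ∀ out, ¬ P out) :
    A.failureProb G ident P = 1 := by
  have := A.seedFinite
  have := A.seedNonempty
  have h : Nat.card {ω : V → Fin r → A.Seed // ¬ P (A.result G ident ω)} =
      Nat.card (V → Fin r → A.Seed) :=
    Nat.card_congr (Equiv.subtypeUnivEquiv fun ω => hP _)
  rw [Algorithm.failureProb, h]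
  exact div_self (by exact_mod_cast Nat.card_pos.ne')

theorem IsNetwork.mono {n n' D D' Δ κ : ℕ} {V : Type} [Fintype V] {G : SimpleGraph V}
    {ident : V → ℕ} (h : IsNetwork n D Δ κ G ident) (hn : n ≤ n') (hD : D ≤ D') :
    IsNetwork n' D' Δ κ G ident :=
  ⟨h.1, h.2.1.trans hn, h.2.2.1.trans hD, h.2.2.2.1, h.2.2.2.2.1, fun v =>
    (h.2.2.2.2.2 v).trans_le (Nat.pow_le_pow_left hn κ)⟩

theorem IsNetwork.card_neighborIdents_le {n D Δ κ : ℕ} {V : Type} [Fintype V] {G : SimpleGraph V}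
    {ident : V → ℕ} (h : IsNetwork n D Δ κ G ident) (v : V) :
    (neighborIdents G ident v).card ≤ min Δ n := by
  classical
  refine le_min ?_ ?_
  · refine le_trans ?_ (h.2.2.2.1 v)
    rw [neighborIdents, ← Set.ncard_coe_finset, Finset.coe_image]
    refine (Set.ncard_image_le (Finset.finite_toSet _)).trans (le_of_eq ?_)
    congr 1
    ext w
    simp
  · exact (Finset.card_image_le.trans (Finset.card_le_univ _)).trans h.2.1

/-- There is an edge to be covered; its cycle forces `1 ≤ c` and has length at least three, which
forces `3 ≤ d`. -/
theorem IsNetwork.not_isCycleCoverOutput {n D Δ κ d c : ℕ} {V : Type} [Fintype V]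
    {G : SimpleGraph V} {ident : V → ℕ} (h : IsNetwork n D Δ κ G ident) (hdc : d * c = 0)
    (out : V → ℕ → Finset ℕ) : ¬ IsCycleCoverOutput G ident d c out := by
  rintro ⟨I, C, hC, -⟩
  have h3 := h.1.1
  obtain ⟨u⟩ : Nonempty V := Fintype.card_pos_iff.1 (by omega)
  have h2 := h.1.two_le_card h.2.2.2.2.1 u
  obtain ⟨x, hx⟩ := Finset.card_pos.1 (show 0 < (neighborIdents G ident u).card by omega)
  obtain ⟨v, hv, -⟩ := mem_neighborIdents.1 hx
  obtain ⟨h₁, h₂⟩ := hC.2 s(u, v) hv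
  have hc : 0 < c := by omega
  obtain ⟨i, hi, -⟩ : {i | i ∈ I ∧ s(u, v) ∈ C i}.Nonempty := by
    by_contra hcon
    rw [Set.not_nonempty_iff_eq_empty] at hcon
    rw [hcon, Set.ncard_empty] at h₁
    omega
  obtain ⟨w, p, hp, hl, -⟩ := hC.1 i hi
  have := hp.three_le_length
  have hd : 0 < d := by omega
  have := Nat.mul_pos hd hc
  omega

theorem IsPrivateTreesOutput.mono {V : Type} {G : SimpleGraph V} {ident : V → ℕ} {d c c' : ℕ}
    {out : V → ℕ → Option ℕ} (h : IsPrivateTreesOutput G ident d c out) (hc : c ≤ c') :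
    IsPrivateTreesOutput G ident d c' out := by
  obtain ⟨T, h₁, h₂⟩ := h
  exact ⟨T, ⟨h₁.1, fun e he => (h₁.2 e he).trans hc⟩, h₂⟩

end PrivateTrees

/-- Messages on networks with size parameter `N` have `β log N` bits (alphabet of size `N ^ β`) and
identifiers have `κ log N` bits. The given algorithm is run on networks with parameters `n ^ 2`,
`3 * D + 2`, `Δ`, the constructed one on networks with parameters `n`, `D`, `Δ`. -/
theorem mainTheorem4 (κ β : ℕ) (hκ : 1 ≤ κ) (hβ : 1 ≤ β) :
    ∃ K k : ℕ, ∀ (n D Δ d c r : ℕ) (δ : ℝ)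
      (A : PrivateTrees.Algorithm r ((n ^ 2) ^ β) (ℕ → Finset ℕ)),
      PrivateTrees.ConstructsCycleCovers A (n ^ 2) (3 * D + 2) Δ κ d c δ →
      ∃ r' : ℕ, r' ≤ K * (Nat.log 2 n + 1) ^ k * (r + d * c) ∧
        ∃ B : PrivateTrees.Algorithm r' (n ^ β) (ℕ → Option ℕ),
          PrivateTrees.ConstructsPrivateTrees B n D Δ κ (d * Δ) (c * d * Nat.log 2 Δ)
            (Nat.log 2 Δ * δ) := by
  open PrivateTrees in
  refine ⟨5 * κ + 5, 1, fun n D Δ d c r δ A hA => ?_⟩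
  have hsame : ∀ (V : Type) [Fintype V] (G : SimpleGraph V) (ident : V → ℕ),
      IsNetwork n D Δ κ G ident → IsNetwork (n ^ 2) (3 * D + 2) Δ κ G ident :=
    fun V _ G ident h => h.mono (Nat.le_self_pow two_ne_zero n) (by omega)
  by_cases hdeg : 3 ≤ n ∧ d * c ≠ 0
  · obtain ⟨hn, hdc⟩ := hdeg
    have : NeZero (n ^ κ) := ⟨(Nat.pow_pos (by omega)).ne'⟩
    have := A.seedFinite
    have := A.seedNonempty
    -- The minimum bounds the rounds by `log n` even if `Δ` exceeds `n`; degrees are below `2 ^ (L +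
    -- 1)` either way, being at most `Δ` and at most `n`.
    let L := min (Nat.log 2 Δ) (Nat.log 2 n)
    obtain ⟨B, hB⟩ := (computableIn_finalOutput (A := A) (N := n ^ κ) (d := d) (c := c) (L := L)
      (transmissible_ident hκ hβ) transmissible_letter
      (transmissible_token hκ hβ (by omega) c)).exists_algorithm
    refine ⟨_, rounds_le (min_le_right _ _) (Nat.one_le_iff_ne_zero.2 hdc), B, ?_⟩
    intro V _ G ident hG
    -- Needed to pass from `L * δ` to `Nat.log 2 Δ * δ`. The network itself belongs to the larger
    -- class, so `δ` bounds an actual probability.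
    have hδ : 0 ≤ δ := (failureProb_nonneg _ _ _ _).trans (hA V G ident (hsame V G ident hG))
    have hL : ∀ v, (neighborIdents G ident v).card < 2 ^ (L + 1) := by
      intro v
      have h₁ := hG.card_neighborIdents_le v
      rcases min_choice (Nat.log 2 Δ) (Nat.log 2 n) with h | h
      · exact (h₁.trans (min_le_left _ _)).trans_lt
          (by simp only [L, h]; exact Nat.lt_pow_succ_log_self (by norm_num) Δ)
      · exact (h₁.trans (min_le_right _ _)).trans_lt
          (by simp only [L, h]; exact Nat.lt_pow_succ_log_self (by norm_num) n)
    have hmain := card_not_finalOutput_le (L := L) rfl hA hG hL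
    rw [hB, div_le_iff₀ (by exact_mod_cast Nat.card_pos)]
    have hsub : Nat.card {φ : V → Fin L → Fin r → Fin (n ^ κ) → A.Seed //
        ¬ IsPrivateTreesOutput G ident (d * Δ) (c * d * Nat.log 2 Δ)
          (finalOutput A (n ^ κ) d c L G ident (phaseSeeds A (n ^ κ) L φ))} ≤
        Nat.card {φ : V → Fin L → Fin r → Fin (n ^ κ) → A.Seed //
        ¬ IsPrivateTreesOutput G ident (d * Δ) (c * d * L)
          (finalOutput A (n ^ κ) d c L G ident (phaseSeeds A (n ^ κ) L φ))} := by
      refine Nat.card_le_card_of_injective (fun φ => ⟨φ.1, fun h => φ.2 (h.mono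
        (Nat.mul_le_mul_left _ (min_le_left _ _)))⟩) ?_
      intro φ φ' h
      exact Subtype.ext (Subtype.mk.inj h)
    refine le_trans (by exact_mod_cast hsub) (hmain.trans ?_)
    refine mul_le_mul_of_nonneg_right (mul_le_mul_of_nonneg_right ?_ hδ) (Nat.cast_nonneg _)
    exact_mod_cast min_le_left _ _
  -- Degenerate parameters: for `n < 3` there are no networks. For `d * c = 0` no cycle cover
  -- exists, so `δ ≥ 1` on any network; as degrees are at least two, `Nat.log 2 Δ * δ ≥ 1`, and an
  -- algorithm that does nothing suffices.
  · refine ⟨0, Nat.zero_le _, ⟨Unit, Unit, inferInstance, inferInstance, fun _ _ => (),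
      fun _ _ _ _ => ((), fun _ => none), fun _ _ => none⟩, ?_⟩
    intro V _ G ident hG
    have hn : 3 ≤ n := hG.1.1.trans hG.2.1
    have hdc : d * c = 0 := by
      by_contra h
      exact hdeg ⟨hn, h⟩
    have hδ : 1 ≤ δ := by
      have := hA V G ident (hsame V G ident hG)
      rwa [failureProb_eq_one _ _ _ (hG.not_isCycleCoverOutput hdc)] at this
    have hlog : 1 ≤ Nat.log 2 Δ := by
      have h3 := hG.1.1
      obtain ⟨u⟩ : Nonempty V := Fintype.card_pos_iff.1 (by omega)
      have h₁ := (hG.1.two_le_card hG.2.2.2.2.1 u).trans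
        ((hG.card_neighborIdents_le u).trans (min_le_left _ _))
      exact Nat.log_pos (by norm_num) h₁
    refine (failureProb_le_one _ _ _ _).trans ?_
    have : (1 : ℝ) ≤ Nat.log 2 Δ := by exact_mod_cast hlog
    nlinarith
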